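/- Let $p\ge 2$ and $n\ge 0$ be integers, $w\in\mathbb R$, $D=\partial/\partial x$, and $\omega=e^{\pi i/(p+1)}$. For $\ell\ge 0$ let $\mathcal C(\omega^\ell)$ be the contour coming in from infinity along $\mathbb R_+\bar\omega^{\ell}$ to $0$ and going out along $\mathbb R_+\omega^\ell$. Let $\Gamma_p^+$ be a union of contours $\mathcal C(\omega^{2j})$, $0\le j\le[\frac{p+1}2]$, and $\Gamma_p^-$ a union of contours $\mathcal C(\omega^{2j+1})$, $0\le j\le[\frac p2]$; in the assertions on $\Psi^-$ assume that $w\notin\Gamma_p^-$ if $n>0$. For pseudo-differential operators in $D$ whose coefficients are formal power series in $x,t_1,t_2,\dots$ let $(\cdot)_+$ be the differential part, $(\cdot)_-$ the remaining part, $(\cdot)^*$ the formal adjoint, and $(D-w)^{-1}=\sum_{k\ge0}w^kD^{-1-k}$. (a) There are unique polynomials $\theta_0,\dots,\theta_{p-2}\in\mathbb C[t_1,\dots,t_{p-1}]$ such that, with $$V_p(y)=\frac{y^{p+1}}{p+1}+\sum_{i=0}^{p-2}\theta_i\frac{y^{i+1}}{i+1},$$ the equation $V_p'(u)=\zeta$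 has the solution $u=\zeta^{1/p}+\frac1p\sum_{i=1}^{p-1}i\,t_i\,\zeta^{(i-p)/p}+O(\zeta^{-1-1/p})$ as a series in large $\zeta$; and there is a unique polynomial $P\in\mathbb C[t_1,\dots,t_{p-1}]$ with $P(0)=0$ and $\partial P/\partial t_i=\big((V_p'(y))^{i/p}\big)_+\big|_{y=0}$ for $1\le i\le p-1$, where $(V_p'(y))^{1/p}=y+O(1)$ is expanded at $y=\infty$ and $(\cdot)_+$ is the polynomial part. (b) Let $L=D+\sum_{j\ge1}a_jD^{-j}$ satisfy the Lax equations $\partial L/\partial t_i=[(L^i)_+,L]$ of the KP hierarchy (only those with $1\le i\le p-1$ are needed), and let $\mathcal L=L^p$ have at $t=0$ the value $D^p-x-n(D-w)^{-1}$. Then at $t_{\ge p}=0$ $$\mathcal L=V_p'(D)-x-n(D-w)^{-1}.$$ Put $L^+=L$, $L^-=L^*$. Let $z\in\mathbb C\setminus\{0\}$, and let $\Psi^\pm$ be a formal power series in $x,t_1,t_2,\dots$ with $\partial\Psi^\pm/\partial t_i=\pm((L^\pm)^i)_+\Psi^\pm$ for the same $i$, which at $t=0$ converges for all $x\in\mathbb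 C$ to $$\sqrt{\pm\tfrac{p}{2\pi}}\;z^{\frac{p-1}2\mp n}e^{\mp\frac p{p+1}z^{p+1}}\int_{\Gamma_p^\pm}e^{\mp\frac{y^{p+1}}{p+1}\pm(x+z^p)y}(y-w)^{\pm n}\,dy.$$ Then at $t_{\ge p}=0$ it converges, for all $(x,t_1,\dots,t_{p-1})\in\mathbb C^p$, to $$\Psi^\pm=e^{\pm P(t)}\sqrt{\pm\tfrac{p}{2\pi}}\;z^{\frac{p-1}2\mp n}e^{\mp\frac p{p+1}z^{p+1}}\int_{\Gamma_p^\pm}e^{\mp V_p(y)\pm(x+z^p)y}(y-w)^{\pm n}\,dy ,$$ where the integrals converge absolutely (principal branches of the root and of the power of $z$). (c) Conversely these expressions do flow off the initial data along $t_1,\dots,t_{p-1}$: $V_p'(D)-x-n(D-w)^{-1}$ is the $p$-th power of an operator $L=D+\sum_{j\ge1}a_jD^{-j}$ that satisfies the Lax equations for $1\le i\le p-1$; the functions of (b) satisfy $\partial\Psi^\pm/\partial t_i=\pm((L^\pm)^i)_+\Psi^\pm$ for $1\le i\le p-1$; and they satisfy $\mathcal L^\pm\Psi^\pm=z^p\Psi^\pm$,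 where $\mathcal L^\pm=(L^\pm)^p$, in the sense that $(\mathcal L^\pm)_+\Psi^\pm-nG=z^p\Psi^\pm$ for some $G$ with $(\pm D-w)G=\Psi^\pm$. -/

import Mathlib

open scoped Polynomial

noncomputable section

namespace KPAiry

/-! ### Formal functions of `x, t₁, t₂, …` -/

/-- Formal power series over `ℂ` in countably many variables.
The variable `0` is the space variable `x`, the variable `i ≥ 1` is the time `t_i`. -/
abbrev Fn : Type := MvPowerSeries ℕ ℂ

/-- The partial derivative in the `i`-th variable (`i = 0`: in `x`; `i ≥ 1`: in `t_i`). -/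
def pd (i : ℕ) (f : Fn) : Fn := MvPowerSeries.pderiv ℂ i f

open Classical in
/-- Evaluation of all variables with index in `S` at `0`. -/
def setZero (S : Set ℕ) (f : Fn) : Fn :=
  fun m => if ∀ i ∈ S, m i = 0 then MvPowerSeries.coeff m f else 0

/-- The series `f` converges absolutely at the point `v`, with sum `c`. -/
def HasValue (f : Fn) (v : ℕ → ℂ) (c : ℂ) : Prop :=
  HasSum (fun m : ℕ →₀ ℕ => MvPowerSeries.coeff m f * m.prod fun i k => v i ^ k) c

/-! ### Formal pseudo-differential operators in `D = ∂/∂x` -/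

/-- `∑_{j ≤ N} a_j D^j` with coefficients `a_j` in the ring of formal functions. -/
@[ext]
structure PsiDO where
  /-- the coefficient of `D ^ j` -/
  coeff : ℤ → Fn
  bdd : ∃ N : ℤ, ∀ j, N < j → coeff j = 0

namespace PsiDO

/-- The polynomial `Q(D) = ∑ q_k D^k`, coefficients written to the left. -/
def ofPoly (Q : Fn[X]) : PsiDO where
  coeff j := if 0 ≤ j then Q.coeff j.toNat else 0
  bdd := by
    refine ⟨Q.natDegree, fun j hj => ?_⟩
    have h : 0 ≤ j := le_trans (Int.natCast_nonneg _) hj.le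
    rw [if_pos h]
    exact Polynomial.coeff_eq_zero_of_natDegree_lt (by omega)

instance : One PsiDO := ⟨ofPoly 1⟩

instance : Sub PsiDO where
  sub P Q :=
    { coeff := fun j => P.coeff j - Q.coeff j
      bdd := by
        obtain ⟨N, hN⟩ := P.bdd
        obtain ⟨M, hM⟩ := Q.bdd
        refine ⟨max N M, fun j hj => ?_⟩
        rw [hN j (lt_of_le_of_lt (le_max_left _ _) hj),
          hM j (lt_of_le_of_lt (le_max_right _ _) hj), sub_zero] }

instance : SMul Fn PsiDO where
  smul a P :=
    { coeff := fun j => a * P.coeff j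
      bdd := by
        obtain ⟨N, hN⟩ := P.bdd
        exact ⟨N, fun j hj => by rw [hN j hj, mul_zero]⟩ }

/-- Composition, determined by `(a D^i)(b D^j) = ∑_{k ≥ 0} (i choose k) a b^{(k)} D^{i+j-k}` for all
integers `i, j`. For each power `D^m` only finitely many pairs `(i, k)` contribute. -/
instance : Mul PsiDO where
  mul P Q :=
    { coeff := fun m => ∑ᶠ q : ℤ × ℕ,
        Ring.choose q.1 q.2 • (P.coeff q.1 * (pd 0)^[q.2] (Q.coeff (m - q.1 + q.2)))
      bdd := by
        obtain ⟨N, hN⟩ := P.bdd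
        obtain ⟨M, hM⟩ := Q.bdd
        have hz : ∀ k : ℕ, (pd 0)^[k] (0 : Fn) = 0 := fun k =>
          Function.iterate_fixed (by simp [pd]) k
        refine ⟨N + M, fun m hm => ?_⟩
        refine finsum_eq_zero_of_forall_eq_zero fun q => ?_
        by_cases h : N < q.1
        · rw [hN _ h, zero_mul, smul_zero]
        · rw [hM _ (by omega), hz, mul_zero, smul_zero] }

/-- Powers `P ^ k` under composition. -/
def npow (P : PsiDO) : ℕ → PsiDO
  | 0 => 1
  | k + 1 => P * npow P k

instance : Pow PsiDO ℕ := ⟨npow⟩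

/-- The differential part `P_+ = ∑_{j ≥ 0} a_j D^j`. -/
def plus (P : PsiDO) : PsiDO where
  coeff j := if 0 ≤ j then P.coeff j else 0
  bdd := by
    obtain ⟨N, hN⟩ := P.bdd
    exact ⟨N, fun j hj => by simp [hN j hj]⟩

/-- The formal adjoint, determined by `(a D^j)^* = (-D)^j a`, that is
`(a D^j)^* = (-1)^j ∑_{k ≥ 0} (j choose k) a^{(k)} D^{j-k}`. -/
def adjoint (P : PsiDO) : PsiDO where
  coeff m := ∑ᶠ k : ℕ, ((((-1 : ℤˣ) ^ (m + k) : ℤˣ) : ℤ) * Ring.choose (m + k) k) •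
    (pd 0)^[k] (P.coeff (m + k))
  bdd := by
    obtain ⟨N, hN⟩ := P.bdd
    have hz : ∀ k : ℕ, (pd 0)^[k] (0 : Fn) = 0 := fun k =>
      Function.iterate_fixed (by simp [pd]) k
    refine ⟨N, fun m hm => finsum_eq_zero_of_forall_eq_zero fun k => ?_⟩
    rw [hN _ (by omega), hz, smul_zero]

/-- The operator obtained by applying `∂/∂t_i` to every coefficient. -/
def timeDeriv (i : ℕ) (P : PsiDO) : PsiDO where
  coeff j := pd i (P.coeff j)
  bdd := by
    obtain ⟨N, hN⟩ := P.bdd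
    exact ⟨N, fun j hj => by simp [hN j hj, pd]⟩

/-- Evaluation of all coefficients at `0` in the variables with index in `S`. -/
def restrict (S : Set ℕ) (P : PsiDO) : PsiDO where
  coeff j := setZero S (P.coeff j)
  bdd := by
    obtain ⟨N, hN⟩ := P.bdd
    refine ⟨N, fun j hj => ?_⟩
    funext m
    rw [hN j hj]
    simp only [setZero, map_zero, ite_self]
    rfl

/-- The action `P_+ f = ∑_{j ≥ 0} a_j f^{(j)}` of the differential part of `P` on a function. -/
def plusApply (P : PsiDO) (f : Fn) : Fn := ∑ᶠ j : ℕ, P.coeff j * (pd 0)^[j] f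

/-- `(D - w)⁻¹ = ∑_{k ≥ 0} w^k D^{-1-k}`, which is also `e^{xw} D⁻¹ e^{-xw}`. -/
def invDSub (w : ℂ) : PsiDO where
  coeff j := if j < 0 then MvPowerSeries.C (w ^ (-1 - j).toNat) else 0
  bdd := ⟨0, fun j hj => if_neg (by omega)⟩

end PsiDO

/-- The operator `Q(D) - x - n (D - w)⁻¹`. -/
def laxOp (Q : Fn[X]) (n : ℕ) (w : ℂ) : PsiDO :=
  PsiDO.ofPoly Q - PsiDO.ofPoly (Polynomial.C (MvPowerSeries.X 0)) - (n : Fn) • PsiDO.invDSub w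

/-- `L = D + ∑_{j ≥ 1} a_j D^{-j}` satisfies the Lax equations `∂L/∂t_i = [(L^i)_+, L]` for the times
`t_i` with `i ∈ T`. The KP hierarchy is the case `T = {1, 2, 3, …}`. -/
structure IsLaxFlow (T : Set ℕ) (L : PsiDO) : Prop where
  coeff_gt : ∀ j, 1 < j → L.coeff j = 0
  coeff_one : L.coeff 1 = 1
  coeff_zero : L.coeff 0 = 0
  lax : ∀ i ∈ T, L.timeDeriv i = (L ^ i).plus * L - L * (L ^ i).plus

/-- `∂Ψ/∂t_i = ε (M^i)_+ Ψ` for the times `t_i` with `i ∈ T`; this is the evolution of the wave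
function for `ε = 1`, `M = L`, and of the adjoint wave function for `ε = -1`, `M = L^*`. -/
def IsWaveFlow (T : Set ℕ) (ε : ℤ) (M : PsiDO) (Ψ : Fn) : Prop :=
  ∀ i ∈ T, pd i Ψ = ε • (M ^ i).plusApply Ψ

/-- `M Ψ = μ Ψ` for an operator `M` with `M_- = -n (εD - w)⁻¹`: here `G` stands for
`(εD - w)⁻¹ Ψ`. -/
def IsEigenfunction (n : ℕ) (w : ℂ) (ε : ℤ) (M : PsiDO) (μ : ℂ) (Ψ : Fn) : Prop :=
  ∃ G : Fn, ε • pd 0 G - w • G = Ψ ∧ M.plusApply Ψ - n • G = μ • Ψ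

/-! ### The potential `V_p` and the polynomial `P` -/

/-- Polynomials in the times `t_1, …, t_{p-1}`; the variable `i : Fin (p - 1)` is `t_{i+1}`. -/
abbrev TimePoly (p : ℕ) : Type := MvPolynomial (Fin (p - 1)) ℂ

/-- `V_p(u) = u^{p+1}/(p+1) + ∑_{i=0}^{p-2} θ_i u^{i+1}/(i+1)`. -/
def potential (p : ℕ) (θ : Fin (p - 1) → TimePoly p) : (TimePoly p)[X] :=
  Polynomial.C (MvPolynomial.C (1 / ((p : ℂ) + 1))) * Polynomial.X ^ (p + 1) +
    ∑ i : Fin (p - 1),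
      Polynomial.C (MvPolynomial.C (1 / ((i : ℂ) + 1)) * θ i) * Polynomial.X ^ ((i : ℕ) + 1)

/-- The polynomials `θ_i` are those for which the solution `u` of `V_p'(u) = ζ`, as a series in large
`ζ`, is `ζ^{1/p} + (1/p) ∑_{i=1}^{p-1} i t_i ζ^{(i-p)/p} + O(ζ^{-1-1/p})`. The Laurent series `u` is
written in the variable `ζ^{-1/p}`: its `k`-th coefficient is that of `ζ^{-k/p}`. -/
def IsTimeParam (p : ℕ) (θ : Fin (p - 1) → TimePoly p) : Prop :=
  ∃ u : LaurentSeries (TimePoly p),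
    (∀ k < -1, u.coeff k = 0) ∧ u.coeff (-1) = 1 ∧ u.coeff 0 = 0 ∧
    (∀ i : Fin (p - 1), u.coeff ((p : ℤ) - ((i : ℤ) + 1)) =
      MvPolynomial.C (((i : ℂ) + 1) / (p : ℂ)) * MvPolynomial.X i) ∧
    u.coeff (p : ℤ) = 0 ∧
    Polynomial.aeval u (Polynomial.derivative (potential p θ)) = HahnSeries.single (-(p : ℤ)) 1

/-- `P(0) = 0` and `∂P/∂t_i = ((V_p'(y))^{i/p})_+` at `y = 0`, for `1 ≤ i ≤ p - 1`. Here
`r = (V_p'(y))^{1/p} = y + O(1)` is a Laurent series in the variable `y⁻¹`, and the value at `y = 0`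
of the polynomial part of `r^i` is its coefficient of `y^0`. -/
def IsPrefactor (p : ℕ) (θ : Fin (p - 1) → TimePoly p) (P : TimePoly p) : Prop :=
  MvPolynomial.constantCoeff P = 0 ∧
  ∃ r : LaurentSeries (TimePoly p),
    (∀ k < -1, r.coeff k = 0) ∧ r.coeff (-1) = 1 ∧
    r ^ p = Polynomial.aeval (HahnSeries.single (-1 : ℤ) (1 : TimePoly p))
      (Polynomial.derivative (potential p θ)) ∧
    ∀ i : Fin (p - 1), MvPolynomial.pderiv i P = (r ^ ((i : ℕ) + 1)).coeff 0

/-- A polynomial in `t_1, …, t_{p-1}` as a formal function of `x, t_1, t_2, …`. -/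
def timePolyToFn (p : ℕ) : TimePoly p →+* Fn :=
  (MvPolynomial.coeToMvPowerSeries.ringHom (σ := ℕ) (R := ℂ)).comp
    (MvPolynomial.rename fun i : Fin (p - 1) => (i : ℕ) + 1).toRingHom

/-- `V_p'(D) - x - n (D - w)⁻¹`. -/
def explicitLax (p n : ℕ) (w : ℂ) (θ : Fin (p - 1) → TimePoly p) : PsiDO :=
  laxOp ((Polynomial.derivative (potential p θ)).map (timePolyToFn p)) n w

/-! ### Contour integrals and wave functions -/

/-- `ω = e^{iπ/(p+1)}`. -/
def omega (p : ℕ) : ℂ := Complex.exp (Real.pi * Complex.I / ((p : ℂ) + 1))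

/-- The integral along the ray `ℝ₊ a`, oriented from `0` to `∞`. -/
def rayIntegral (a : ℂ) (f : ℂ → ℂ) : ℂ := ∫ r in Set.Ioi (0 : ℝ), f (r * a) * a

/-- The integral over the union `Γ` of the contours `C(ω^ℓ)`, `ℓ ∈ Γ`, where `C(ω^ℓ)` comes in from
infinity along the ray through the conjugate of `ω^ℓ` and goes out along the ray through `ω^ℓ`. -/
def contourIntegral (p : ℕ) (Γ : Finset ℕ) (f : ℂ → ℂ) : ℂ :=
  ∑ l ∈ Γ, (rayIntegral (omega p ^ l) f - rayIntegral ((starRingEnd ℂ) (omega p ^ l)) f)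

/-- Absolute convergence of the integral over every ray of `Γ`. -/
def ContourIntegrable (p : ℕ) (Γ : Finset ℕ) (f : ℂ → ℂ) : Prop :=
  ∀ l ∈ Γ, ∀ a ∈ ({omega p ^ l, (starRingEnd ℂ) (omega p ^ l)} : Set ℂ),
    MeasureTheory.IntegrableOn (fun r : ℝ => f (r * a) * a) (Set.Ioi 0)

/-- The point set of the contour `Γ`. -/
def contourSet (p : ℕ) (Γ : Finset ℕ) : Set ℂ :=
  {y | ∃ l ∈ Γ, ∃ r : ℝ, 0 ≤ r ∧ (y = r * omega p ^ l ∨ y = r * (starRingEnd ℂ) (omega p ^ l))}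

/-- The integrand `e^{-ε V(y) + ε (x + z^p) y} (y - w)^{ε n}`. -/
def integrand (p n : ℕ) (w : ℂ) (ε : ℤ) (V : ℂ[X]) (x z y : ℂ) : ℂ :=
  Complex.exp (-(ε : ℂ) * V.eval y + (ε : ℂ) * (x + z ^ p) * y) * (y - w) ^ (ε * (n : ℤ))

/-- `√(ε p / 2π) z^{(p-1)/2 - ε n} e^{-ε p z^{p+1}/(p+1)} ∫_Γ e^{-ε V(y) + ε (x + z^p) y} (y - w)^{ε n} dy`,
with principal branches of the square root and of the power of `z`. -/
def airyWave (p n : ℕ) (w : ℂ) (Γ : Finset ℕ) (ε : ℤ) (V : ℂ[X]) (x z : ℂ) : ℂ :=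
  ((ε : ℂ) * p / (2 * Real.pi)) ^ (1 / 2 : ℂ) * z ^ (((p : ℂ) - 1) / 2 - (ε : ℂ) * n) *
    Complex.exp (-(ε : ℂ) * (p / ((p : ℂ) + 1)) * z ^ (p + 1)) *
    contourIntegral p Γ (integrand p n w ε V x z)

/-- The wave function (`ε = 1`) and adjoint wave function (`ε = -1`) at `t = 0`, where
`V(y) = y^{p+1}/(p+1)`. -/
def initialWave (p n : ℕ) (w : ℂ) (Γ : Finset ℕ) (ε : ℤ) (x z : ℂ) : ℂ :=
  airyWave p n w Γ ε (Polynomial.C (1 / ((p : ℂ) + 1)) * Polynomial.X ^ (p + 1)) x z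

/-- The potential `V_p` at numerical times `t`. -/
def potentialAt (p : ℕ) (θ : Fin (p - 1) → TimePoly p) (t : Fin (p - 1) → ℂ) : ℂ[X] :=
  (potential p θ).map (MvPolynomial.eval t)

/-- `e^{ε P(t)}` times the Airy-like integral with potential `V_p`. -/
def explicitWave (p n : ℕ) (w : ℂ) (Γ : Finset ℕ) (ε : ℤ) (θ : Fin (p - 1) → TimePoly p)
    (P : TimePoly p) (x : ℂ) (t : Fin (p - 1) → ℂ) (z : ℂ) : ℂ :=
  Complex.exp ((ε : ℂ) * MvPolynomial.eval t P) * airyWave p n w Γ ε (potentialAt p θ t) x z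

/-- The point `(x, t_1, …, t_{p-1}, 0, 0, …)`. -/
def point (p : ℕ) (x : ℂ) (t : Fin (p - 1) → ℂ) (i : ℕ) : ℂ :=
  if i = 0 then x else if h : i - 1 < p - 1 then t ⟨i - 1, h⟩ else 0

end KPAiry

end

open scoped Polynomial

noncomputable section

namespace KPAiry

/-! ### Formal functions and the ring of formal pseudo-differential operators. -/

section

/-! ### Finite sums over boxes -/

/-! Everything is governed by the polynomials Q_i(y), the polynomial part of (V_p'(y))^{i/p}
(`flowPoly`). Let u be the series with V_p'(u) = ζ, and count orders in powers of ζ^{1/p}. A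
polynomial W over the times with W(u) = O(ζ^{-1/p}) is zero (`eq_zero_of_ev_le`), so identities
between polynomials can be tested on u up to such tails; and Q_i(u) = ζ^{i/p} + O(ζ^{-1/p})
(`ev_polyPart_pow_sub`). Comparing the derivatives of V_p'(u) = ζ and of Q_i(u) in the times with
their derivatives in ζ gives ∂V_p'/∂t_i = -Q_i' (`pderiv_potential`) and ∂Q_i/∂t_j = ∂Q_j/∂t_i
(`pderiv_flowPoly_comm`). The second identity at y = 0 is the closedness that produces P, with
∂P/∂t_i = Q_i(0) (`exists_primitive`).

Operators. Formal Laurent series and pseudo-differential operators are both complete for the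
filtration by order, with multiplicative leading coefficients, and successive approximation gives
unique monic p-th roots in both (`HasSlope.exists_eq`, `HasSlope.injOn`). The root L of 𝓛 = V_p'(D)
- x - n(D - w)⁻¹ differs from (V_p')^{1/p}(D) by an operator of order at most 1 - p, so (L^i)_+ =
Q_i(D) for 1 ≤ i < p. In 𝓛 only x fails to commute with Q_i(D), whence [Q_i(D), 𝓛] = [x, Q_i(D)] =
-Q_i'(D) = ∂𝓛/∂t_i. The derivation ∂/∂t_i - [Q_i(D), ·] thus kills L^p, hence L, which is the Lax
equation (`IsLaxRoot.isLaxFlow`).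

Wave functions. The exponent E = ε(P + xy - ∑ θ_i y^{i+1}/(i+1)) satisfies ∂E/∂x = εy and ∂E/∂t_i =
εQ_i(y). Any linear functional on ℂ[y], applied to the coefficients of the formal series e^E,
therefore gives a formal solution of the evolution equations (`formalWave_isWaveFlow`). Taking for
the functional the contour integral against the remaining factor e^{-εy^{p+1}/(p+1) + εz^p y}(y -
w)^{εn}, integration by parts gives the eigenvalue equation (`formalWave_isEigenfunction`). Along
the rays the sum of absolute values of the terms of e^E is e^{o(r^{p+1})}, which the factor
e^{-r^{p+1}/(p+1)} dominates, so integration is termwise and the formal series converges to the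
explicit integral (`hasValue_formalWave`).

Uniqueness. At t_{≥p} = 0, two solutions with the same value at t = 0 agree to every order in t,
because the evolution equations raise the order of agreement by one (`lax_unique`, `wave_unique`).
The initial wave function is determined as a formal series by its values for all x. -/

theorem sum_box_eq_sum_antidiagonal {B : Type*} [AddCommMonoid B] (K : ℕ) (f : ℕ → ℕ → B)
    (hf : ∀ i j, K ≤ i + j → f i j = 0) :
    ∑ i ∈ Finset.range K, ∑ j ∈ Finset.range K, f i j =
      ∑ e ∈ Finset.range K, ∑ q ∈ Finset.HasAntidiagonal.antidiagonal e, f q.1 q.2 := by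
  have h1 : ∀ i ∈ Finset.range K, ∑ j ∈ Finset.range K, f i j =
      ∑ e ∈ Finset.range K, if i ≤ e then f i (e - i) else 0 := by
    intro i hi
    rw [Finset.mem_range] at hi
    rw [← Finset.sum_filter]
    have h2 : (Finset.range K).filter (fun e => i ≤ e) = Finset.Ico i K := by
      ext e; simp; omega
    rw [h2, Finset.sum_Ico_eq_sum_range]
    rw [← Finset.sum_subset (Finset.range_mono (Nat.sub_le K i))]
    · refine Finset.sum_congr rfl fun j _ => by rw [Nat.add_sub_cancel_left]
    · intro j _ hj
      rw [Finset.mem_range] at hj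
      exact hf _ _ (by omega)
  rw [Finset.sum_congr rfl h1, Finset.sum_comm]
  refine Finset.sum_congr rfl fun e he => ?_
  rw [Finset.Nat.sum_antidiagonal_eq_sum_range_succ_mk, ← Finset.sum_filter]
  refine Finset.sum_congr ?_ fun _ _ => rfl
  ext i; simp only [Finset.mem_filter, Finset.mem_range] at *; omega

theorem sum_range_shift {B : Type*} [AddCommMonoid B] (K d : ℕ) (f : ℕ → B)
    (h0 : ∀ c, c < d → f c = 0) (h1 : ∀ c, K ≤ c → f c = 0) :
    ∑ c ∈ Finset.range K, f c = ∑ b ∈ Finset.range K, f (d + b) := by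
  rw [Finset.sum_subset (Finset.range_mono (Nat.le_add_left K d))
    (fun c _ hc => h1 c (by simpa using hc)), Finset.sum_range_add,
    Finset.sum_eq_zero (fun c hc => h0 c (Finset.mem_range.mp hc)), zero_add]

/-! ### Partial derivatives -/

theorem pd_sub (i : ℕ) (f g : Fn) : pd i (f - g) = pd i f - pd i g := map_sub _ _ _
theorem pd_zero (i : ℕ) : pd i 0 = 0 := map_zero _
theorem pd_zsmul (i : ℕ) (c : ℤ) (f : Fn) : pd i (c • f) = c • pd i f := map_zsmul _ _ _
theorem pd_sum {ι : Type*} (i : ℕ) (s : Finset ι) (f : ι → Fn) :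
    pd i (∑ a ∈ s, f a) = ∑ a ∈ s, pd i (f a) := map_sum _ _ _

theorem pd_mul (i : ℕ) (f g : Fn) : pd i (f * g) = pd i f * g + f * pd i g := by
  unfold pd
  rw [Derivation.leibniz, smul_eq_mul, smul_eq_mul]
  ring

theorem coeff_pd (i : ℕ) (f : Fn) (m : ℕ →₀ ℕ) :
    MvPowerSeries.coeff m (pd i f) =
      MvPowerSeries.coeff (m + Finsupp.single i 1) f * (m i + 1) :=
  MvPowerSeries.coeff_pderiv ..

theorem pd_comm (i j : ℕ) (f : Fn) : pd i (pd j f) = pd j (pd i f) := by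
  ext m
  simp only [coeff_pd]
  rcases eq_or_ne i j with rfl | h
  · rfl
  · rw [add_right_comm m, Finsupp.add_apply, Finsupp.add_apply, Finsupp.single_eq_of_ne h,
      Finsupp.single_eq_of_ne h.symm, add_zero, add_zero]
    ring

theorem pd_C (i : ℕ) (c : ℂ) : pd i (MvPowerSeries.C c) = 0 := by
  unfold pd
  exact MvPowerSeries.pderiv_C ..

theorem pd_one (i : ℕ) : pd i 1 = 0 := by
  rw [← map_one MvPowerSeries.C, pd_C]

/-- The iterated `x`-derivative as an additive map. -/
def dx (k : ℕ) : Fn →+ Fn := (((MvPowerSeries.pderiv ℂ 0 : Derivation ℂ Fn Fn) : Fn →ₗ[ℂ] Fn) ^ k :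
  Module.End ℂ Fn).toAddMonoidHom

theorem iterate_pd (k : ℕ) (f : Fn) : (pd 0)^[k] f = dx k f := by
  rw [dx, LinearMap.toAddMonoidHom_coe, Module.End.pow_apply]
  rfl

theorem dx_zero_apply (f : Fn) : dx 0 f = f := by
  rw [← iterate_pd]; rfl

theorem dx_succ (k : ℕ) (f : Fn) : dx (k + 1) f = pd 0 (dx k f) := by
  rw [← iterate_pd, ← iterate_pd, Function.iterate_succ_apply']

theorem dx_dx (k l : ℕ) (f : Fn) : dx k (dx l f) = dx (k + l) f := by
  rw [← iterate_pd, ← iterate_pd, ← iterate_pd, Function.iterate_add_apply]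

theorem pd_dx (i k : ℕ) (f : Fn) : pd i (dx k f) = dx k (pd i f) := by
  induction k with
  | zero => simp only [dx_zero_apply]
  | succ k ih => rw [dx_succ, dx_succ, pd_comm, ih]

theorem dx_mul (k : ℕ) (f g : Fn) :
    dx k (f * g) = ∑ q ∈ Finset.HasAntidiagonal.antidiagonal k, (k.choose q.1) • (dx q.1 f * dx q.2 g) := by
  induction k with
  | zero => simp [dx_zero_apply]
  | succ k ih =>
    rw [Finset.sum_antidiagonal_choose_succ_nsmul (fun i j => dx i f * dx j g) k, dx_succ, ih,
      pd_sum, ← Finset.sum_add_distrib]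
    refine Finset.sum_congr rfl fun q hq => ?_
    rw [Finset.HasAntidiagonal.mem_antidiagonal] at hq
    rw [dx_succ, dx_succ, ← Nat.choose_symm_of_eq_add hq.symm, ← smul_add, add_comm, ← pd_mul]
    exact map_nsmul (MvPowerSeries.pderiv ℂ 0 : Derivation ℂ Fn Fn) _ _

theorem dx_zsmul (k : ℕ) (c : ℤ) (f : Fn) : dx k (c • f) = c • dx k f := map_zsmul _ _ _

/-- A function which does not depend on `x` has vanishing higher `x`-derivatives. -/
theorem dx_of_pd_eq_zero {f : Fn} (hf : pd 0 f = 0) {k : ℕ} (hk : k ≠ 0) : dx k f = 0 := by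
  obtain ⟨k, rfl⟩ := Nat.exists_eq_succ_of_ne_zero hk
  rw [Nat.succ_eq_add_one, ← dx_dx, show dx 1 f = pd 0 f by rw [dx_succ, dx_zero_apply], hf,
    map_zero]

/-! ### The ring of pseudo-differential operators -/

namespace PsiDO

/-- `P` has order at most `N`. -/
def OrdLE (P : PsiDO) (N : ℤ) : Prop := ∀ j, N < j → P.coeff j = 0

theorem coeff_sub (P Q : PsiDO) (j : ℤ) : (P - Q).coeff j = P.coeff j - Q.coeff j := rfl

theorem coeff_mul_def (P Q : PsiDO) (m : ℤ) : (P * Q).coeff m = ∑ᶠ q : ℤ × ℕ,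
    Ring.choose q.1 q.2 • (P.coeff q.1 * (pd 0)^[q.2] (Q.coeff (m - q.1 + q.2))) := rfl

/-- A nonzero term needs a ≥ 0 and m - N + a + k ≤ M, so a + k ≤ N + M - m < K. The cut-off K is
left free so that the same box of indices serves several products at once. -/
theorem coeff_mul {P Q : PsiDO} {N M : ℤ} (hN : P.OrdLE N) (hM : Q.OrdLE M) (m : ℤ) (K : ℕ)
    (hK : N + M - m < K) : (P * Q).coeff m = ∑ a ∈ Finset.range K, ∑ k ∈ Finset.range K,
      Ring.choose (N - a) k • (P.coeff (N - a) * dx k (Q.coeff (m - N + a + k))) := by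
  rw [coeff_mul_def, ← Finset.sum_product' (Finset.range K) (Finset.range K)
    (fun a k : ℕ => Ring.choose (N - a) k • (P.coeff (N - a) * dx k (Q.coeff (m - N + a + k))))]
  have he : Function.Injective (fun q : ℕ × ℕ => ((N - q.1 : ℤ), q.2)) := by
    rintro ⟨a, b⟩ ⟨c, d⟩ h
    simp only [Prod.mk.injEq, sub_right_inj, Nat.cast_inj] at h
    rw [h.1, h.2]
  rw [finsum_eq_sum_of_support_subset (s := ((Finset.range K) ×ˢ (Finset.range K)).image
    (fun q : ℕ × ℕ => ((N - q.1 : ℤ), q.2))), Finset.sum_image (fun a _ b _ h => he h)]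
  · refine Finset.sum_congr rfl fun q _ => ?_
    simp only [iterate_pd]
    rw [show m - (N - (q.1 : ℤ)) + q.2 = m - N + q.1 + q.2 by ring]
  · rintro ⟨i, k⟩ h
    simp only [Function.mem_support, iterate_pd] at h
    have h1 : ¬ N < i := fun hi => h (by rw [hN i hi, zero_mul, smul_zero])
    have h2 : ¬ M < m - i + k := fun hi => h (by rw [hM _ hi, map_zero, mul_zero, smul_zero])
    simp only [Finset.coe_image, Set.mem_image, Finset.mem_coe, Finset.mem_product,
      Finset.mem_range, Prod.mk.injEq]
    exact ⟨((N - i).toNat, k), ⟨by omega, by omega⟩, by omega, rfl⟩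

theorem exists_ordLE (P : PsiDO) : ∃ N, P.OrdLE N := P.bdd

theorem OrdLE.mono {P : PsiDO} {N M : ℤ} (h : P.OrdLE N) (hNM : N ≤ M) : P.OrdLE M :=
  fun j hj => h j (lt_of_le_of_lt hNM hj)

theorem OrdLE.mul {P Q : PsiDO} {N M : ℤ} (hN : P.OrdLE N) (hM : Q.OrdLE M) :
    (P * Q).OrdLE (N + M) := by
  intro m hm
  rw [coeff_mul hN hM m 0 (by push_cast; omega)]
  simp

theorem coeff_mul_top {P Q : PsiDO} {N M : ℤ} (hN : P.OrdLE N) (hM : Q.OrdLE M) :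
    (P * Q).coeff (N + M) = P.coeff N * Q.coeff M := by
  rw [coeff_mul hN hM (N + M) 1 (by push_cast; omega)]
  simp [dx_zero_apply]

/-- Both sides are brought to one fourfold sum. On the left this is a change of indices; on the
right it uses the Leibniz rule, the identity (x choose i+j)(i+j choose i) = (x choose i)(x-i choose
j), and the Chu–Vandermonde identity for integer upper arguments. -/
theorem mul_assoc' (P Q R : PsiDO) : P * Q * R = P * (Q * R) := by
  obtain ⟨N, hN⟩ := P.exists_ordLE
  obtain ⟨M, hM⟩ := Q.exists_ordLE
  obtain ⟨O, hO⟩ := R.exists_ordLE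
  ext1
  funext m
  obtain ⟨K, hK⟩ : ∃ K : ℕ, N + M + O - m < K := ⟨(N + M + O - m).toNat + 1, by omega⟩
  -- both sides equal the following sum
  trans ∑ a ∈ Finset.range K, ∑ b ∈ Finset.range K, ∑ k ∈ Finset.range K, ∑ e ∈ Finset.range K,
    (Ring.choose (N - a) k * Ring.choose (N - a - k + (M - b)) e) •
      (P.coeff (N - a) * dx k (Q.coeff (M - b)) *
        dx e (R.coeff (m - N - M + a + b + k + e)))
  · rw [coeff_mul (hN.mul hM) hO m K (by omega)]
    have h1 : ∀ c ∈ Finset.range K, (P * Q).coeff (N + M - c) =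
        ∑ a ∈ Finset.range K, ∑ k ∈ Finset.range K, Ring.choose (N - a) k •
          (P.coeff (N - a) * dx k (Q.coeff (M - c + a + k))) := by
      intro c hc
      rw [Finset.mem_range] at hc
      rw [coeff_mul hN hM (N + M - c) K (by omega)]
      refine Finset.sum_congr rfl fun a _ => Finset.sum_congr rfl fun k _ => ?_
      rw [show N + M - (c : ℤ) - N + a + k = M - c + a + k by ring]
    have h2 : ∀ c ∈ Finset.range K, ∑ e ∈ Finset.range K, Ring.choose (N + M - (c : ℤ)) e •
        ((P * Q).coeff (N + M - c) * dx e (R.coeff (m - (N + M) + c + e))) =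
        ∑ a ∈ Finset.range K, ∑ k ∈ Finset.range K, ∑ e ∈ Finset.range K,
          (Ring.choose (N - a) k * Ring.choose (N + M - (c : ℤ)) e) •
          (P.coeff (N - a) * dx k (Q.coeff (M - c + a + k)) *
            dx e (R.coeff (m - (N + M) + c + e))) := by
      intro c hc
      rw [Finset.sum_congr rfl (fun e _ => by rw [h1 c hc])]
      simp only [Finset.sum_mul, Finset.smul_sum]
      rw [Finset.sum_comm]
      refine Finset.sum_congr rfl fun a _ => ?_
      rw [Finset.sum_comm]
      refine Finset.sum_congr rfl fun k _ => Finset.sum_congr rfl fun e _ => ?_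
      rw [smul_mul_assoc, smul_smul, mul_comm (Ring.choose (N + M - (c : ℤ)) e)]
    rw [Finset.sum_congr rfl h2, Finset.sum_comm]
    refine Finset.sum_congr rfl fun a _ => ?_
    rw [Finset.sum_comm]
    conv_rhs => rw [Finset.sum_comm]
    refine Finset.sum_congr rfl fun k _ => ?_
    -- The order N + M - c in `P * Q` comes from c = a + k + b with b ≥ 0: for smaller c the
    -- coefficient of `Q` lies above its order M.
    rw [sum_range_shift K (a + k)]
    · refine Finset.sum_congr rfl fun b _ => Finset.sum_congr rfl fun e _ => ?_
      push_cast
      rw [show M - ((a : ℤ) + k + b) + a + k = M - b by ring,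
        show N + M - ((a : ℤ) + k + b) = N - a - k + (M - b) by ring,
        show m - (N + M) + ((a : ℤ) + k + b) + e = m - N - M + a + b + k + e by ring]
    · intro c hc
      refine Finset.sum_eq_zero fun e _ => ?_
      rw [hM _ (by omega), map_zero, mul_zero, zero_mul, smul_zero]
    · intro c hc
      refine Finset.sum_eq_zero fun e _ => ?_
      rw [hO _ (by omega), map_zero, mul_zero, smul_zero]
  · symm
    rw [coeff_mul hN (hM.mul hO) m K (by omega)]
    refine Finset.sum_congr rfl fun a _ => ?_
    have h1 : ∀ k ∈ Finset.range K, Ring.choose (N - (a : ℤ)) k •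
        (P.coeff (N - a) * dx k ((Q * R).coeff (m - N + a + k))) =
        ∑ b ∈ Finset.range K, ∑ q ∈ Finset.HasAntidiagonal.antidiagonal k, ∑ l ∈ Finset.range K,
          (Ring.choose (N - (a : ℤ)) (q.1 + q.2) * ((q.1 + q.2).choose q.1 : ℤ)
            * Ring.choose (M - b) l) •
          (P.coeff (N - a) * dx q.1 (Q.coeff (M - b)) *
            dx (q.2 + l) (R.coeff (m - N - M + a + b + q.1 + q.2 + l))) := by
      intro k _
      rw [coeff_mul hM hO _ K (by omega), map_sum, Finset.mul_sum, Finset.smul_sum]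
      refine Finset.sum_congr rfl fun b _ => ?_
      rw [map_sum, Finset.mul_sum, Finset.smul_sum, Finset.sum_comm]
      refine Finset.sum_congr rfl fun l _ => ?_
      rw [dx_zsmul, dx_mul, Finset.smul_sum, Finset.mul_sum, Finset.smul_sum]
      refine Finset.sum_congr rfl fun q hq => ?_
      rw [Finset.HasAntidiagonal.mem_antidiagonal] at hq
      subst hq
      rw [dx_dx, ← natCast_zsmul, smul_smul, mul_smul_comm, smul_smul, mul_assoc]
      push_cast
      rw [show m - N + a + ((q.1 : ℤ) + q.2) - M + b + l =
        m - N - M + a + b + q.1 + q.2 + l by ring, mul_comm (Ring.choose (M - (b : ℤ)) l),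
        mul_assoc]
    rw [Finset.sum_congr rfl h1, Finset.sum_comm]
    refine Finset.sum_congr rfl fun b _ => ?_
    rw [← sum_box_eq_sum_antidiagonal K (fun i j => ∑ l ∈ Finset.range K,
          (Ring.choose (N - (a : ℤ)) (i + j) * ((i + j).choose i : ℤ)
            * Ring.choose (M - b) l) •
          (P.coeff (N - a) * dx i (Q.coeff (M - b)) *
            dx (j + l) (R.coeff (m - N - M + a + b + i + j + l))))]
    · refine Finset.sum_congr rfl fun k _ => ?_
      rw [sum_box_eq_sum_antidiagonal]
      · refine Finset.sum_congr rfl fun e _ => ?_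
        -- Here e = j + l is the total number of derivatives falling on `R`; Vandermonde sums the
        -- binomials over its splittings.
        rw [Ring.add_choose_eq e (Commute.all (N - (a : ℤ) - k) (M - b)), Finset.mul_sum,
          Finset.sum_smul]
        refine Finset.sum_congr rfl fun q hq => ?_
        rw [Finset.HasAntidiagonal.mem_antidiagonal] at hq
        subst hq
        push_cast
        have h3 := Ring.choose_smul_choose (N - (a : ℤ)) (Nat.le_add_right k q.1)
        rw [Nat.add_sub_cancel_left, nsmul_eq_mul] at h3
        rw [← mul_assoc (Ring.choose (N - (a : ℤ)) k), ← h3, mul_comm ((k + q.1).choose k : ℤ),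
          show m - N - M + a + b + k + q.1 + q.2 = m - N - M + a + b + k + (q.1 + q.2) by ring]
      · intro i j hij
        rw [hO _ (by omega), map_zero, mul_zero, smul_zero]
    · intro i j hij
      refine Finset.sum_eq_zero fun l _ => ?_
      rw [hO _ (by omega), map_zero, mul_zero, smul_zero]

instance : Zero PsiDO := ⟨⟨fun _ => 0, 0, fun _ _ => rfl⟩⟩
instance : Add PsiDO where
  add P Q :=
    { coeff := fun j => P.coeff j + Q.coeff j
      bdd := by
        obtain ⟨N, hN⟩ := P.bdd
        obtain ⟨M, hM⟩ := Q.bdd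
        refine ⟨max N M, fun j hj => ?_⟩
        rw [hN j (lt_of_le_of_lt (le_max_left _ _) hj),
          hM j (lt_of_le_of_lt (le_max_right _ _) hj), add_zero] }
instance : Neg PsiDO where
  neg P :=
    { coeff := fun j => - P.coeff j
      bdd := by
        obtain ⟨N, hN⟩ := P.bdd
        exact ⟨N, fun j hj => by rw [hN j hj, neg_zero]⟩ }
instance : SMul ℕ PsiDO where
  smul c P :=
    { coeff := fun j => c • P.coeff j
      bdd := by
        obtain ⟨N, hN⟩ := P.bdd
        exact ⟨N, fun j hj => by rw [hN j hj, smul_zero]⟩ }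
instance : SMul ℤ PsiDO where
  smul c P :=
    { coeff := fun j => c • P.coeff j
      bdd := by
        obtain ⟨N, hN⟩ := P.bdd
        exact ⟨N, fun j hj => by rw [hN j hj, smul_zero]⟩ }

theorem coeff_injective : Function.Injective PsiDO.coeff := fun _ _ h => PsiDO.ext h

instance : AddCommGroup PsiDO :=
  coeff_injective.addCommGroup PsiDO.coeff rfl (fun _ _ => rfl) (fun _ => rfl) (fun _ _ => rfl)
    (fun _ _ => rfl) (fun _ _ => rfl)

theorem coeff_add (P Q : PsiDO) (j : ℤ) : (P + Q).coeff j = P.coeff j + Q.coeff j := rfl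
theorem coeff_smul (a : Fn) (P : PsiDO) (j : ℤ) : (a • P).coeff j = a * P.coeff j := rfl
theorem coeff_ofPoly (Q : Fn[X]) (j : ℤ) :
    (ofPoly Q).coeff j = if 0 ≤ j then Q.coeff j.toNat else 0 := rfl
theorem coeff_plus (P : PsiDO) (j : ℤ) : P.plus.coeff j = if 0 ≤ j then P.coeff j else 0 := rfl
theorem coeff_timeDeriv (i : ℕ) (P : PsiDO) (j : ℤ) : (P.timeDeriv i).coeff j = pd i (P.coeff j) :=
  rfl

theorem coeff_one' (j : ℤ) : (1 : PsiDO).coeff j = if j = 0 then 1 else 0 := by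
  rw [show (1 : PsiDO) = ofPoly 1 from rfl, coeff_ofPoly, Polynomial.coeff_one]
  split_ifs <;> first | rfl | omega

theorem OrdLE.add {P Q : PsiDO} {N : ℤ} (hP : P.OrdLE N) (hQ : Q.OrdLE N) : (P + Q).OrdLE N :=
  fun j hj => by rw [coeff_add, hP j hj, hQ j hj, add_zero]
theorem OrdLE.sub {P Q : PsiDO} {N : ℤ} (hP : P.OrdLE N) (hQ : Q.OrdLE N) : (P - Q).OrdLE N :=
  fun j hj => by rw [coeff_sub, hP j hj, hQ j hj, sub_zero]

theorem exists_ordLE₂ (P Q : PsiDO) : ∃ N, P.OrdLE N ∧ Q.OrdLE N := by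
  obtain ⟨N, hN⟩ := P.exists_ordLE
  obtain ⟨M, hM⟩ := Q.exists_ordLE
  exact ⟨max N M, hN.mono (le_max_left _ _), hM.mono (le_max_right _ _)⟩

theorem ordLE_one : (1 : PsiDO).OrdLE 0 := fun j hj => by rw [coeff_one', if_neg hj.ne']

theorem add_mul' (P Q R : PsiDO) : (P + Q) * R = P * R + Q * R := by
  obtain ⟨N, hP, hQ⟩ := exists_ordLE₂ P Q
  obtain ⟨M, hM⟩ := R.exists_ordLE
  ext1; funext m
  have hK : N + M - m < ((N + M - m).toNat + 1 : ℕ) := by omega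
  rw [coeff_add, coeff_mul (hP.add hQ) hM m _ hK, coeff_mul hP hM m _ hK, coeff_mul hQ hM m _ hK]
  simp only [← Finset.sum_add_distrib, coeff_add, add_mul, smul_add]

theorem mul_add' (R P Q : PsiDO) : R * (P + Q) = R * P + R * Q := by
  obtain ⟨N, hP, hQ⟩ := exists_ordLE₂ P Q
  obtain ⟨M, hM⟩ := R.exists_ordLE
  ext1; funext m
  have hK : M + N - m < ((M + N - m).toNat + 1 : ℕ) := by omega
  rw [coeff_add, coeff_mul hM (hP.add hQ) m _ hK, coeff_mul hM hP m _ hK, coeff_mul hM hQ m _ hK]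
  simp only [← Finset.sum_add_distrib, coeff_add, map_add, mul_add, smul_add]

theorem one_mul' (P : PsiDO) : 1 * P = P := by
  obtain ⟨N, hP⟩ := P.exists_ordLE
  ext1; funext m
  have hK : 0 + N - m < ((N - m).toNat + 1 : ℕ) := by omega
  rw [coeff_mul ordLE_one hP m _ hK, Finset.sum_eq_single_of_mem 0 (by simp),
    Finset.sum_eq_single_of_mem 0 (by simp)]
  · simp [coeff_one', dx_zero_apply]
  · intro k _ hk
    rw [Nat.cast_zero, sub_zero, Ring.choose_zero_pos ℤ (Nat.pos_of_ne_zero hk), zero_smul]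
  · intro a _ ha
    refine Finset.sum_eq_zero fun k _ => ?_
    rw [coeff_one', if_neg (by omega), zero_mul, smul_zero]

theorem mul_one' (P : PsiDO) : P * 1 = P := by
  obtain ⟨N, hP⟩ := P.exists_ordLE
  ext1; funext m
  obtain ⟨K, hK⟩ : ∃ K : ℕ, N + 0 - m < K := ⟨(N - m).toNat + 1, by omega⟩
  have hz : ∀ (k : ℕ) (j : ℤ), k ≠ 0 → dx k ((1 : PsiDO).coeff j) = 0 := by
    intro k j hk
    rw [coeff_one']
    split_ifs
    · exact dx_of_pd_eq_zero (pd_one 0) hk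
    · exact map_zero _
  rw [coeff_mul hP ordLE_one m K hK]
  by_cases hm : N < m
  · rw [hP m hm]
    refine Finset.sum_eq_zero fun a _ => Finset.sum_eq_zero fun k _ => ?_
    rw [coeff_one', if_neg (by omega), map_zero, mul_zero, smul_zero]
  · rw [Finset.sum_eq_single_of_mem (N - m).toNat (by rw [Finset.mem_range]; omega),
      Finset.sum_eq_single_of_mem 0 (by rw [Finset.mem_range]; omega)]
    · rw [Int.toNat_of_nonneg (by omega), dx_zero_apply, coeff_one', if_pos (by push_cast; omega),
        Ring.choose_zero_right, one_smul, mul_one]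
      congr 1; ring
    · intro k _ hk
      rw [hz _ _ hk, mul_zero, smul_zero]
    · intro a _ ha
      refine Finset.sum_eq_zero fun k _ => ?_
      rcases eq_or_ne k 0 with rfl | hk
      · rw [coeff_one', if_neg (by push_cast; omega), map_zero, mul_zero, smul_zero]
      · rw [hz _ _ hk, mul_zero, smul_zero]

theorem npow_succ' (P : PsiDO) (k : ℕ) : P.npow (k + 1) = P.npow k * P := by
  induction k with
  | zero => exact (mul_one' P).trans (one_mul' P).symm
  | succ k ih => rw [npow, ih, ← mul_assoc', ← npow, ih]

instance : Ring PsiDO where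
  left_distrib := mul_add'
  right_distrib := add_mul'
  zero_mul P := by
    have h := add_mul' 0 0 P
    rwa [add_zero, left_eq_add] at h
  mul_zero P := by
    have h := mul_add' P 0 0
    rwa [add_zero, left_eq_add] at h
  mul_assoc := mul_assoc'
  one_mul := one_mul'
  mul_one := mul_one'
  npow k P := P ^ k
  npow_zero _ := rfl
  npow_succ k P := npow_succ' P k
  zsmul := fun c P => c • P
  zsmul_zero' := zero_zsmul
  zsmul_succ' := SubNegMonoid.zsmul_succ'
  zsmul_neg' := SubNegMonoid.zsmul_neg'
  neg_add_cancel := neg_add_cancel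
  sub_eq_add_neg := sub_eq_add_neg

end PsiDO

end

/-! ### Orders, leading coefficients and solution of equations by successive approximation. -/

section

/-! ### Rings of formal symbols

Both the formal Laurent series in `ζ⁻¹` and the pseudo-differential operators have coefficients
indexed by the (descending) order, with multiplicative leading terms, and are complete. -/

/-- A ring whose elements are determined by coefficients indexed by `ℤ` and bounded above, such that
leading coefficients are multiplicative. -/
class SymbolRing (R : Type*) (B : outParam Type*) [Ring R] [CommRing B] where
  /-- the coefficients -/
  sc : R →+ (ℤ → B)
  sc_injective : Function.Injective sc
  sc_bdd : ∀ x, ∃ N, ∀ j, N < j → sc x j = 0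
  exists_sc : ∀ c : ℤ → B, (∃ N, ∀ j, N < j → c j = 0) → ∃ x, sc x = c
  sc_mul_of_lt : ∀ {x y a b}, (∀ j, a < j → sc x j = 0) → (∀ j, b < j → sc y j = 0) →
    ∀ j, a + b < j → sc (x * y) j = 0
  sc_mul_top : ∀ {x y a b}, (∀ j, a < j → sc x j = 0) → (∀ j, b < j → sc y j = 0) →
    sc (x * y) (a + b) = sc x a * sc y b
  sc_one_zero : sc 1 0 = 1
  sc_one_of_lt : ∀ j, 0 < j → sc 1 j = 0

namespace SymbolRing

variable {R B : Type*} [Ring R] [CommRing B] [SymbolRing R B]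

/-- The order of `x` is at most `a`. -/
def Le (a : ℤ) (x : R) : Prop := ∀ j, a < j → sc x j = 0

/-- `x` has order `a` and leading coefficient `1`. -/
structure Monic (a : ℤ) (x : R) : Prop where
  le : Le a x
  top : sc x a = 1

theorem Le.mono {a b : ℤ} {x : R} (h : Le a x) (hab : a ≤ b) : Le b x :=
  fun j hj => h j (lt_of_le_of_lt hab hj)

theorem le_zero (a : ℤ) : Le a (0 : R) := fun j _ => by rw [map_zero, Pi.zero_apply]

theorem Le.add {a : ℤ} {x y : R} (hx : Le a x) (hy : Le a y) : Le a (x + y) :=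
  fun j hj => by rw [map_add, Pi.add_apply, hx j hj, hy j hj, add_zero]

theorem Le.neg {a : ℤ} {x : R} (hx : Le a x) : Le a (-x) :=
  fun j hj => by rw [map_neg, Pi.neg_apply, hx j hj, neg_zero]

theorem Le.sub {a : ℤ} {x y : R} (hx : Le a x) (hy : Le a y) : Le a (x - y) :=
  sub_eq_add_neg x y ▸ hx.add hy.neg

theorem Le.mul {a b : ℤ} {x y : R} (hx : Le a x) (hy : Le b y) : Le (a + b) (x * y) :=
  sc_mul_of_lt hx hy

theorem Le.sum {ι : Type*} {a : ℤ} {s : Finset ι} {f : ι → R} (h : ∀ i ∈ s, Le a (f i)) :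
    Le a (∑ i ∈ s, f i) := by
  classical
  induction s using Finset.induction_on with
  | empty => simpa using le_zero a
  | insert i s hi ih =>
    rw [Finset.sum_insert hi]
    exact (h i (Finset.mem_insert_self i s)).add
      (ih fun j hj => h j (Finset.mem_insert_of_mem hj))

theorem Le.pred {a : ℤ} {x : R} (hx : Le a x) (h : sc x a = 0) : Le (a - 1) x := fun j hj => by
  rcases eq_or_ne j a with rfl | hj'
  · exact h
  · exact hx j (by omega)

theorem exists_le (x : R) : ∃ a, Le a x := sc_bdd x

theorem eq_zero_of_forall_le {x : R} (h : ∀ a, Le a x) : x = 0 :=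
  sc_injective (by funext j; rw [map_zero]; exact h (j - 1) j (by omega))

theorem eq_zero_of_forall_le_sub {x : R} (a : ℤ) (h : ∀ k : ℕ, Le (a - k) x) : x = 0 :=
  eq_zero_of_forall_le fun b => (h (a - b).toNat).mono (by omega)

/-- Descending induction from some bound on the order: as long as the bound exceeds e, the top
coefficient vanishes and the bound drops by one. -/
theorem Le.of_step {x : R} {e : ℤ} (h : ∀ a, e < a → Le a x → sc x a = 0) : Le e x := by
  obtain ⟨N, hN⟩ := exists_le x
  have : ∀ k : ℕ, Le (max e (N - k)) x := by
    intro k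
    induction k with
    | zero => exact hN.mono (by simp)
    | succ k ih =>
      rcases le_or_gt (max e (N - (k : ℤ))) e with h1 | h1
      · exact ih.mono (h1.trans (le_max_left _ _))
      · exact (ih.pred (h _ h1 ih)).mono (by push_cast; omega)
  exact (this (N - e).toNat).mono (by omega)

theorem monic_one : Monic 0 (1 : R) := ⟨sc_one_of_lt, sc_one_zero⟩

theorem Monic.mul {a b : ℤ} {x y : R} (hx : Monic a x) (hy : Monic b y) : Monic (a + b) (x * y) :=
  ⟨hx.le.mul hy.le, by rw [sc_mul_top hx.le hy.le, hx.top, hy.top, one_mul]⟩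

theorem Monic.pow {a : ℤ} {x : R} (hx : Monic a x) (k : ℕ) : Monic (k * a) (x ^ k) := by
  induction k with
  | zero => simpa using monic_one
  | succ k ih =>
    rw [pow_succ]
    convert ih.mul hx using 1
    push_cast; ring

theorem Monic.sub_le {a : ℤ} {x y : R} (hx : Monic a x) (hy : Monic a y) : Le (a - 1) (x - y) :=
  (hx.le.sub hy.le).pred (by rw [map_sub, Pi.sub_apply, hx.top, hy.top, sub_self])

theorem Monic.of_sub {a : ℤ} {x y : R} (hx : Monic a x) (h : Le (a - 1) (y - x)) : Monic a y := by
  have hy : y = x + (y - x) := by abel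
  constructor
  · rw [hy]; exact hx.le.add (h.mono (by omega))
  · rw [hy, map_add, Pi.add_apply, hx.top, h a (by omega), add_zero]

/-- On monic elements of order `a`, the map `F` changes differences to leading order by the factor
`c` and the shift `d`. -/
def HasSlope (a d : ℤ) (c : B) (F : R → R) : Prop :=
  ∀ x y e, Monic a x → Monic a y → Le e (x - y) →
    Le (d + e) (F x - F y) ∧ sc (F x - F y) (d + e) = c * sc (x - y) e

/-- The splitting x^{k+2} - y^{k+2} = x(x^{k+1} - y^{k+1}) + (x - y)y^{k+1} needs no commutativity,
and leading coefficients multiply in a commutative ring, so the k + 1 factors 1 add up as for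
commuting variables. -/
theorem hasSlope_pow_succ (a : ℤ) (k : ℕ) :
    HasSlope a (k * a) ((k : B) + 1) (fun x : R => x ^ (k + 1)) := by
  intro x y e hx hy he
  induction k with
  | zero => simpa using he
  | succ k ih =>
    have h1 : x ^ (k + 1 + 1) - y ^ (k + 1 + 1) =
        x * (x ^ (k + 1) - y ^ (k + 1)) + (x - y) * y ^ (k + 1) := by
      rw [pow_succ' x (k + 1), pow_succ' y (k + 1)]; noncomm_ring
    have h2 : (((k + 1 : ℕ) : ℤ)) * a + e = a + (k * a + e) := by push_cast; ring
    have h3 : (((k + 1 : ℕ) : ℤ)) * a + e = e + ((k + 1 : ℕ) : ℤ) * a := by ring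
    have h4 := hy.pow (k + 1)
    simp only
    rw [h1]
    constructor
    · refine Le.add ?_ ?_
      · rw [h2]; exact hx.le.mul ih.1
      · rw [h3]; exact he.mul h4.le
    · rw [map_add, Pi.add_apply]
      nth_rw 1 [h2]
      rw [h3, sc_mul_top hx.le ih.1, sc_mul_top he h4.le, hx.top, h4.top]
      simp only [ih.2]
      push_cast; ring

theorem hasSlope_pow (a : ℤ) {p : ℕ} (hp : p ≠ 0) :
    HasSlope a ((p - 1) * a) (p : B) (fun x : R => x ^ p) := by
  obtain ⟨k, rfl⟩ := Nat.exists_eq_succ_of_ne_zero hp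
  have := hasSlope_pow_succ (R := R) a k
  simpa using this

/-- If x - y had a top coefficient at some b > e, then F x - F y would have c times it at d + b,
where it vanishes by hypothesis. -/
theorem HasSlope.le {a d : ℤ} {c : B} {F : R → R} (h : HasSlope a d c F)
    (hc : ∀ b, c * b = 0 → b = 0) {x y : R} (hx : Monic a x) (hy : Monic a y) {e : ℤ}
    (hF : Le (d + e) (F x - F y)) : Le e (x - y) := by
  refine Le.of_step fun b hb hle => hc _ ?_
  rw [← (h x y b hx hy hle).2]
  exact hF _ (by omega)

theorem HasSlope.injOn {a d : ℤ} {c : B} {F : R → R} (h : HasSlope a d c F)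
    (hc : ∀ b, c * b = 0 → b = 0) {x y : R} (hx : Monic a x) (hy : Monic a y)
    (hF : F x = F y) : x = y := by
  rw [← sub_eq_zero]
  refine eq_zero_of_forall_le fun e => h.le hc hx hy ?_
  rw [hF, sub_self]
  exact le_zero _

/-- Solution of `F x = T` by successive approximation. -/
theorem HasSlope.exists_eq {a d : ℤ} {c c' : B} {F : R → R} (h : HasSlope a d c F)
    (hc : c * c' = 1) {x₀ T : R} (hx₀ : Monic a x₀) (hT : Le (d + a - 1) (F x₀ - T)) :
    ∃ x, Monic a x ∧ F x = T := by
  -- The hypotheses on `x` stand inside the existential so that `choose` yields a total map that can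
  -- be iterated.
  have step : ∀ (k : ℕ) (x : R), ∃ y, Monic a x → Le (d + a - 1 - k) (F x - T) →
      Monic a y ∧ Le (a - 1 - k) (y - x) ∧ Le (d + a - 1 - (k + 1 : ℕ)) (F y - T) := by
    intro k x
    -- A single term, chosen so that subtracting it from `x` changes F x at order d + a - 1 - k by
    -- exactly minus the error there.
    obtain ⟨v, hv⟩ := exists_sc (R := R)
      (Pi.single (a - 1 - (k : ℤ)) (c' * sc (F x - T) (d + a - 1 - k)) : ℤ → B)
      ⟨a - 1 - k, fun j hj => Pi.single_eq_of_ne hj.ne' _⟩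
    refine ⟨x - v, fun hx hF => ?_⟩
    have hv1 : Le (a - 1 - k) v := fun j hj => by rw [hv]; exact Pi.single_eq_of_ne hj.ne' _
    have hv2 : Le (a - 1 - k) (x - v - x) := by
      rw [sub_sub_cancel_left]; exact hv1.neg
    have hy : Monic a (x - v) := hx.of_sub (hv2.mono (by omega))
    refine ⟨hy, hv2, ?_⟩
    obtain ⟨h1, h2⟩ := h _ _ _ hy hx hv2
    have h3 : F (x - v) - T = (F (x - v) - F x) + (F x - T) := by abel
    rw [show d + (a - 1 - (k : ℤ)) = d + a - 1 - k by ring] at h1 h2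
    rw [show d + a - 1 - ((k + 1 : ℕ) : ℤ) = d + a - 1 - k - 1 by push_cast; ring, h3]
    refine (h1.add hF).pred ?_
    rw [map_add, Pi.add_apply, h2, sub_sub_cancel_left, map_neg, Pi.neg_apply, hv, Pi.single_eq_same,
      mul_neg, ← mul_assoc, hc, one_mul, neg_add_cancel]
  choose next hnext using step
  let S : ℕ → R := fun k => Nat.rec x₀ next k
  have hX : ∀ k, S (k + 1) = next k (S k) := fun k => rfl
  have inv : ∀ k : ℕ, Monic a (S k) ∧ Le (d + a - 1 - k) (F (S k) - T) := by
    intro k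
    induction k with
    | zero => exact ⟨hx₀, by rw [Nat.cast_zero, sub_zero]; exact hT⟩
    | succ k ih =>
      obtain ⟨h1, -, h3⟩ := hnext k (S k) ih.1 ih.2
      exact ⟨h1, h3⟩
  have hstep : ∀ k : ℕ, Le (a - 1 - k) (S (k + 1) - S k) := fun k =>
    (hnext k (S k) (inv k).1 (inv k).2).2.1
  have hdiff : ∀ k l : ℕ, Le (a - 1 - k) (S (k + l) - S k) := by
    intro k l
    induction l with
    | zero => rw [add_zero, sub_self]; exact le_zero _
    | succ l ih =>
      have := ((hstep (k + l)).mono (b := a - 1 - k) (by push_cast; omega)).add ih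
      rwa [sub_add_sub_cancel] at this
  -- From the stage a - j on, the coefficient of order j of the approximants no longer changes; the
  -- limit takes that value.
  obtain ⟨x, hx⟩ := exists_sc (R := R) (fun j => sc (S (a - j).toNat) j) ⟨a, fun j hj => by
    rw [Int.toNat_of_nonpos (by omega)]; exact hx₀.le j hj⟩
  have hxk : ∀ k : ℕ, Le (a - 1 - k) (x - S k) := by
    intro k j hj
    rw [map_sub, Pi.sub_apply, hx, sub_eq_zero]
    obtain ⟨l, hl⟩ : ∃ l, k = (a - j).toNat + l := ⟨k - (a - j).toNat, by omega⟩
    have := hdiff (a - j).toNat l j (by omega)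
    rw [← hl, map_sub, Pi.sub_apply, sub_eq_zero] at this
    exact this.symm
  have hxm : Monic a x := hx₀.of_sub (by have := hxk 0; rwa [Nat.cast_zero, sub_zero] at this)
  refine ⟨x, hxm, ?_⟩
  rw [← sub_eq_zero]
  refine eq_zero_of_forall_le_sub (d + a - 1) fun k => ?_
  have h1 := (h _ _ _ hxm (inv k).1 (hxk k)).1.mono (b := d + a - 1 - k) (by omega)
  have := h1.add (inv k).2
  rwa [sub_add_sub_cancel] at this

/-- A derivation acts on powers of a monic element with leading term `k x^{k-1} δ x`. -/
theorem derivation_pow_succ (δ : R → R) (hδ : ∀ x y, δ (x * y) = δ x * y + x * δ y) {a e : ℤ}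
    {x : R} (hx : Monic a x) (he : Le e (δ x)) (k : ℕ) :
    Le (k * a + e) (δ (x ^ (k + 1))) ∧
      sc (δ (x ^ (k + 1))) (k * a + e) = (k + 1) * sc (δ x) e := by
  induction k with
  | zero => simpa using he
  | succ k ih =>
    have h2 : (((k + 1 : ℕ) : ℤ)) * a + e = a + (k * a + e) := by push_cast; ring
    have h3 : (((k + 1 : ℕ) : ℤ)) * a + e = e + ((k + 1 : ℕ) : ℤ) * a := by ring
    have h4 := hx.pow (k + 1)
    rw [pow_succ' x (k + 1), hδ]
    constructor
    · refine Le.add ?_ ?_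
      · rw [h3]; exact he.mul h4.le
      · rw [h2]; exact hx.le.mul ih.1
    · rw [map_add, Pi.add_apply]
      nth_rw 1 [h3]
      rw [h2, sc_mul_top hx.le ih.1, sc_mul_top he h4.le, hx.top, h4.top, ih.2]
      push_cast; ring

/-- The leading coefficient of δ(x^p) is p times that of δ x, since x is monic; so δ x can have no
leading coefficient. This passes from L^p to L in the Lax equations. -/
theorem derivation_eq_zero_of_pow (δ : R → R) (hδ : ∀ x y, δ (x * y) = δ x * y + x * δ y) {a : ℤ}
    {x : R} (hx : Monic a x) {p : ℕ} (hp : p ≠ 0) (hc : ∀ b : B, p * b = 0 → b = 0)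
    (h : δ (x ^ p) = 0) : δ x = 0 := by
  obtain ⟨k, rfl⟩ := Nat.exists_eq_succ_of_ne_zero hp
  refine eq_zero_of_forall_le fun e => Le.of_step fun b _ hb => hc _ ?_
  push_cast
  rw [← (derivation_pow_succ δ hδ hx hb k).2, h, map_zero, Pi.zero_apply]

end SymbolRing

instance : SymbolRing PsiDO Fn where
  sc := { toFun := PsiDO.coeff, map_zero' := rfl, map_add' := fun _ _ => rfl }
  sc_injective := PsiDO.coeff_injective
  sc_bdd P := P.bdd
  exists_sc c h := ⟨⟨c, h⟩, rfl⟩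
  sc_mul_of_lt hx hy := PsiDO.OrdLE.mul hx hy
  sc_mul_top hx hy := PsiDO.coeff_mul_top hx hy
  sc_one_zero := by simp [PsiDO.coeff_one']
  sc_one_of_lt j hj := PsiDO.ordLE_one j hj

theorem sc_psiDO (P : PsiDO) (j : ℤ) : SymbolRing.sc P j = P.coeff j := rfl

/-! ### Laurent series -/

theorem laurent_coeff_mul {A : Type*} [CommRing A] {x y : LaurentSeries A} {a b : ℤ}
    (hx : ∀ j < a, x.coeff j = 0) (hy : ∀ j < b, y.coeff j = 0) (m : ℤ) (K : ℕ)
    (hK : m - a - b < K) : (x * y).coeff m =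
      ∑ k ∈ Finset.range K, x.coeff (a + k) * y.coeff (m - a - k) := by
  have hinj : Function.Injective (fun k : ℕ => ((a + k : ℤ), (m - a - k : ℤ))) := by
    intro k l h
    simpa using congrArg Prod.fst h
  rw [HahnSeries.coeff_mul, ← Finset.sum_image (s := Finset.range K)
    (g := fun k : ℕ => ((a + k : ℤ), (m - a - k : ℤ)))
    (f := fun q : ℤ × ℤ => x.coeff q.1 * y.coeff q.2) (fun _ _ _ _ h => hinj h)]
  refine Finset.sum_subset ?_ ?_
  · rintro ⟨i, j⟩ hij
    rw [Finset.mem_antidiagonal] at hij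
    obtain ⟨hi, hj, hs⟩ := hij
    have h1 : ¬ i < a := fun h => hi (hx i h)
    have h2 : ¬ j < b := fun h => hj (hy j h)
    simp only [Finset.mem_image, Finset.mem_range, Prod.mk.injEq]
    simp only at hs
    exact ⟨(i - a).toNat, by omega, by omega, by omega⟩
  · rintro ⟨i, j⟩ hij hn
    simp only [Finset.mem_image, Finset.mem_range, Prod.mk.injEq] at hij
    obtain ⟨k, -, rfl, rfl⟩ := hij
    rw [Finset.mem_antidiagonal] at hn
    by_contra h
    exact hn ⟨left_ne_zero_of_mul h, right_ne_zero_of_mul h, by simp⟩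

theorem exists_laurent {A : Type*} [CommRing A] (c : ℤ → A) (N : ℤ) (h : ∀ j < N, c j = 0) :
    ∃ x : LaurentSeries A, x.coeff = c :=
  ⟨HahnSeries.ofSuppBddBelow c ⟨N, fun j hj => by
    by_contra hlt
    exact hj (h j (not_le.mp hlt))⟩, rfl⟩

/-- Series are indexed by powers of the local parameter ζ^{-1/p} (or y⁻¹), orders by powers of its
inverse; hence the sign. -/
instance (A : Type*) [CommRing A] : SymbolRing (LaurentSeries A) A where
  sc := { toFun := fun x j => x.coeff (-j), map_zero' := rfl, map_add' := fun _ _ => rfl }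
  sc_injective x y h := by
    ext j
    simpa using congrFun h (-j)
  sc_bdd x := ⟨-x.order, fun j hj => HahnSeries.coeff_eq_zero_of_lt_order (by omega)⟩
  exists_sc c h := by
    obtain ⟨N, hN⟩ := h
    obtain ⟨x, hx⟩ := exists_laurent (fun j => c (-j)) (-N) (fun j hj => hN _ (by omega))
    refine ⟨x, ?_⟩
    funext j
    change x.coeff (-j) = c j
    rw [hx]
    simp only [neg_neg]
  sc_mul_of_lt {x y a b} hx hy j hj := by
    change (x * y).coeff (-j) = 0
    rw [laurent_coeff_mul (a := -a) (b := -b) (K := 0)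
      (fun i hi => by simpa using hx (-i) (by omega))
      (fun i hi => by simpa using hy (-i) (by omega)) _ (by push_cast; omega)]
    simp
  sc_mul_top {x y a b} hx hy := by
    change (x * y).coeff (-(a + b)) = x.coeff (-a) * y.coeff (-b)
    rw [laurent_coeff_mul (a := -a) (b := -b) (K := 1)
      (fun i hi => by simpa using hx (-i) (by omega))
      (fun i hi => by simpa using hy (-i) (by omega)) _ (by push_cast; omega)]
    simp
  sc_one_zero := by
    change (1 : LaurentSeries A).coeff (-0) = 1
    simp
  sc_one_of_lt j hj := by
    change (1 : LaurentSeries A).coeff (-j) = 0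
    rw [HahnSeries.coeff_one, if_neg (by omega)]

theorem sc_laurent {A : Type*} [CommRing A] (x : LaurentSeries A) (j : ℤ) :
    SymbolRing.sc x j = x.coeff (-j) := rfl

end

/-! ### Polynomials evaluated at Laurent series, and derivations of Laurent series. -/

section

section Laurent

open SymbolRing Polynomial

variable {A : Type*} [CommRing A]

/-- The series variable `ζ^{1/p}` (or `y`), i.e. the inverse of the local parameter at infinity. -/
def invVar (A : Type*) [CommRing A] : LaurentSeries A := HahnSeries.single (-1 : ℤ) (1 : A)

theorem sc_single (k j : ℤ) (c : A) :
    sc (HahnSeries.single k c : LaurentSeries A) j = if j = -k then c else 0 := by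
  rw [sc_laurent, HahnSeries.coeff_single]
  split_ifs <;> first | rfl | omega

theorem monic_single (k : ℤ) : Monic k (HahnSeries.single (-k) (1 : A) : LaurentSeries A) :=
  ⟨fun j hj => by rw [sc_single, if_neg (by omega)], by rw [sc_single, neg_neg, if_pos rfl]⟩

theorem monic_invVar : Monic 1 (invVar A) := monic_single 1

theorem invVar_pow (k : ℕ) : invVar A ^ k = HahnSeries.single (-(k : ℤ)) 1 := by
  rw [invVar, HahnSeries.single_pow, one_pow]
  congr 1
  simp

theorem sc_C_mul (c : A) (x : LaurentSeries A) (j : ℤ) :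
    sc (HahnSeries.C c * x) j = c * sc x j := by
  rw [sc_laurent, sc_laurent, HahnSeries.C_mul_eq_smul, HahnSeries.coeff_smul, smul_eq_mul]

theorem Le.C_mul {a : ℤ} {x : LaurentSeries A} (c : A) (hx : Le a x) :
    Le a (HahnSeries.C c * x) :=
  fun j hj => by rw [sc_C_mul, hx j hj, mul_zero]

/-- Evaluation of a polynomial at a Laurent series. -/
def ev (u : LaurentSeries A) : A[X] →+* LaurentSeries A := eval₂RingHom HahnSeries.C u

theorem ev_C (u : LaurentSeries A) (c : A) : ev u (C c) = HahnSeries.C c := eval₂_C _ _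

theorem ev_X (u : LaurentSeries A) : ev u X = u := eval₂_X _ _

theorem ev_eq_sum_range (u : LaurentSeries A) (W : A[X]) :
    ev u W = ∑ k ∈ Finset.range (W.natDegree + 1), HahnSeries.C (W.coeff k) * u ^ k :=
  eval₂_eq_sum_range _ _

theorem ev_eq_sum_range' (u : LaurentSeries A) (W : A[X]) {n : ℕ} (hn : W.natDegree < n) :
    ev u W = ∑ k ∈ Finset.range n, HahnSeries.C (W.coeff k) * u ^ k :=
  eval₂_eq_sum_range' _ hn _

theorem sc_sum {ι : Type*} (s : Finset ι) (f : ι → LaurentSeries A) (j : ℤ) :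
    sc (∑ i ∈ s, f i) j = ∑ i ∈ s, sc (f i) j := by
  rw [map_sum, Finset.sum_apply]

theorem le_ev {u : LaurentSeries A} (hu : Monic 1 u) (W : A[X]) (N : ℤ)
    (hW : ∀ k : ℕ, N < k → W.coeff k = 0) : Le N (ev u W) := by
  rw [ev_eq_sum_range]
  refine Le.sum fun k _ => ?_
  rcases lt_or_ge N k with h | h
  · rw [hW k h, map_zero, zero_mul]; exact le_zero _
  · exact Le.C_mul _ ((hu.pow k).le.mono (by simpa using h))

theorem sc_ev_natDegree {u : LaurentSeries A} (hu : Monic 1 u) (W : A[X]) :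
    sc (ev u W) W.natDegree = W.leadingCoeff := by
  rw [ev_eq_sum_range, Finset.sum_range_succ, map_add, Pi.add_apply, sc_C_mul]
  have h := (hu.pow W.natDegree).top
  rw [mul_one] at h
  rw [h, mul_one, coeff_natDegree]
  have h2 : Le ((W.natDegree : ℤ) - 1) (∑ k ∈ Finset.range W.natDegree, HahnSeries.C (W.coeff k) * u ^ k) := by
    refine Le.sum fun k hk => Le.C_mul _ ((hu.pow k).le.mono ?_)
    rw [Finset.mem_range] at hk
    omega
  rw [h2 _ (by omega), zero_add]

/-- A polynomial in `u = ζ^{1/p} + ⋯` that vanishes to first order at infinity is zero. -/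
theorem eq_zero_of_ev_le {u : LaurentSeries A} (hu : Monic 1 u) {W : A[X]}
    (h : Le (-1) (ev u W)) : W = 0 := by
  rw [← leadingCoeff_eq_zero, ← sc_ev_natDegree hu]
  exact h _ (by omega)

theorem sc_ev_invVar (W : A[X]) (j : ℤ) :
    sc (ev (invVar A) W) j = if 0 ≤ j then W.coeff j.toNat else 0 := by
  rw [ev_eq_sum_range' _ _ (Nat.lt_succ_of_le (le_max_left W.natDegree j.toNat)), sc_sum]
  simp only [sc_C_mul, invVar_pow, sc_single, neg_neg, mul_ite, mul_one, mul_zero]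
  split_ifs with h
  · rw [Finset.sum_eq_single_of_mem j.toNat (by simp)]
    · rw [if_pos (by omega)]
    · intro k _ hk
      rw [if_neg (by omega)]
  · exact Finset.sum_eq_zero fun k _ => if_neg (by omega)

/-- Only the top power matters: a term of degree k < p changes differences by a factor of order at
most k - 1 < p - 1. -/
theorem hasSlope_ev {p : ℕ} (hp : p ≠ 0) {W : A[X]} (hd : W.natDegree ≤ p)
    (hc : W.coeff p = 1) :
    HasSlope 1 (p - 1) (p : A) (fun x : LaurentSeries A => ev x W) := by
  intro x y e hx hy he
  have h0 := hasSlope_pow (R := LaurentSeries A) 1 hp x y e hx hy he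
  rw [mul_one] at h0
  have h1 : ev x W - ev y W = (x ^ p - y ^ p) +
      ∑ k ∈ Finset.range p, HahnSeries.C (W.coeff k) * (x ^ k - y ^ k) := by
    rw [ev_eq_sum_range' _ _ (Nat.lt_succ_of_le hd), ev_eq_sum_range' _ _ (Nat.lt_succ_of_le hd),
      Finset.sum_range_succ, Finset.sum_range_succ, hc, map_one, one_mul, one_mul]
    simp only [mul_sub, Finset.sum_sub_distrib]
    abel
  have h2 : Le ((p : ℤ) - 1 + e - 1) (∑ k ∈ Finset.range p, HahnSeries.C (W.coeff k) * (x ^ k - y ^ k)) := by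
    refine Le.sum fun k hk => Le.C_mul _ ?_
    rw [Finset.mem_range] at hk
    rcases Nat.eq_zero_or_pos k with rfl | hk0
    · rw [pow_zero, pow_zero, sub_self]; exact le_zero _
    · have := (hasSlope_pow (R := LaurentSeries A) 1 hk0.ne' x y e hx hy he).1
      exact this.mono (by omega)
  simp only
  rw [h1]
  refine ⟨h0.1.add (h2.mono (by omega)), ?_⟩
  rw [map_add, Pi.add_apply, h2 _ (by omega), add_zero]
  exact h0.2

theorem Le.of_mul {a : ℤ} {x y : LaurentSeries A} (hy : Monic 1 y) (h : Le (a + 1) (x * y)) :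
    Le a x := by
  refine Le.of_step fun b hb hx => ?_
  have := sc_mul_top hx hy.le
  rw [hy.top, mul_one] at this
  rw [← this]
  exact h _ (by omega)

/-- The polynomial part of f in powers of u instead of powers of the variable: the leading term is
removed by a multiple of u^d, since u^d is monic. -/
theorem exists_poly_approx {u : LaurentSeries A} (hu : Monic 1 u) (d : ℕ) (f : LaurentSeries A)
    (hf : Le ((d : ℤ) - 1) f) :
    ∃ Q : A[X], (∀ k, d ≤ k → Q.coeff k = 0) ∧ Le (-1) (ev u Q - f) := by
  induction d generalizing f with
  | zero => exact ⟨0, by simp, by simpa using Le.neg (hf.mono (by simp))⟩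
  | succ d ih =>
    have hud := hu.pow d
    rw [mul_one] at hud
    obtain ⟨Q, hQ1, hQ2⟩ := ih (f - HahnSeries.C (sc f d) * u ^ d) (by
      refine Le.pred (Le.sub (hf.mono (by push_cast; omega)) (Le.C_mul _ hud.le)) ?_
      rw [map_sub, Pi.sub_apply, sc_C_mul, hud.top, mul_one, sub_self])
    refine ⟨Q + C (sc f d) * X ^ d, fun k hk => ?_, ?_⟩
    · rw [coeff_add, hQ1 k (by omega), coeff_C_mul_X_pow, if_neg (by omega), add_zero]
    · convert hQ2 using 1
      rw [map_add, map_mul, ev_C, map_pow, ev_X]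
      ring

/-- A map of Laurent series that acts on the coefficients by additive maps. -/
def coeffMap (δ : ℤ → A →+ A) : LaurentSeries A →+ LaurentSeries A where
  toFun x := HahnSeries.ofSuppBddBelow (fun j => δ j (x.coeff j)) ⟨x.order, fun j hj => by
    by_contra h
    rw [Function.mem_support, HahnSeries.coeff_eq_zero_of_lt_order (not_le.mp h), map_zero] at hj
    exact hj rfl⟩
  map_zero' := by ext j; exact map_zero (δ j)
  map_add' x y := by ext j; exact map_add (δ j) _ _

theorem sc_coeffMap (δ : ℤ → A →+ A) (x : LaurentSeries A) (j : ℤ) :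
    sc (coeffMap δ x) j = δ (-j) (sc x j) := rfl

theorem Le.coeffMap {a : ℤ} {x : LaurentSeries A} (δ : ℤ → A →+ A) (hx : Le a x) :
    Le a (coeffMap δ x) :=
  fun j hj => by rw [sc_coeffMap, hx j hj, map_zero]

theorem coeffMap_single (δ : ℤ → A →+ A) (j : ℤ) (c : A) :
    coeffMap δ (HahnSeries.single j c) = HahnSeries.single j (δ j c) := by
  apply sc_injective
  funext i
  rw [sc_coeffMap, sc_single, sc_single]
  split_ifs with h
  · rw [h, neg_neg]
  · exact map_zero _

/-- The Leibniz rule may mix the exponents, so that both the Euler operator (multiplication of the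
j-th coefficient by j) and a derivation of the coefficient ring are covered. -/
theorem coeffMap_mul (δ : ℤ → A →+ A)
    (hδ : ∀ i j a b, δ (i + j) (a * b) = δ i a * b + a * δ j b) (x y : LaurentSeries A) :
    coeffMap δ (x * y) = coeffMap δ x * y + x * coeffMap δ y := by
  ext m
  change δ m ((x * y).coeff m) = (coeffMap δ x * y).coeff m + (x * coeffMap δ y).coeff m
  have hx : ∀ j < x.order, x.coeff j = 0 := fun j hj => HahnSeries.coeff_eq_zero_of_lt_order hj
  have hy : ∀ j < y.order, y.coeff j = 0 := fun j hj => HahnSeries.coeff_eq_zero_of_lt_order hj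
  obtain ⟨K, hK⟩ : ∃ K : ℕ, m - x.order - y.order < K :=
    ⟨(m - x.order - y.order).toNat + 1, by omega⟩
  rw [laurent_coeff_mul hx hy m K hK, laurent_coeff_mul (a := x.order) (fun j hj => ?_) hy m K hK,
    laurent_coeff_mul hx (b := y.order) (fun j hj => ?_) m K hK, map_sum, ← Finset.sum_add_distrib]
  · refine Finset.sum_congr rfl fun k _ => ?_
    change _ = δ _ (x.coeff _) * y.coeff _ + x.coeff _ * δ _ (y.coeff _)
    rw [← hδ]
    congr 2; ring
  · change δ j (y.coeff j) = 0
    rw [hy j hj, map_zero]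
  · change δ j (x.coeff j) = 0
    rw [hx j hj, map_zero]

theorem leibniz_pow' (D : LaurentSeries A →+ LaurentSeries A)
    (hD : ∀ x y, D (x * y) = D x * y + x * D y) (x : LaurentSeries A) (k : ℕ) :
    D (x ^ k) = k * x ^ (k - 1) * D x := by
  induction k with
  | zero =>
    have h := hD 1 1
    rw [one_mul, mul_one, one_mul, left_eq_add] at h
    simpa using h
  | succ k ih =>
    rw [pow_succ, hD, ih, Nat.add_sub_cancel, Nat.cast_succ]
    rcases k with _ | k
    · simp
    · rw [Nat.add_sub_cancel, pow_succ]
      ring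

/-- The chain rule for W(u), when D differentiates both the coefficients of W (giving `W₁`) and the
argument u. -/
theorem leibniz_ev (D : LaurentSeries A →+ LaurentSeries A)
    (hD : ∀ x y, D (x * y) = D x * y + x * D y)
    (δ : A → A) (hδ : ∀ c, D (HahnSeries.C c) = HahnSeries.C (δ c))
    (u : LaurentSeries A) (W W₁ : A[X]) (hW : ∀ k, W₁.coeff k = δ (W.coeff k)) :
    D (ev u W) = ev u W₁ + ev u (derivative W) * D u := by
  have h1 : ev u (derivative W) = ∑ k ∈ Finset.range (max W.natDegree W₁.natDegree + 1),
      HahnSeries.C (W.coeff k) * ((k : LaurentSeries A) * u ^ (k - 1)) := by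
    rw [derivative_apply, sum_over_range' _ (by simp) (max W.natDegree W₁.natDegree + 1)
      (Nat.lt_succ_of_le (le_max_left _ _)), map_sum]
    refine Finset.sum_congr rfl fun k _ => ?_
    rw [map_mul, ev_C, map_pow, ev_X, map_mul, map_natCast]
    ring
  rw [h1, ev_eq_sum_range' _ _ (Nat.lt_succ_of_le (le_max_left W.natDegree W₁.natDegree)),
    ev_eq_sum_range' _ _ (Nat.lt_succ_of_le (le_max_right W.natDegree W₁.natDegree)),
    map_sum, Finset.sum_mul, ← Finset.sum_add_distrib]
  refine Finset.sum_congr rfl fun k _ => ?_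
  rw [hD, leibniz_pow' D hD, hδ, hW]
  ring

/-- The Euler operator `s d/ds` on Laurent series in `s`. -/
def euler (A : Type*) [CommRing A] : LaurentSeries A →+ LaurentSeries A :=
  coeffMap fun j => AddMonoidHom.mulLeft (j : A)

theorem euler_mul (x y : LaurentSeries A) : euler A (x * y) = euler A x * y + x * euler A y :=
  coeffMap_mul _ (fun i j a b => by simp only [AddMonoidHom.coe_mulLeft]; push_cast; ring) x y

theorem sc_euler (x : LaurentSeries A) (j : ℤ) : sc (euler A x) j = -(j : A) * sc x j := by
  rw [euler, sc_coeffMap, AddMonoidHom.coe_mulLeft]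
  push_cast; rfl

theorem euler_single (k : ℤ) (c : A) :
    euler A (HahnSeries.single k c) = HahnSeries.single k (k * c) := coeffMap_single _ _ _

theorem euler_ev (u : LaurentSeries A) (W : A[X]) :
    euler A (ev u W) = ev u (derivative W) * euler A u := by
  rw [leibniz_ev (euler A) euler_mul (fun _ => 0) (fun c => ?_) u W 0 (by simp), map_zero, zero_add]
  rw [HahnSeries.C_apply, euler_single]
  simp

/-- A derivation of the coefficient ring acting on the coefficients of Laurent series. -/
def coeffwise {k : Type*} [CommRing k] [Algebra k A] (δ : Derivation k A A) :
    LaurentSeries A →+ LaurentSeries A :=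
  coeffMap fun _ => (δ : A →ₗ[k] A).toAddMonoidHom

section coeffwise

variable {k : Type*} [CommRing k] [Algebra k A] (δ : Derivation k A A)

theorem sc_coeffwise (x : LaurentSeries A) (j : ℤ) : sc (coeffwise δ x) j = δ (sc x j) := rfl

theorem coeffwise_mul (x y : LaurentSeries A) :
    coeffwise δ (x * y) = coeffwise δ x * y + x * coeffwise δ y :=
  coeffMap_mul _ (fun i j a b => by
    change δ (a * b) = δ a * b + a * δ b
    rw [Derivation.leibniz, smul_eq_mul, smul_eq_mul]
    ring) x y

theorem coeffwise_single (j : ℤ) (c : A) :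
    coeffwise δ (HahnSeries.single j c) = HahnSeries.single j (δ c) := coeffMap_single _ _ _

/-- A derivation of the coefficient ring acting on the coefficients of polynomials. -/
def polyCoeffwise (W : A[X]) : A[X] :=
  ∑ k ∈ Finset.range (W.natDegree + 1), C (δ (W.coeff k)) * X ^ k

theorem coeff_polyCoeffwise (W : A[X]) (k : ℕ) : (polyCoeffwise δ W).coeff k = δ (W.coeff k) := by
  rw [polyCoeffwise, finsetSum_coeff]
  simp only [coeff_C_mul_X_pow]
  rw [Finset.sum_ite_eq]
  split_ifs with h
  · rfl
  · rw [coeff_eq_zero_of_natDegree_lt (by simpa using h), map_zero]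

theorem coeffwise_ev (u : LaurentSeries A) (W : A[X]) :
    coeffwise δ (ev u W) =
      ev u (polyCoeffwise δ W) + ev u (derivative W) * coeffwise δ u :=
  leibniz_ev (coeffwise δ) (coeffwise_mul δ) δ (fun c => by
    rw [HahnSeries.C_apply, coeffwise_single]; rfl) u W _ (coeff_polyCoeffwise δ W)

end coeffwise

/-- The polynomial part of a Laurent series of order at most `d`. -/
def polyPart (d : ℕ) (x : LaurentSeries A) : A[X] := ∑ k ∈ Finset.range (d + 1), C (sc x k) * X ^ k

theorem coeff_polyPart {d : ℕ} {x : LaurentSeries A} (hx : Le d x) (k : ℕ) :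
    (polyPart d x).coeff k = sc x k := by
  rw [polyPart, finsetSum_coeff]
  simp only [coeff_C_mul_X_pow]
  rw [Finset.sum_ite_eq]
  split_ifs with h
  · rfl
  · rw [hx k (by simp at h; omega)]

theorem ev_invVar_polyPart_sub {d : ℕ} {x : LaurentSeries A} (hx : Le d x) :
    Le (-1) (ev (invVar A) (polyPart d x) - x) := by
  intro j hj
  rw [map_sub, Pi.sub_apply, sc_ev_invVar, if_pos (by omega), coeff_polyPart hx,
    Int.toNat_of_nonneg (by omega), sub_self]

/-- If `V(u) = ζ` and `r = V^{1/p}`, then the polynomial part of `r^i` at `u` is `ζ^{i/p} + O(ζ^{-1/p})`. -/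
theorem ev_polyPart_pow_sub {p i : ℕ} (hp : p ≠ 0) (hpA : ∀ b : A, p * b = 0 → b = 0)
    {V : A[X]} {u r : LaurentSeries A} (hu : Monic 1 u) (hr : Monic 1 r)
    (hVu : ev u V = HahnSeries.single (-(p : ℤ)) 1) (hrV : r ^ p = ev (invVar A) V) :
    Le (-1) (ev u (polyPart i (r ^ i)) - HahnSeries.single (-(i : ℤ)) 1) := by
  have hri := hr.pow i
  rw [mul_one] at hri
  have hQ := ev_invVar_polyPart_sub hri.le
  set Q := polyPart i (r ^ i) with hQdef
  have hQy : Monic i (ev (invVar A) Q) := hri.of_sub (hQ.mono (by omega))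
  have hdeg : Q.natDegree ≤ i := natDegree_le_iff_coeff_eq_zero.mpr fun k hk => by
    rw [hQdef, coeff_polyPart hri.le, hri.le k (by exact_mod_cast hk)]
  have hQi : Q.coeff i = 1 := by rw [hQdef, coeff_polyPart hri.le, hri.top]
  have hQu : Monic i (ev u Q) := by
    refine ⟨le_ev hu Q i fun k hk => coeff_eq_zero_of_natDegree_lt (by omega), ?_⟩
    -- Over the zero ring `Q` need not have degree i, but there every coefficient equals 1.
    rcases subsingleton_or_nontrivial A with h | h
    · exact Subsingleton.elim _ _
    · have hdeg' : Q.natDegree = i :=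
        natDegree_eq_of_le_of_coeff_ne_zero hdeg (by rw [hQi]; exact one_ne_zero)
      have := sc_ev_natDegree hu Q
      rwa [leadingCoeff, hdeg', hQi] at this
  have hslope := hasSlope_pow (R := LaurentSeries A) (B := A) i hp
  have h1 := (hslope _ _ _ hQy hri hQ).1
  simp only at h1
  -- At the series y, Q^p is close to r^{ip} = V^i. This bounds the degree of the polynomial Q^p -
  -- V^i, and a bound on the degree can be evaluated at u as well; no composition of Laurent series
  -- is needed.
  have h2 : Le (((p : ℤ) - 1) * i + -1) (ev u (Q ^ p - V ^ i)) := by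
    refine le_ev hu _ _ fun k hk => ?_
    have h3 := h1 k hk
    rw [← pow_mul, mul_comm i p, pow_mul, hrV, ← map_pow, ← map_pow, ← map_sub,
      sc_ev_invVar, if_pos (by omega)] at h3
    simpa using h3
  -- Extraction of p-th roots: Q(u) and ζ^{i/p} are both monic of order i.
  refine hslope.le hpA hQu (monic_single _) ?_
  convert h2 using 1
  rw [map_sub, map_pow, map_pow, hVu, HahnSeries.single_pow, HahnSeries.single_pow, one_pow,
    one_pow]
  congr 3
  simp; ring

end Laurent

end

/-! ### Construction and uniqueness of the potential. -/

section

open SymbolRing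

/-! ### A Poincaré lemma for polynomials -/

/-- Euler's homotopy: for a closed form, P is obtained from ∑ X_i f_i by dividing the homogeneous
part of each degree by that degree. -/
theorem exists_primitive {σ : Type*} [Fintype σ] (f : σ → MvPolynomial σ ℂ)
    (hf : ∀ i j, MvPolynomial.pderiv j (f i) = MvPolynomial.pderiv i (f j)) :
    ∃ P : MvPolynomial σ ℂ, MvPolynomial.constantCoeff P = 0 ∧
      ∀ i, MvPolynomial.pderiv i P = f i := by
  classical
  set g : MvPolynomial σ ℂ := ∑ i, MvPolynomial.X i * f i with hg
  have hsupp : ∀ m : σ →₀ ℕ, g.coeff m / (m.degree : ℂ) ≠ 0 → m ∈ g.support := by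
    intro m hm
    rw [MvPolynomial.mem_support_iff]
    exact fun h => hm (by rw [h, zero_div])
  let P : MvPolynomial σ ℂ := ∑ m ∈ g.support, MvPolynomial.monomial m (g.coeff m / (m.degree : ℂ))
  have hP : ∀ m, P.coeff m = g.coeff m / (m.degree : ℂ) := by
    intro m
    simp only [P, MvPolynomial.coeff_sum, MvPolynomial.coeff_monomial]
    rw [Finset.sum_ite_eq']
    split_ifs with h
    · rfl
    · by_contra h'
      exact h (hsupp m fun h'' => h' h''.symm)
  have euler : ∀ (q : MvPolynomial σ ℂ) (i : σ) (m : σ →₀ ℕ),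
      (MvPolynomial.X i * MvPolynomial.pderiv i q).coeff m = (m i : ℂ) * q.coeff m := by
    intro q i m
    rw [MvPolynomial.coeff_X_mul']
    split_ifs with h
    · rw [MvPolynomial.coeff_pderiv]
      rw [Finsupp.mem_support_iff] at h
      have h1 : m - Finsupp.single i 1 + Finsupp.single i 1 = m :=
        tsub_add_cancel_of_le (by simpa [Finsupp.single_le_iff] using Nat.one_le_iff_ne_zero.mpr h)
      rw [h1, Finsupp.tsub_apply, Finsupp.single_eq_same, Nat.cast_sub (by omega)]
      push_cast; ring
    · rw [Finsupp.notMem_support_iff.mp h]; simp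
  refine ⟨P, ?_, fun j => ?_⟩
  -- The degree of the trivial monomial is 0, and division by zero gives the required value 0.
  · rw [MvPolynomial.constantCoeff_eq, hP]; simp
  · ext m
    -- Closedness replaces ∂_j f_i by ∂_i f_j, so that the Euler operator applied to f_j appears.
    have h1 : MvPolynomial.pderiv j g = f j + ∑ i, MvPolynomial.X i * MvPolynomial.pderiv i (f j) := by
      rw [hg, map_sum]
      simp only [Derivation.leibniz, smul_eq_mul, Finset.sum_add_distrib, hf _ j]
      rw [add_comm]
      congr 1
      rw [Finset.sum_eq_single_of_mem j (Finset.mem_univ j)]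
      · rw [MvPolynomial.pderiv_X_self, mul_one]
      · intro i _ hi
        rw [MvPolynomial.pderiv_X_of_ne hi, mul_zero]
    have h2 := congrArg (MvPolynomial.coeff m) h1
    clear_value g
    rw [MvPolynomial.coeff_pderiv, MvPolynomial.coeff_add, MvPolynomial.coeff_sum] at h2
    rw [Finset.sum_congr rfl fun i _ => euler (f j) i m, ← Finset.sum_mul] at h2
    have h3 : (m.degree : ℂ) = ∑ i, (m i : ℂ) := by
      rw [Finsupp.degree_eq_sum]; push_cast; rfl
    rw [MvPolynomial.coeff_pderiv, hP, map_add, Finsupp.degree_single]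
    have h4 : ((m.degree + 1 : ℕ) : ℂ) ≠ 0 := Nat.cast_ne_zero.mpr (Nat.succ_ne_zero _)
    rw [div_mul_eq_mul_div, h2, div_eq_iff h4]
    push_cast
    rw [h3]; ring

theorem primitive_unique {σ : Type*} {P Q : MvPolynomial σ ℂ}
    (h0 : MvPolynomial.constantCoeff P = MvPolynomial.constantCoeff Q)
    (h : ∀ i, MvPolynomial.pderiv i P = MvPolynomial.pderiv i Q) : P = Q := by
  apply MvPolynomial.coe_injective (σ := σ) (R := ℂ)
  refine MvPowerSeries.pderiv.ext (fun i => ?_) ?_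
  · rw [MvPowerSeries.pderiv_coe, MvPowerSeries.pderiv_coe, h i]
  · rw [← MvPowerSeries.coeff_zero_eq_constantCoeff_apply,
      ← MvPowerSeries.coeff_zero_eq_constantCoeff_apply, MvPolynomial.coeff_coe,
      MvPolynomial.coeff_coe, ← MvPolynomial.constantCoeff_eq, h0, MvPolynomial.constantCoeff_eq]

/-! ### The potential -/

section Potential

variable (p : ℕ)

theorem aeval_eq_ev (u : LaurentSeries (TimePoly p)) (W : (TimePoly p)[X]) :
    Polynomial.aeval u W = ev u W := by
  rw [Polynomial.aeval_def]
  refine congrArg (fun φ => Polynomial.eval₂ φ u W) ?_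
  refine RingHom.ext fun c => ?_
  rw [HahnSeries.algebraMap_apply', HahnSeries.C_apply]
  simp

theorem derivative_potential (θ : Fin (p - 1) → TimePoly p) :
    Polynomial.derivative (potential p θ) =
      Polynomial.X ^ p + ∑ i : Fin (p - 1), Polynomial.C (θ i) * Polynomial.X ^ (i : ℕ) := by
  have h : ∀ k : ℕ, ((k : ℂ) + 1) ≠ 0 := fun k => Nat.cast_add_one_ne_zero k
  have h1 : ∀ k : ℕ, (MvPolynomial.C (1 / ((k : ℂ) + 1)) : TimePoly p) * ((k + 1 : ℕ) : TimePoly p) = 1 := by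
    intro k
    rw [← map_natCast (MvPolynomial.C : ℂ →+* TimePoly p), ← map_mul, Nat.cast_succ,
      one_div_mul_cancel (h k), map_one]
  rw [potential, Polynomial.derivative_add, Polynomial.derivative_sum]
  congr 1
  · rw [Polynomial.derivative_C_mul_X_pow, h1, map_one, one_mul, Nat.add_sub_cancel]
  · refine Finset.sum_congr rfl fun i _ => ?_
    rw [Polynomial.derivative_C_mul_X_pow, mul_right_comm, h1, one_mul, Nat.add_sub_cancel]

theorem coeff_derivative_potential (hp : 2 ≤ p) (θ : Fin (p - 1) → TimePoly p) (k : ℕ) :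
    (Polynomial.derivative (potential p θ)).coeff k =
      if k = p then 1 else if h : k < p - 1 then θ ⟨k, h⟩ else 0 := by
  rw [derivative_potential, Polynomial.coeff_add, Polynomial.coeff_X_pow,
    Polynomial.finsetSum_coeff]
  simp only [Polynomial.coeff_C_mul_X_pow]
  split_ifs with h1 h2
  · rw [Finset.sum_eq_zero, add_zero]
    intro i _
    rw [if_neg (by omega)]
  · rw [Finset.sum_eq_single_of_mem ⟨k, h2⟩ (Finset.mem_univ _), if_pos rfl, zero_add]
    intro i _ hi
    rw [if_neg fun h => hi (Fin.ext h.symm)]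
  · rw [Finset.sum_eq_zero, add_zero]
    intro i _
    rw [if_neg (by omega)]

theorem natDegree_derivative_potential (hp : 2 ≤ p) (θ : Fin (p - 1) → TimePoly p) :
    (Polynomial.derivative (potential p θ)).natDegree ≤ p := by
  refine Polynomial.natDegree_le_iff_coeff_eq_zero.mpr fun k hk => ?_
  rw [coeff_derivative_potential p hp, if_neg (by omega), dif_neg (by omega)]

theorem derivative_potential_injective (hp : 2 ≤ p) {θ θ' : Fin (p - 1) → TimePoly p}
    (h : Polynomial.derivative (potential p θ) = Polynomial.derivative (potential p θ')) :
    θ = θ' := by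
  funext i
  have := congrArg (fun W => Polynomial.coeff W i) h
  simp only [coeff_derivative_potential p hp] at this
  rwa [if_neg (by omega), dif_pos i.2, if_neg (by omega), dif_pos i.2] at this

theorem hasSlope_potential (hp : 2 ≤ p) (θ : Fin (p - 1) → TimePoly p) :
    HasSlope 1 (p - 1) (p : TimePoly p) (fun x : LaurentSeries (TimePoly p) =>
      ev x (Polynomial.derivative (potential p θ))) :=
  hasSlope_ev (by omega) (natDegree_derivative_potential p hp θ)
    (by rw [coeff_derivative_potential p hp, if_pos rfl])

theorem natCast_mul_inj (hp : 2 ≤ p) (b : TimePoly p) (h : (p : TimePoly p) * b = 0) : b = 0 :=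
  (mul_eq_zero.mp h).resolve_left (Nat.cast_ne_zero.mpr (by omega))

theorem natCast_mul_inv (hp : 2 ≤ p) :
    (p : TimePoly p) * MvPolynomial.C (1 / (p : ℂ)) = 1 := by
  rw [← map_natCast (MvPolynomial.C : ℂ →+* TimePoly p), ← map_mul, mul_one_div_cancel, map_one]
  exact Nat.cast_ne_zero.mpr (by omega)

/-- The coefficients of `ζ^{1/p} + (1/p) ∑ i t_i ζ^{(i-p)/p}`. -/
def leadingU (p : ℕ) (k : ℤ) : TimePoly p :=
  if k = -1 then 1 else if h : 1 ≤ k ∧ k ≤ p - 1 then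
    MvPolynomial.C (((p - k : ℤ) : ℂ) / (p : ℂ)) * MvPolynomial.X ⟨(p - 1 - k).toNat, by omega⟩
  else 0

/-- `u` has the expansion that defines the times, and `V_p'(u) = ζ`. -/
structure IsInverseSeries (θ : Fin (p - 1) → TimePoly p) (u : LaurentSeries (TimePoly p)) :
    Prop where
  coeff_le : ∀ k ≤ (p : ℤ), u.coeff k = leadingU p k
  eq : ev u (Polynomial.derivative (potential p θ)) = HahnSeries.single (-(p : ℤ)) 1

theorem isTimeParam_iff (hp : 2 ≤ p) (θ : Fin (p - 1) → TimePoly p) :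
    IsTimeParam p θ ↔ ∃ u, IsInverseSeries p θ u := by
  refine exists_congr fun u => ?_
  rw [aeval_eq_ev]
  have hl : ∀ i : Fin (p - 1), leadingU p ((p : ℤ) - ((i : ℤ) + 1)) =
      MvPolynomial.C (((i : ℂ) + 1) / (p : ℂ)) * MvPolynomial.X i := by
    intro i
    have := i.2
    rw [leadingU, if_neg (by omega), dif_pos (by omega)]
    congr 2
    · push_cast; ring
    · apply Fin.ext; simp
  constructor
  · rintro ⟨h1, h2, h3, h4, h5, h6⟩
    refine ⟨fun k hk => ?_, h6⟩
    rcases lt_trichotomy k (-1) with h | h | h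
    · rw [h1 k h, leadingU, if_neg (by omega), dif_neg (by omega)]
    · rw [h, h2, leadingU, if_pos rfl]
    · rcases eq_or_ne k 0 with rfl | h0
      · rw [h3, leadingU, if_neg (by omega), dif_neg (by omega)]
      · rcases eq_or_ne k p with rfl | hkp
        · rw [h5, leadingU, if_neg (by omega), dif_neg (by omega)]
        · have := h4 ⟨(p - 1 - k).toNat, by omega⟩
          rw [← hl] at this
          simp only at this
          rwa [show (p : ℤ) - (((p - 1 - k).toNat : ℤ) + 1) = k by omega] at this
  · rintro ⟨h1, h2⟩
    refine ⟨fun k hk => ?_, ?_, ?_, fun i => ?_, ?_, h2⟩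
    · rw [h1 k (by omega), leadingU, if_neg (by omega), dif_neg (by omega)]
    · rw [h1 _ (by omega), leadingU, if_pos rfl]
    · rw [h1 _ (by omega), leadingU, if_neg (by omega), dif_neg (by omega)]
    · rw [h1 _ (by omega), hl]
    · rw [h1 _ (by omega), leadingU, if_neg (by omega), dif_neg (by omega)]

variable {p}

theorem monic_of_coeff {u : LaurentSeries (TimePoly p)}
    (h : ∀ k ≤ (0 : ℤ), u.coeff k = leadingU p k) : Monic 1 u := by
  constructor
  · intro j hj
    rw [sc_laurent, h _ (by omega), leadingU, if_neg (by omega), dif_neg (by omega)]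
  · rw [sc_laurent, h _ (by omega), leadingU, if_pos rfl]

theorem IsInverseSeries.monic {θ : Fin (p - 1) → TimePoly p} {u : LaurentSeries (TimePoly p)}
    (h : IsInverseSeries p θ u) : Monic 1 u :=
  monic_of_coeff fun k hk => h.coeff_le k (by omega)

/-- The two series agree through ζ^{-1}, so replacing u' by u changes the second V_p' only at
negative order. The two polynomials V_p' then agree at u up to negative order, hence are equal. -/
theorem IsInverseSeries.unique (hp : 2 ≤ p) {θ θ' : Fin (p - 1) → TimePoly p}
    {u u' : LaurentSeries (TimePoly p)} (h : IsInverseSeries p θ u) (h' : IsInverseSeries p θ' u') :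
    θ = θ' := by
  apply derivative_potential_injective p hp
  rw [← sub_eq_zero]
  refine eq_zero_of_ev_le h.monic ?_
  have h1 : Le (-(p : ℤ) - 1) (u' - u) := fun j hj => by
    rw [map_sub, Pi.sub_apply, sc_laurent, sc_laurent, h.coeff_le _ (by omega),
      h'.coeff_le _ (by omega), sub_self]
  have h2 := (hasSlope_potential p hp θ' u' u _ h'.monic h.monic h1).1
  simp only at h2
  rw [h'.eq, ← h.eq, ← map_sub] at h2
  exact h2.mono (by omega)

/-- Vanishing of the coefficient of `ζ^{-1}` in `u`, as the residue of a total derivative. -/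
theorem coeff_eq_zero_of_ev_eq (hp : 2 ≤ p) {V : (TimePoly p)[X]} {u : LaurentSeries (TimePoly p)}
    (h : ev u (Polynomial.derivative V) = HahnSeries.single (-(p : ℤ)) 1) : u.coeff p = 0 := by
  -- The Legendre transform: d(yV' - V) = y dV', so u dζ is exact.
  set W := Polynomial.X * Polynomial.derivative V - V with hW
  have hW' : Polynomial.derivative W =
      Polynomial.X * Polynomial.derivative (Polynomial.derivative V) := by
    rw [hW, Polynomial.derivative_sub, Polynomial.derivative_mul, Polynomial.derivative_X]
    ring
  have h1 : euler _ (ev u W) = u * euler _ (ev u (Polynomial.derivative V)) := by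
    rw [euler_ev, euler_ev, hW', map_mul, ev_X, mul_assoc]
  -- An Euler derivative has no constant term, while the constant term of u · E(ζ) is -p times the
  -- coefficient of ζ^{-1} in u.
  have h2 := sc_euler (ev u W) 0
  rw [h1, h, euler_single, Int.cast_zero, neg_zero, zero_mul, mul_one, sc_laurent, neg_zero] at h2
  have h3 : ∀ c : TimePoly p, (u * HahnSeries.single (-(p : ℤ)) c).coeff 0 = u.coeff p * c := by
    intro c
    have := HahnSeries.coeff_mul_single_add (r := c) (x := u) (a := (p : ℤ)) (b := -(p : ℤ))
    rwa [add_neg_cancel] at this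
  rw [h3] at h2
  push_cast at h2
  apply natCast_mul_inj p hp
  rw [← neg_eq_zero, ← h2]
  ring

/-- The θ_i are read off from the prescribed leading part u₀, by requiring V_p'(u₀) = ζ +
O(ζ^{-1/p}). An exact solution near u₀ then has the prescribed coefficients before ζ^{-1}, and the
coefficient of ζ^{-1} vanishes as a residue. -/
theorem exists_isInverseSeries (hp : 2 ≤ p) : ∃ θ u, IsInverseSeries p θ u := by
  obtain ⟨u₀, hu₀⟩ := exists_laurent (leadingU p) (-1) fun k hk => by
    rw [leadingU, if_neg (by omega), dif_neg (by omega)]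
  have hm₀ : Monic 1 u₀ := monic_of_coeff fun k _ => by rw [hu₀]
  have hd : Le (-1) (u₀ - invVar (TimePoly p)) := by
    refine Le.pred (Le.pred (Le.sub hm₀.le monic_invVar.le) ?_) ?_
    · rw [map_sub, Pi.sub_apply, hm₀.top, monic_invVar.top, sub_self]
    · rw [map_sub, Pi.sub_apply, sc_laurent, hu₀, invVar, sc_single, if_neg (by omega), leadingU,
        if_neg (by omega), dif_neg (by omega), sub_self]
  have h1 := (hasSlope_pow (R := LaurentSeries (TimePoly p)) 1 (p := p) (by omega)
    u₀ _ _ hm₀ monic_invVar hd).1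
  -- Since u₀ = ζ^{1/p} + O(ζ^{-1/p}), the difference ζ - u₀^p has order at most p - 2, and the p -
  -- 1 coefficients θ_0, …, θ_{p-2} suffice.
  obtain ⟨Q, hQ1, hQ2⟩ := exists_poly_approx hm₀ (p - 1) (invVar _ ^ p - u₀ ^ p) (by
    rw [← neg_sub (u₀ ^ p)]
    exact h1.neg.mono (b := ((p - 1 : ℕ) : ℤ) - 1) (by omega))
  let θ : Fin (p - 1) → TimePoly p := fun i => Q.coeff i
  have hV : Polynomial.derivative (potential p θ) = Polynomial.X ^ p + Q := by
    ext1 k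
    rw [coeff_derivative_potential p hp, Polynomial.coeff_add, Polynomial.coeff_X_pow]
    split_ifs with h1 h2
    · rw [hQ1 k (by omega), add_zero]
    · rw [zero_add]
    · rw [hQ1 k (by omega), add_zero]
  have hle : Le (-1) (ev u₀ (Polynomial.derivative (potential p θ)) -
      HahnSeries.single (-(p : ℤ)) 1) := by
    convert hQ2 using 1
    rw [hV, map_add, map_pow, ev_X, ← invVar_pow]
    ring
  obtain ⟨u, hu1, hu2⟩ := (hasSlope_potential p hp θ).exists_eq (natCast_mul_inv p hp)
    (T := HahnSeries.single (-(p : ℤ)) 1) hm₀ (hle.mono (b := (p : ℤ) - 1 + 1 - 1) (by omega))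
  -- The slope has shift p - 1, and (p - 1) + (-p) = -1 is the order of the error at u₀.
  have hdiff : Le (-(p : ℤ)) (u₀ - u) :=
    (hasSlope_potential p hp θ).le (natCast_mul_inj p hp) hm₀ hu1 (e := -(p : ℤ)) (by
      rw [hu2]
      exact hle.mono (by omega))
  refine ⟨θ, u, fun k hk => ?_, hu2⟩
  rcases eq_or_ne k p with rfl | hkp
  · rw [coeff_eq_zero_of_ev_eq hp hu2, leadingU, if_neg (by omega), dif_neg (by omega)]
  · have := hdiff (-k) (by omega)
    rw [map_sub, Pi.sub_apply, sc_laurent, sc_laurent, neg_neg, hu₀, sub_eq_zero] at this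
    exact this.symm

end Potential

end

/-! ### Roots of the potential, the flow polynomials, and their derivatives in the times. -/

section

open SymbolRing

/-- The map of Laurent series induced by a ring homomorphism of the coefficients. -/
def laurentMap {A B : Type*} [CommRing A] [CommRing B] (φ : A →+* B) :
    LaurentSeries A →+* LaurentSeries B where
  toFun x := x.map φ
  map_zero' := by ext j; exact map_zero φ
  map_one' := HahnSeries.map_one φ.toMonoidWithZeroHom
  map_add' x y := by ext j; exact map_add φ _ _
  map_mul' x y := HahnSeries.map_mul (φ : A →ₙ+* B)

theorem sc_laurentMap {A B : Type*} [CommRing A] [CommRing B] (φ : A →+* B) (x : LaurentSeries A)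
    (j : ℤ) : sc (laurentMap φ x) j = φ (sc x j) := rfl

theorem laurentMap_single {A B : Type*} [CommRing A] [CommRing B] (φ : A →+* B) (k : ℤ) (c : A) :
    laurentMap φ (HahnSeries.single k c) = HahnSeries.single k (φ c) := by
  apply sc_injective
  funext j
  rw [sc_laurentMap, sc_single, sc_single, apply_ite φ, map_zero]

theorem laurentMap_ev {A B : Type*} [CommRing A] [CommRing B] (φ : A →+* B) (u : LaurentSeries A)
    (W : A[X]) : laurentMap φ (ev u W) = ev (laurentMap φ u) (W.map φ) := by
  change laurentMap φ (Polynomial.eval₂ _ _ _) = Polynomial.eval₂ _ _ _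
  rw [Polynomial.hom_eval₂, Polynomial.eval₂_map]
  congr 1
  ext1 c
  exact laurentMap_single φ 0 c

theorem single_neg' {A : Type*} [CommRing A] (k : ℤ) (c : A) :
    (HahnSeries.single k (-c) : LaurentSeries A) = -HahnSeries.single k c := by
  ext j
  rw [HahnSeries.coeff_neg, HahnSeries.coeff_single, HahnSeries.coeff_single]
  split_ifs <;> simp

variable {p : ℕ}

/-- The potential at `t = 0`. -/
theorem IsInverseSeries.constantCoeff_eq_zero (hp : 2 ≤ p) {θ : Fin (p - 1) → TimePoly p}
    {u : LaurentSeries (TimePoly p)} (h : IsInverseSeries p θ u) (i : Fin (p - 1)) :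
    MvPolynomial.constantCoeff (θ i) = 0 := by
  set φ : TimePoly p →+* ℂ := MvPolynomial.constantCoeff
  set V := Polynomial.derivative (potential p θ) with hV
  have hVp : (V.map φ).coeff p = 1 := by
    rw [Polynomial.coeff_map, hV, coeff_derivative_potential p hp, if_pos rfl, map_one]
  have hVd : (V.map φ).natDegree ≤ p :=
    Polynomial.natDegree_map_le.trans (natDegree_derivative_potential p hp θ)
  -- At t = 0 all prescribed coefficients but the first vanish, so u is ζ^{1/p} up to order -p - 1;
  -- then V_p' at t = 0 agrees with y^p at this series up to negative order.
  have hu : Le (-(p : ℤ) - 1) (laurentMap φ u - invVar ℂ) := by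
    intro j hj
    rw [map_sub, Pi.sub_apply, sc_laurentMap, sc_laurent, h.coeff_le _ (by omega), invVar,
      sc_single, leadingU]
    split_ifs with h1 h2 h2 h2 h2
    · rw [map_one, sub_self]
    · omega
    · omega
    · rw [map_mul, MvPolynomial.constantCoeff_X, mul_zero, sub_zero]
    · omega
    · rw [map_zero, sub_zero]
  have hm : Monic 1 (laurentMap φ u) := monic_invVar.of_sub (hu.mono (by omega))
  have h1 := (hasSlope_ev (by omega) hVd hVp _ _ _ hm monic_invVar hu).1
  simp only at h1
  rw [← laurentMap_ev, h.eq, laurentMap_single, map_one, ← invVar_pow] at h1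
  have h2 : Polynomial.X ^ p - V.map φ = 0 := by
    refine eq_zero_of_ev_le monic_invVar ?_
    rw [map_sub, map_pow, ev_X]
    exact h1.mono (by omega)
  have h3 := congrArg (fun W => Polynomial.coeff W i) h2
  have hi := i.2
  simp only [Polynomial.coeff_sub, Polynomial.coeff_X_pow, Polynomial.coeff_map,
    Polynomial.coeff_zero, hV, coeff_derivative_potential p hp] at h3
  rw [if_neg (by omega), if_neg (by omega), dif_pos hi, zero_sub, neg_eq_zero] at h3
  exact h3

/-- `r = (V_p')^{1/p}` -/
structure IsRoot (p : ℕ) (θ : Fin (p - 1) → TimePoly p) (r : LaurentSeries (TimePoly p)) : Prop where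
  monic : Monic 1 r
  pow_eq : r ^ p = ev (invVar _) (Polynomial.derivative (potential p θ))

theorem exists_isRoot (hp : 2 ≤ p) (θ : Fin (p - 1) → TimePoly p) : ∃ r, IsRoot p θ r := by
  obtain ⟨r, h1, h2⟩ := (hasSlope_pow (R := LaurentSeries (TimePoly p)) 1 (p := p)
    (by omega)).exists_eq (natCast_mul_inv p hp) (monic_invVar (A := TimePoly p))
    (T := ev (invVar _) (Polynomial.derivative (potential p θ))) (by
      rw [show ((p : ℤ) - 1) * 1 + 1 - 1 = p - 1 by ring]
      refine Monic.sub_le ?_ ⟨le_ev monic_invVar _ _ fun k hk => ?_, ?_⟩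
      · simpa using (monic_invVar (A := TimePoly p)).pow p
      · exact Polynomial.coeff_eq_zero_of_natDegree_lt
          (lt_of_le_of_lt (natDegree_derivative_potential p hp θ) (by exact_mod_cast hk))
      · rw [sc_ev_invVar, if_pos (by omega), Int.toNat_natCast, coeff_derivative_potential p hp,
          if_pos rfl])
  exact ⟨r, h1, h2⟩

theorem IsRoot.unique (hp : 2 ≤ p) {θ : Fin (p - 1) → TimePoly p}
    {r r' : LaurentSeries (TimePoly p)} (h : IsRoot p θ r) (h' : IsRoot p θ r') : r = r' :=
  (hasSlope_pow (R := LaurentSeries (TimePoly p)) 1 (p := p) (by omega)).injOn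
    (natCast_mul_inj p hp) h.monic h'.monic (h.pow_eq.trans h'.pow_eq.symm)

theorem isPrefactor_iff (hp : 2 ≤ p) {θ : Fin (p - 1) → TimePoly p}
    {r : LaurentSeries (TimePoly p)} (hr : IsRoot p θ r) (P : TimePoly p) :
    IsPrefactor p θ P ↔ MvPolynomial.constantCoeff P = 0 ∧
      ∀ i : Fin (p - 1), MvPolynomial.pderiv i P = (r ^ ((i : ℕ) + 1)).coeff 0 := by
  refine and_congr_right fun _ => ⟨?_, fun h => ⟨r, fun k hk => ?_, ?_, ?_, h⟩⟩
  · rintro ⟨r', h1, h2, h3, h4⟩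
    rw [aeval_eq_ev] at h3
    have : IsRoot p θ r' := ⟨⟨fun j hj => by rw [sc_laurent, h1 _ (by omega)], h2⟩, h3⟩
    rw [hr.unique hp this]
    exact h4
  · simpa [sc_laurent] using hr.monic.le (-k) (by omega)
  · exact hr.monic.top
  · rw [aeval_eq_ev]
    exact hr.pow_eq

/-- The polynomial part `Q_i` of `(V_p')^{i/p}`. -/
def flowPoly (r : LaurentSeries (TimePoly p)) (i : ℕ) : (TimePoly p)[X] := polyPart i (r ^ i)

theorem IsRoot.coeff_flowPoly {θ : Fin (p - 1) → TimePoly p}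
    {r : LaurentSeries (TimePoly p)} (hr : IsRoot p θ r) (i k : ℕ) :
    (flowPoly r i).coeff k = sc (r ^ i) k :=
  coeff_polyPart (by simpa using (hr.monic.pow i).le) k

/-- `Q_i(u) = ζ^{i/p} + O(ζ^{-1/p})` -/
theorem ev_flowPoly_sub (hp : 2 ≤ p) {θ : Fin (p - 1) → TimePoly p}
    {u r : LaurentSeries (TimePoly p)} (hu : IsInverseSeries p θ u) (hr : IsRoot p θ r) (i : ℕ) :
    Le (-1) (ev u (flowPoly r i) - HahnSeries.single (-(i : ℤ)) 1) :=
  ev_polyPart_pow_sub (by omega) (natCast_mul_inj p hp) hu.monic hr.monic hu.eq hr.pow_eq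

/-- The Euler operator, applied to Q_i(u) = ζ^{i/p} + O(ζ^{-1/p}), preserves orders and multiplies
ζ^{i/p} by -i. -/
theorem ev_derivative_flowPoly (hp : 2 ≤ p) {θ : Fin (p - 1) → TimePoly p}
    {u r : LaurentSeries (TimePoly p)} (hu : IsInverseSeries p θ u) (hr : IsRoot p θ r) (i : ℕ) :
    Le (-1) (ev u (Polynomial.derivative (flowPoly r i)) * euler _ u +
      HahnSeries.single (-(i : ℤ)) (i : TimePoly p)) := by
  have h := Le.coeffMap (fun j => AddMonoidHom.mulLeft (j : TimePoly p)) (ev_flowPoly_sub hp hu hr i)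
  change Le (-1) (euler _ _) at h
  rw [map_sub, euler_ev, euler_single, mul_one] at h
  convert h using 1
  push_cast
  rw [sub_eq_add_neg, single_neg', neg_neg]

/-- The coefficients of u are known through ζ^{-1}, and of these only one involves a given time,
linearly. -/
theorem coeffwise_u (hp : 2 ≤ p) {θ : Fin (p - 1) → TimePoly p}
    {u : LaurentSeries (TimePoly p)} (hu : IsInverseSeries p θ u) (i : Fin (p - 1)) :
    Le (-(p : ℤ) - 1) (coeffwise (MvPolynomial.pderiv i) u -
      HahnSeries.single ((p : ℤ) - ((i : ℤ) + 1))
        (MvPolynomial.C (((i : ℂ) + 1) / (p : ℂ)) : TimePoly p)) := by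
  intro j hj
  have hi := i.2
  rw [map_sub, Pi.sub_apply, sc_coeffwise, sc_laurent, hu.coeff_le _ (by omega), leadingU,
    sc_single]
  split_ifs with h1 h2 h2 h3 h3
  · omega
  · rw [map_one_eq_zero', sub_zero]
  · have h4 : (⟨((p : ℤ) - 1 - -j).toNat, by omega⟩ : Fin (p - 1)) = i :=
      Fin.ext (by simp only; omega)
    rw [h4, Derivation.leibniz, MvPolynomial.pderiv_C, MvPolynomial.pderiv_X_self, smul_zero, add_zero,
      smul_eq_mul, mul_one, h3]
    push_cast
    rw [sub_eq_zero]
    congr 2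
    ring
  · have h4 : (⟨((p : ℤ) - 1 - -j).toNat, by omega⟩ : Fin (p - 1)) ≠ i := fun h => h3 (by
      rw [← h]; simp only; omega)
    rw [Derivation.leibniz, MvPolynomial.pderiv_C, MvPolynomial.pderiv_X_of_ne h4, smul_zero, smul_zero,
      add_zero, sub_zero]
  · omega
  · rw [map_zero, sub_zero]
where
  map_one_eq_zero' : (MvPolynomial.pderiv i) (1 : TimePoly p) = 0 := Derivation.map_one_eq_zero _

/-- Used to divide by the Euler derivative of u, whose leading coefficient is -1. -/
theorem monic_neg_euler {u : LaurentSeries (TimePoly p)} (hu : Monic 1 u) : Monic 1 (-euler _ u) := by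
  constructor
  · intro j hj
    rw [map_neg, Pi.neg_apply, sc_euler, hu.le j hj, mul_zero, neg_zero]
  · rw [map_neg, Pi.neg_apply, sc_euler, hu.top]
    simp

theorem Le.of_mul_euler {a : ℤ} {x u : LaurentSeries (TimePoly p)} (hu : Monic 1 u)
    (h : Le (a + 1) (x * euler _ u)) : Le a x :=
  Le.of_mul (monic_neg_euler hu) (by rw [mul_neg]; exact h.neg)

theorem C_div_mul (hp : 2 ≤ p) (i : ℕ) :
    (p : TimePoly p) * MvPolynomial.C (((i : ℂ) + 1) / (p : ℂ)) = ((i + 1 : ℕ) : TimePoly p) := by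
  rw [← map_natCast (MvPolynomial.C : ℂ →+* TimePoly p), ← map_mul, mul_div_cancel₀,
    ← map_natCast (MvPolynomial.C : ℂ →+* TimePoly p)]
  · push_cast; rfl
  · exact Nat.cast_ne_zero.mpr (by omega)

/-- `∂V_p'/∂t_i = -∂Q_i/∂y` -/
theorem pderiv_potential (hp : 2 ≤ p) {θ : Fin (p - 1) → TimePoly p}
    {u r : LaurentSeries (TimePoly p)} (hu : IsInverseSeries p θ u) (hr : IsRoot p θ r)
    (i : Fin (p - 1)) :
    polyCoeffwise (MvPolynomial.pderiv i) (Polynomial.derivative (potential p θ)) =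
      -Polynomial.derivative (flowPoly r (i + 1)) := by
  set V := Polynomial.derivative (potential p θ) with hV
  set δ := MvPolynomial.pderiv (R := ℂ) i
  -- The equation V_p'(u) = ζ is differentiated in the time, then by the Euler operator; the factor
  -- V_p''(u) is eliminated between the two.
  have h1 : ev u (polyCoeffwise δ V) + ev u (Polynomial.derivative V) * coeffwise δ u = 0 := by
    rw [← coeffwise_ev, hu.eq, coeffwise_single, Derivation.map_one_eq_zero, map_zero]
  have h2 : ev u (Polynomial.derivative V) * euler _ u =
      HahnSeries.single (-(p : ℤ)) (-(p : TimePoly p)) := by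
    rw [← euler_ev, hu.eq, euler_single]
    push_cast; rw [mul_one]
  have h3 : ev u (polyCoeffwise δ V) * euler _ u =
      HahnSeries.single (-(p : ℤ)) (p : TimePoly p) * coeffwise δ u := by
    rw [eq_neg_of_add_eq_zero_left h1, neg_mul, mul_right_comm, h2, single_neg', neg_mul, neg_neg]
  have h4 : Le (-1) (HahnSeries.single (-(p : ℤ)) (p : TimePoly p) * coeffwise δ u -
      HahnSeries.single (-(((i : ℕ) + 1 : ℕ) : ℤ)) (((i : ℕ) + 1 : ℕ) : TimePoly p)) := by
    have hle : Le p (HahnSeries.single (-(p : ℤ)) (p : TimePoly p) : LaurentSeries (TimePoly p)) :=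
      fun j hj => by rw [sc_single, if_neg (by omega)]
    have := hle.mul (coeffwise_u hp hu i)
    rw [mul_sub, HahnSeries.single_mul_single, C_div_mul hp] at this
    convert this using 1
    · ring
    · congr 3
      push_cast; ring
  refine eq_neg_of_add_eq_zero_left (eq_zero_of_ev_le hu.monic ?_)
  -- The terms (i+1)ζ^{(i+1)/p} of the two expansions cancel. What remains has order at most -1, and
  -- dividing by the Euler derivative of u, of order 1, lowers this to -2.
  refine (Le.of_mul_euler (a := -2) hu.monic ?_).mono (by omega)
  rw [map_add, add_mul, h3]
  have := h4.add (ev_derivative_flowPoly hp hu hr (i + 1))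
  rwa [sub_add_add_cancel] at this

/-- The main term is symmetric in i and j. It arises by differentiating Q_i(u) = ζ^{i/p} +
O(ζ^{-1/p}) in t_j and inserting the leading terms of Q_i'(u)·E(u) and of ∂u/∂t_j, where E is the
Euler operator. -/
theorem pderiv_flowPoly_aux (hp : 2 ≤ p) {θ : Fin (p - 1) → TimePoly p}
    {u r : LaurentSeries (TimePoly p)} (hu : IsInverseSeries p θ u) (hr : IsRoot p θ r)
    (i j : Fin (p - 1)) :
    Le 0 (ev u (polyCoeffwise (MvPolynomial.pderiv j) (flowPoly r (i + 1))) * euler _ u -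
      HahnSeries.single ((p : ℤ) - (i + 1) - (j + 1))
        (MvPolynomial.C (((i : ℂ) + 1) * ((j : ℂ) + 1) / (p : ℂ)) : TimePoly p)) := by
  set δ := MvPolynomial.pderiv (R := ℂ) j
  set Q := flowPoly r (i + 1)
  have hi := i.2
  have hj := j.2
  have hEu : Le 1 (euler _ u) := Le.coeffMap _ hu.monic.le
  have h1 : Le (-1) (coeffwise δ (ev u Q)) := by
    have := Le.coeffMap (fun _ => (δ : TimePoly p →ₗ[ℂ] TimePoly p).toAddMonoidHom)
      (ev_flowPoly_sub hp hu hr (i + 1))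
    change Le (-1) (coeffwise δ _) at this
    rwa [map_sub, coeffwise_single, Derivation.map_one_eq_zero, map_zero, sub_zero] at this
  rw [coeffwise_ev] at h1
  set q := ev u (Polynomial.derivative Q) * euler _ u with hq
  have h2 := ev_derivative_flowPoly hp hu hr (i + 1)
  rw [← hq] at h2
  have h3 := coeffwise_u hp hu j
  set a : LaurentSeries (TimePoly p) := HahnSeries.single (-(((i : ℕ) + 1 : ℕ) : ℤ)) (((i : ℕ) + 1 : ℕ) : TimePoly p)
    with ha
  set b : LaurentSeries (TimePoly p) := HahnSeries.single ((p : ℤ) - ((j : ℤ) + 1))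
        (MvPolynomial.C (((j : ℂ) + 1) / (p : ℂ)) : TimePoly p) with hb
  have hab : a * b = HahnSeries.single ((p : ℤ) - (i + 1) - (j + 1))
        (MvPolynomial.C (((i : ℂ) + 1) * ((j : ℂ) + 1) / (p : ℂ)) : TimePoly p) := by
    rw [ha, hb, HahnSeries.single_mul_single,
      ← map_natCast (MvPolynomial.C : ℂ →+* TimePoly p), ← map_mul]
    rw [show -(((i : ℕ) + 1 : ℕ) : ℤ) + ((p : ℤ) - (j + 1)) = p - (i + 1) - (j + 1) by
      push_cast; ring, ← mul_div_assoc]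
    push_cast
    rfl
  have hla : Le ((i : ℤ) + 1) a := fun k hk => by rw [ha, sc_single, if_neg (by push_cast; omega)]
  have hlb : Le ((j : ℤ) + 1 - p) b := fun k hk => by rw [hb, sc_single, if_neg (by omega)]
  rw [← hab]
  -- With q = -a + O(ζ^{-1/p}) and ∂u/∂t_j = b + O(ζ^{-1-1/p}), every term besides a b has order at
  -- most 0.
  have e : ev u (polyCoeffwise δ Q) * euler _ u - a * b =
      (ev u (polyCoeffwise δ Q) + ev u (Polynomial.derivative Q) * coeffwise δ u) * euler _ u
        - (q + a) * (coeffwise δ u - b) - (q + a) * b + a * (coeffwise δ u - b) := by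
    rw [hq]; ring
  rw [e]
  refine Le.add (Le.sub (Le.sub ?_ ?_) ?_) ?_
  · exact (h1.mul hEu).mono (by omega)
  · exact (h2.mul h3).mono (by omega)
  · exact (h2.mul hlb).mono (by omega)
  · exact (hla.mul h3).mono (by omega)

/-- `∂Q_i/∂t_j = ∂Q_j/∂t_i` -/
theorem pderiv_flowPoly_comm (hp : 2 ≤ p) {θ : Fin (p - 1) → TimePoly p}
    {u r : LaurentSeries (TimePoly p)} (hu : IsInverseSeries p θ u) (hr : IsRoot p θ r)
    (i j : Fin (p - 1)) :
    polyCoeffwise (MvPolynomial.pderiv j) (flowPoly r (i + 1)) =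
      polyCoeffwise (MvPolynomial.pderiv i) (flowPoly r (j + 1)) := by
  rw [← sub_eq_zero]
  -- Order 0 before division by the Euler derivative of u becomes order -1 after it, just enough for
  -- the polynomial to vanish.
  refine eq_zero_of_ev_le hu.monic (Le.of_mul_euler hu.monic ?_)
  have := (pderiv_flowPoly_aux hp hu hr i j).sub (pderiv_flowPoly_aux hp hu hr j i)
  rw [show (p : ℤ) - (j + 1) - (i + 1) = p - (i + 1) - (j + 1) by ring,
    mul_comm ((j : ℂ) + 1), sub_sub_sub_cancel_right, ← sub_mul, ← map_sub] at this
  simpa using this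

/-- The potential with its `p`-th root and prefactor, and the equations that they satisfy. -/
structure PotentialData (p : ℕ) (θ : Fin (p - 1) → TimePoly p) (r : LaurentSeries (TimePoly p))
    (P : TimePoly p) : Prop where
  isRoot : IsRoot p θ r
  constantCoeff_theta : ∀ i, MvPolynomial.constantCoeff (θ i) = 0
  constantCoeff_prefactor : MvPolynomial.constantCoeff P = 0
  pderiv_potential : ∀ i : Fin (p - 1), ∀ k,
    MvPolynomial.pderiv i ((Polynomial.derivative (potential p θ)).coeff k) =
      -(Polynomial.derivative (flowPoly r (i + 1))).coeff k
  pderiv_prefactor : ∀ i : Fin (p - 1), MvPolynomial.pderiv i P = (flowPoly r (i + 1)).coeff 0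

theorem exists_potentialData (hp : 2 ≤ p) : ∃ θ r P, PotentialData p θ r P ∧
    (∀ θ', IsTimeParam p θ' ↔ θ' = θ) ∧ (∀ P', IsPrefactor p θ P' ↔ P' = P) := by
  obtain ⟨θ, u, hu⟩ := exists_isInverseSeries hp
  obtain ⟨r, hr⟩ := exists_isRoot hp θ
  obtain ⟨P, hP0, hP⟩ := exists_primitive
    (fun i : Fin (p - 1) => (flowPoly r ((i : ℕ) + 1)).coeff 0) (fun i j => by
      rw [← coeff_polyCoeffwise, ← coeff_polyCoeffwise, pderiv_flowPoly_comm hp hu hr])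
  have hcoeff : ∀ i : Fin (p - 1), (r ^ ((i : ℕ) + 1)).coeff 0 = (flowPoly r (i + 1)).coeff 0 := by
    intro i
    rw [hr.coeff_flowPoly, sc_laurent]; simp
  refine ⟨θ, r, P, ⟨hr, hu.constantCoeff_eq_zero hp, hP0, fun i k => ?_, hP⟩, fun θ' => ?_,
    fun P' => ?_⟩
  · rw [← coeff_polyCoeffwise, pderiv_potential hp hu hr, Polynomial.coeff_neg]
  · rw [isTimeParam_iff p hp]
    exact ⟨fun ⟨u', hu'⟩ => hu'.unique hp hu, fun h => h ▸ ⟨u, hu⟩⟩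
  · rw [isPrefactor_iff hp hr]
    constructor
    · rintro ⟨h0, h⟩
      exact primitive_unique (h0.trans hP0.symm) fun i => by rw [h i, hcoeff, hP]
    · rintro rfl
      exact ⟨hP0, fun i => by rw [hP, hcoeff]⟩

end

/-! ### Restriction to zero times, operators free of x, adjoints. -/

section

open SymbolRing

/-! ### Evaluation at zero of some of the variables -/

open Classical in
/-- `setZero` as a ring homomorphism. -/
def zeroHom (S : Set ℕ) : Fn →+* Fn := MvPowerSeries.rescale fun i => if i ∈ S then (0 : ℂ) else 1

theorem zeroHom_apply (S : Set ℕ) (f : Fn) : zeroHom S f = setZero S f := by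
  classical
  ext m
  rw [zeroHom, MvPowerSeries.coeff_rescale]
  change _ = if ∀ i ∈ S, m i = 0 then MvPowerSeries.coeff m f else 0
  split_ifs with h
  · rw [Finsupp.prod, Finset.prod_eq_one, one_mul]
    intro i hi
    rw [if_neg (fun hiS => Finsupp.mem_support_iff.mp hi (h i hiS)), one_pow]
  · push Not at h
    obtain ⟨i, hiS, hi⟩ := h
    rw [Finsupp.prod, Finset.prod_eq_zero (Finsupp.mem_support_iff.mpr hi), zero_mul]
    rw [if_pos hiS, zero_pow hi]

/-- `setZero` is defined with classical decidability; an arbitrary instance is admitted here so that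
rewriting applies. -/
theorem coeff_setZero (S : Set ℕ) (f : Fn) (m : ℕ →₀ ℕ) [Decidable (∀ i ∈ S, m i = 0)] :
    MvPowerSeries.coeff m (setZero S f) =
      if ∀ i ∈ S, m i = 0 then MvPowerSeries.coeff m f else 0 := by
  have h : MvPowerSeries.coeff m (setZero S f) = @ite _ (∀ i ∈ S, m i = 0)
    (Classical.propDecidable _) (MvPowerSeries.coeff m f) 0 := rfl
  rw [h]
  congr

theorem pd_setZero {S : Set ℕ} {i : ℕ} (hi : i ∉ S) (f : Fn) :
    pd i (setZero S f) = setZero S (pd i f) := by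
  classical
  ext m
  rw [coeff_pd, coeff_setZero, coeff_setZero, coeff_pd]
  have : (∀ j ∈ S, (m + Finsupp.single i 1 : ℕ →₀ ℕ) j = 0) ↔ ∀ j ∈ S, m j = 0 := by
    refine forall₂_congr fun j hj => ?_
    rw [Finsupp.add_apply, Finsupp.single_eq_of_ne (fun h : j = i => hi (h ▸ hj)), add_zero]
  simp only [this]
  split_ifs <;> simp

theorem dx_setZero {S : Set ℕ} (hS : 0 ∉ S) (k : ℕ) (f : Fn) :
    dx k (setZero S f) = setZero S (dx k f) := by
  induction k with
  | zero => simp only [dx_zero_apply]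
  | succ k ih => rw [dx_succ, dx_succ, ih, pd_setZero hS]

theorem setZero_X (S : Set ℕ) [DecidablePred (· ∈ S)] (i : ℕ) :
    setZero S (MvPowerSeries.X i) = if i ∈ S then 0 else MvPowerSeries.X i := by
  classical
  rw [← zeroHom_apply, zeroHom]
  ext m
  rw [MvPowerSeries.coeff_rescale, MvPowerSeries.coeff_X, apply_ite (MvPowerSeries.coeff m),
    MvPowerSeries.coeff_X, map_zero]
  by_cases hm : m = Finsupp.single i 1
  · subst hm
    simp [Finsupp.prod_single_index]
  · simp [hm]

theorem setZero_C (S : Set ℕ) (c : ℂ) : setZero S (MvPowerSeries.C c) = MvPowerSeries.C c := by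
  classical
  rw [← zeroHom_apply, zeroHom]
  ext m
  rw [MvPowerSeries.coeff_rescale, MvPowerSeries.coeff_C]
  split_ifs with h
  · subst h; simp
  · simp

/-! ### Polynomials in the times as functions -/

theorem timePolyToFn_C (p : ℕ) (c : ℂ) :
    timePolyToFn p (MvPolynomial.C c) = MvPowerSeries.C c := by
  simp [timePolyToFn]

theorem timePolyToFn_X (p : ℕ) (i : Fin (p - 1)) :
    timePolyToFn p (MvPolynomial.X i) = MvPowerSeries.X ((i : ℕ) + 1) := by
  simp [timePolyToFn]

theorem timePolyToFn_apply (p : ℕ) (f : TimePoly p) : timePolyToFn p f =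
    ((MvPolynomial.rename (fun i : Fin (p - 1) => (i : ℕ) + 1) f : MvPolynomial ℕ ℂ) : Fn) := rfl

theorem pd_timePolyToFn (p : ℕ) (i : Fin (p - 1)) (f : TimePoly p) :
    pd (i + 1) (timePolyToFn p f) = timePolyToFn p (MvPolynomial.pderiv i f) := by
  rw [timePolyToFn_apply, timePolyToFn_apply, pd, MvPowerSeries.pderiv_coe,
    ← MvPolynomial.pderiv_rename (f := fun i : Fin (p - 1) => (i : ℕ) + 1)
      (fun a b h => Fin.ext (by simpa using h))]

theorem pd_zero_timePolyToFn (p : ℕ) (f : TimePoly p) : pd 0 (timePolyToFn p f) = 0 := by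
  classical
  rw [timePolyToFn_apply, pd, MvPowerSeries.pderiv_coe, MvPolynomial.pderiv_eq_zero_of_notMem_vars,
    MvPolynomial.coe_zero]
  intro h
  obtain ⟨j, -, hj⟩ := Finset.mem_image.mp (MvPolynomial.vars_rename _ _ h)
  omega

theorem setZero_timePolyToFn_of_one_le (p : ℕ) (f : TimePoly p) :
    setZero {i | 1 ≤ i} (timePolyToFn p f) =
      MvPowerSeries.C (MvPolynomial.constantCoeff f) := by
  classical
  have : (zeroHom {i | 1 ≤ i}).comp (timePolyToFn p) =
      (MvPowerSeries.C : ℂ →+* Fn).comp MvPolynomial.constantCoeff := by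
    refine MvPolynomial.ringHom_ext (fun c => ?_) fun i => ?_
    · simp only [RingHom.comp_apply, timePolyToFn_C, zeroHom_apply, setZero_C,
        MvPolynomial.constantCoeff_C]
    · simp only [RingHom.comp_apply, timePolyToFn_X, zeroHom_apply, setZero_X,
        MvPolynomial.constantCoeff_X, map_zero]
      rw [if_pos (by simp)]
  rw [← zeroHom_apply]
  exact congrArg (fun φ => φ f) this

theorem setZero_timePolyToFn (p : ℕ) (f : TimePoly p) :
    setZero {i | p ≤ i} (timePolyToFn p f) = timePolyToFn p f := by
  classical
  have : (zeroHom {i | p ≤ i}).comp (timePolyToFn p) = timePolyToFn p := by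
    refine MvPolynomial.ringHom_ext (fun c => ?_) fun i => ?_
    · simp only [RingHom.comp_apply, timePolyToFn_C, zeroHom_apply, setZero_C]
    · simp only [RingHom.comp_apply, timePolyToFn_X, zeroHom_apply, setZero_X]
      have := i.2
      rw [if_neg (by simp only [Set.mem_ofPred_eq]; omega)]
  rw [← zeroHom_apply]
  exact congrArg (fun φ => φ f) this

theorem natCast_mul_inj_fn {p : ℕ} (hp : p ≠ 0) (b : Fn) (h : (p : Fn) * b = 0) : b = 0 := by
  ext m
  have h1 := congrArg (MvPowerSeries.coeff m) h
  rw [← nsmul_eq_mul, map_nsmul, nsmul_eq_mul, map_zero] at h1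
  rw [map_zero]
  exact (mul_eq_zero.mp h1).resolve_left (Nat.cast_ne_zero.mpr hp)

theorem natCast_mul_inv_fn {p : ℕ} (hp : p ≠ 0) :
    (p : Fn) * MvPowerSeries.C (1 / (p : ℂ)) = 1 := by
  rw [← map_natCast (MvPowerSeries.C : ℂ →+* Fn), ← map_mul, mul_one_div_cancel, map_one]
  exact Nat.cast_ne_zero.mpr hp

namespace PsiDO

/-! ### Derivations and restrictions of operators -/

theorem OrdLE.map {P Q : PsiDO} {N : ℤ} (h : P.OrdLE N)
    (hQ : ∀ j, P.coeff j = 0 → Q.coeff j = 0) : Q.OrdLE N := fun j hj => hQ j (h j hj)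

theorem timeDeriv_mul (i : ℕ) (P Q : PsiDO) :
    (P * Q).timeDeriv i = P.timeDeriv i * Q + P * Q.timeDeriv i := by
  obtain ⟨N, hN⟩ := P.exists_ordLE
  obtain ⟨M, hM⟩ := Q.exists_ordLE
  have hN' : (P.timeDeriv i).OrdLE N := hN.map fun j hj => by rw [coeff_timeDeriv, hj, pd_zero]
  have hM' : (Q.timeDeriv i).OrdLE M := hM.map fun j hj => by rw [coeff_timeDeriv, hj, pd_zero]
  ext1; funext m
  have hK : N + M - m < ((N + M - m).toNat + 1 : ℕ) := by omega
  rw [coeff_timeDeriv, coeff_add, coeff_mul hN hM m _ hK, coeff_mul hN' hM m _ hK,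
    coeff_mul hN hM' m _ hK, ← Finset.sum_add_distrib, pd_sum]
  refine Finset.sum_congr rfl fun a _ => ?_
  rw [← Finset.sum_add_distrib, pd_sum]
  refine Finset.sum_congr rfl fun k _ => ?_
  rw [pd_zsmul, pd_mul, pd_dx, smul_add]
  rfl

theorem coeff_restrict (S : Set ℕ) (P : PsiDO) (j : ℤ) :
    (P.restrict S).coeff j = setZero S (P.coeff j) := rfl

/-- Composition differentiates the coefficients in x, so x (the variable 0) must not be among the
variables that are set to zero. -/
theorem restrict_mul {S : Set ℕ} (hS : 0 ∉ S) (P Q : PsiDO) :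
    (P * Q).restrict S = P.restrict S * Q.restrict S := by
  obtain ⟨N, hN⟩ := P.exists_ordLE
  obtain ⟨M, hM⟩ := Q.exists_ordLE
  have h0 : setZero S 0 = 0 := by rw [← zeroHom_apply, map_zero]
  have hN' : (P.restrict S).OrdLE N := hN.map fun j hj => by rw [coeff_restrict, hj, h0]
  have hM' : (Q.restrict S).OrdLE M := hM.map fun j hj => by rw [coeff_restrict, hj, h0]
  ext1; funext m
  have hK : N + M - m < ((N + M - m).toNat + 1 : ℕ) := by omega
  rw [coeff_restrict, coeff_mul hN hM m _ hK, coeff_mul hN' hM' m _ hK, ← zeroHom_apply, map_sum]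
  refine Finset.sum_congr rfl fun a _ => ?_
  rw [map_sum]
  refine Finset.sum_congr rfl fun k _ => ?_
  rw [map_zsmul, map_mul, zeroHom_apply, zeroHom_apply, ← dx_setZero hS]
  rfl

theorem restrict_one (S : Set ℕ) : (1 : PsiDO).restrict S = 1 := by
  ext1; funext m
  rw [coeff_restrict, coeff_one', ← zeroHom_apply]
  split_ifs <;> simp

theorem restrict_sub (S : Set ℕ) (P Q : PsiDO) :
    (P - Q).restrict S = P.restrict S - Q.restrict S := by
  ext1; funext m
  simp only [coeff_restrict, coeff_sub, ← zeroHom_apply, map_sub]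

theorem restrict_pow {S : Set ℕ} (hS : 0 ∉ S) (P : PsiDO) (k : ℕ) :
    (P ^ k).restrict S = P.restrict S ^ k := by
  induction k with
  | zero => rw [pow_zero, pow_zero, restrict_one]
  | succ k ih => rw [pow_succ, pow_succ, restrict_mul hS, ih]

theorem restrict_plus (S : Set ℕ) (P : PsiDO) : P.plus.restrict S = (P.restrict S).plus := by
  ext1; funext m
  rw [coeff_restrict, coeff_plus, coeff_plus, coeff_restrict]
  split_ifs
  · rfl
  · rw [← zeroHom_apply, map_zero]

theorem restrict_timeDeriv {S : Set ℕ} {i : ℕ} (hi : i ∉ S) (P : PsiDO) :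
    (P.timeDeriv i).restrict S = (P.restrict S).timeDeriv i := by
  ext1; funext m
  rw [coeff_restrict, coeff_timeDeriv, coeff_timeDeriv, coeff_restrict, pd_setZero hi]

/-! ### Adjoints -/

theorem coeff_adjoint {P : PsiDO} {N : ℤ} (hN : P.OrdLE N) (m : ℤ) (K : ℕ) (hK : N - m < K) :
    P.adjoint.coeff m = ∑ k ∈ Finset.range K,
      ((((-1 : ℤˣ) ^ (m + k) : ℤˣ) : ℤ) * Ring.choose (m + k) k) • dx k (P.coeff (m + k)) := by
  have h : P.adjoint.coeff m = ∑ᶠ k : ℕ, ((((-1 : ℤˣ) ^ (m + k) : ℤˣ) : ℤ) *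
    Ring.choose (m + k) k) • (pd 0)^[k] (P.coeff (m + k)) := rfl
  rw [h, finsum_eq_sum_of_support_subset (s := Finset.range K)]
  · simp only [iterate_pd]
  · intro k hk
    simp only [Function.mem_support, iterate_pd] at hk
    have h1 : ¬ N < m + k := fun h => hk (by rw [hN _ h, map_zero, smul_zero])
    rw [Finset.mem_coe, Finset.mem_range]
    omega

theorem OrdLE.adjoint {P : PsiDO} {N : ℤ} (hN : P.OrdLE N) : P.adjoint.OrdLE N := fun m hm => by
  rw [coeff_adjoint hN m 0 (by push_cast; omega), Finset.sum_range_zero]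

theorem adjoint_sub (P Q : PsiDO) : (P - Q).adjoint = P.adjoint - Q.adjoint := by
  obtain ⟨N, hP, hQ⟩ := exists_ordLE₂ P Q
  ext1; funext m
  have hK : N - m < ((N - m).toNat + 1 : ℕ) := by omega
  rw [coeff_sub, coeff_adjoint (hP.sub hQ) m _ hK, coeff_adjoint hP m _ hK, coeff_adjoint hQ m _ hK,
    ← Finset.sum_sub_distrib]
  refine Finset.sum_congr rfl fun k _ => ?_
  rw [coeff_sub, map_sub, smul_sub]

theorem restrict_adjoint {S : Set ℕ} (hS : 0 ∉ S) (P : PsiDO) :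
    P.adjoint.restrict S = (P.restrict S).adjoint := by
  obtain ⟨N, hN⟩ := P.exists_ordLE
  have hN' : (P.restrict S).OrdLE N := hN.map fun j hj => by
    rw [coeff_restrict, hj, ← zeroHom_apply, map_zero]
  ext1; funext m
  have hK : N - m < ((N - m).toNat + 1 : ℕ) := by omega
  rw [coeff_restrict, coeff_adjoint hN m _ hK, coeff_adjoint hN' m _ hK, ← zeroHom_apply, map_sum]
  refine Finset.sum_congr rfl fun k _ => ?_
  rw [map_zsmul, zeroHom_apply, ← dx_setZero hS, coeff_restrict]

theorem coeff_adjoint_of_pd_eq_zero {P : PsiDO} (h : ∀ j, pd 0 (P.coeff j) = 0) (m : ℤ) :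
    P.adjoint.coeff m = (((-1 : ℤˣ) ^ m : ℤˣ) : ℤ) • P.coeff m := by
  obtain ⟨N, hN⟩ := P.exists_ordLE
  rw [coeff_adjoint hN m ((N - m).toNat + 1) (by omega), Finset.sum_eq_single_of_mem 0 (by simp)]
  · simp [dx_zero_apply]
  · intro k _ hk
    rw [dx_of_pd_eq_zero (h _) hk, smul_zero]

/-! ### Action on functions -/

theorem plusApply_eq_sum {P : PsiDO} {N : ℕ} (hP : ∀ j : ℕ, N < j → P.coeff j = 0) (f : Fn) :
    P.plusApply f = ∑ j ∈ Finset.range (N + 1), P.coeff j * dx j f := by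
  rw [plusApply, finsum_eq_sum_of_support_subset (s := Finset.range (N + 1))]
  · simp only [iterate_pd]
  · intro k hk
    rw [Finset.mem_coe, Finset.mem_range]
    by_contra h
    exact hk (by simp only; rw [hP k (by omega), zero_mul])

theorem setZero_plusApply {S : Set ℕ} (hS : 0 ∉ S) (P : PsiDO) (f : Fn) :
    setZero S (P.plusApply f) = (P.restrict S).plusApply (setZero S f) := by
  obtain ⟨N, hN⟩ := P.exists_ordLE
  have h1 : ∀ j : ℕ, N.toNat < j → P.coeff j = 0 := fun j hj => hN j (by omega)
  have h2 : ∀ j : ℕ, N.toNat < j → (P.restrict S).coeff j = 0 := fun j hj => by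
    rw [coeff_restrict, h1 j hj, ← zeroHom_apply, map_zero]
  rw [plusApply_eq_sum h1, plusApply_eq_sum h2, ← zeroHom_apply, map_sum]
  refine Finset.sum_congr rfl fun k _ => ?_
  rw [map_mul, zeroHom_apply, zeroHom_apply, dx_setZero hS, coeff_restrict]

/-! ### Multiplication by `x` -/

/-- The operator of multiplication by `x`. -/
def mulX : PsiDO := ofPoly (Polynomial.C (MvPowerSeries.X 0))

theorem coeff_mulX (j : ℤ) : mulX.coeff j = if j = 0 then MvPowerSeries.X 0 else 0 := by
  rw [mulX, coeff_ofPoly, Polynomial.coeff_C]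
  split_ifs <;> first | rfl | omega

theorem pd_X_self (i : ℕ) : pd i (MvPowerSeries.X i) = 1 := MvPowerSeries.pderiv_X_self

theorem pd_X_of_ne {i j : ℕ} (h : j ≠ i) : pd i (MvPowerSeries.X j) = 0 :=
  MvPowerSeries.pderiv_X_of_ne h

theorem dx_X {k : ℕ} (hk : 2 ≤ k) : dx k (MvPowerSeries.X 0) = 0 := by
  obtain ⟨l, rfl⟩ := Nat.exists_eq_add_of_le' hk
  rw [show l + 2 = (l + 1) + 1 by ring, ← dx_dx, show dx 1 (MvPowerSeries.X 0) = 1 by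
    rw [dx_succ, dx_zero_apply, pd_X_self], dx_of_pd_eq_zero (pd_one 0) (Nat.succ_ne_zero l)]

/-- The rule D^i x = x D^i + i D^{i-1}: higher derivatives of x vanish. With `coeff_mulX_mul` it
shows that the commutator with x is the formal derivative in D. -/
theorem coeff_mul_mulX (T : PsiDO) (m : ℤ) :
    (T * mulX).coeff m = T.coeff m * MvPowerSeries.X 0 + (m + 1) • T.coeff (m + 1) := by
  rw [coeff_mul_def, finsum_eq_sum_of_support_subset (s := {(m, 0), (m + 1, 1)}),
    Finset.sum_pair (by simp)]
  · simp only [iterate_pd, dx_zero_apply, coeff_mulX]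
    rw [if_pos (by simp), if_pos (by push_cast; ring), dx_succ, dx_zero_apply, pd_X_self]
    simp
  · rintro ⟨i, k⟩ h
    simp only [Function.mem_support, iterate_pd, coeff_mulX] at h
    have h1 : m - i + k = 0 := by
      by_contra h'
      exact h (by rw [if_neg h', map_zero, mul_zero, smul_zero])
    have h2 : k < 2 := by
      by_contra h'
      exact h (by rw [if_pos h1, dx_X (not_lt.mp h'), mul_zero, smul_zero])
    simp only [Finset.coe_insert, Finset.coe_singleton, Set.mem_insert_iff, Prod.mk.injEq,
      Set.mem_singleton_iff]
    omega

theorem coeff_mulX_mul (T : PsiDO) (m : ℤ) :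
    (mulX * T).coeff m = MvPowerSeries.X 0 * T.coeff m := by
  rw [coeff_mul_def, finsum_eq_single _ ((0 : ℤ), 0)]
  · simp [coeff_mulX]
  · rintro ⟨i, k⟩ h
    simp only [coeff_mulX]
    split_ifs with h1
    · rw [h1, Ring.choose_zero_pos ℤ (Nat.pos_of_ne_zero fun hk => h (by rw [h1, hk])), zero_smul]
    · rw [zero_mul, smul_zero]

theorem adjoint_mulX : mulX.adjoint = mulX := by
  ext1; funext m
  have h0 : mulX.OrdLE 0 := fun j hj => by rw [coeff_mulX, if_neg hj.ne']
  rw [coeff_adjoint h0 m ((-m).toNat + 1) (by omega), coeff_mulX m]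
  split_ifs with h
  · subst h
    simp [coeff_mulX, dx_zero_apply]
  · refine Finset.sum_eq_zero fun k _ => ?_
    rw [coeff_mulX]
    split_ifs with h1
    · rw [h1, Ring.choose_zero_pos ℤ (by omega), mul_zero, zero_smul]
    · rw [map_zero, smul_zero]

end PsiDO

/-! ### Operators with coefficients independent of `x` -/

/-- The operator obtained from a Laurent series in `y⁻¹` by the substitution `y = D`. -/
def ofLaurent (p : ℕ) (v : LaurentSeries (TimePoly p)) : PsiDO where
  coeff j := timePolyToFn p (sc v j)
  bdd := by
    obtain ⟨N, hN⟩ := exists_le v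
    exact ⟨N, fun j hj => by rw [hN j hj, map_zero]⟩

theorem coeff_ofLaurent (p : ℕ) (v : LaurentSeries (TimePoly p)) (j : ℤ) :
    (ofLaurent p v).coeff j = timePolyToFn p (sc v j) := rfl

/-- The coefficients do not depend on x, so only the terms with k = 0 of the composition survive and
the symbols multiply as commuting series. -/
theorem ofLaurent_mul (p : ℕ) (v v' : LaurentSeries (TimePoly p)) :
    ofLaurent p (v * v') = ofLaurent p v * ofLaurent p v' := by
  obtain ⟨N, hN⟩ := exists_le v
  obtain ⟨M, hM⟩ := exists_le v'
  have hN' : (ofLaurent p v).OrdLE N := fun j hj => by rw [coeff_ofLaurent, hN j hj, map_zero]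
  have hM' : (ofLaurent p v').OrdLE M := fun j hj => by rw [coeff_ofLaurent, hM j hj, map_zero]
  ext1; funext m
  have hK : N + M - m < ((N + M - m).toNat + 1 : ℕ) := by omega
  rw [PsiDO.coeff_mul hN' hM' m _ hK, coeff_ofLaurent, sc_laurent,
    laurent_coeff_mul (a := -N) (b := -M) (K := (N + M - m).toNat + 1)
      (fun i hi => by simpa [sc_laurent] using hN (-i) (by omega))
      (fun i hi => by simpa [sc_laurent] using hM (-i) (by omega)) _ (by omega), map_sum]
  refine Finset.sum_congr rfl fun a _ => ?_
  rw [Finset.sum_eq_single_of_mem 0 (by simp)]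
  · rw [dx_zero_apply, Ring.choose_zero_right, one_smul, map_mul, coeff_ofLaurent, coeff_ofLaurent,
      sc_laurent, sc_laurent]
    congr 4 <;> push_cast <;> ring
  · intro k _ hk
    rw [coeff_ofLaurent _ v', dx_of_pd_eq_zero (pd_zero_timePolyToFn p _) hk, mul_zero, smul_zero]

theorem ofLaurent_one (p : ℕ) : ofLaurent p 1 = 1 := by
  ext1; funext m
  rw [coeff_ofLaurent, PsiDO.coeff_one', sc_laurent, HahnSeries.coeff_one]
  simp only [neg_eq_zero]
  split_ifs <;> simp

theorem ofLaurent_pow (p : ℕ) (v : LaurentSeries (TimePoly p)) (k : ℕ) :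
    ofLaurent p (v ^ k) = ofLaurent p v ^ k := by
  induction k with
  | zero => rw [pow_zero, pow_zero, ofLaurent_one]
  | succ k ih => rw [pow_succ, pow_succ, ofLaurent_mul, ih]

theorem ofLaurent_sub (p : ℕ) (v v' : LaurentSeries (TimePoly p)) :
    ofLaurent p (v - v') = ofLaurent p v - ofLaurent p v' := by
  ext1; funext m
  rw [PsiDO.coeff_sub, coeff_ofLaurent, coeff_ofLaurent, coeff_ofLaurent, map_sub, Pi.sub_apply,
    map_sub]

theorem ofLaurent_ev (p : ℕ) (W : (TimePoly p)[X]) :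
    ofLaurent p (ev (invVar _) W) = PsiDO.ofPoly (W.map (timePolyToFn p)) := by
  ext1; funext m
  rw [coeff_ofLaurent, sc_ev_invVar, PsiDO.coeff_ofPoly, Polynomial.coeff_map]
  split_ifs
  · rfl
  · exact map_zero _

theorem ofLaurent_comm (p : ℕ) (v v' : LaurentSeries (TimePoly p)) :
    ofLaurent p v * ofLaurent p v' = ofLaurent p v' * ofLaurent p v := by
  rw [← ofLaurent_mul, mul_comm, ofLaurent_mul]

/-- The substitution `y ↦ -y` in Laurent series. -/
def flipVar {A : Type*} [CommRing A] : LaurentSeries A →+ LaurentSeries A :=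
  coeffMap fun j => AddMonoidHom.mulLeft ((((-1 : ℤˣ) ^ j : ℤˣ) : ℤ) : A)

theorem sc_flipVar {A : Type*} [CommRing A] (x : LaurentSeries A) (j : ℤ) :
    sc (flipVar x) j = ((((-1 : ℤˣ) ^ j : ℤˣ) : ℤ) : A) * sc x j := by
  rw [flipVar, sc_coeffMap, AddMonoidHom.coe_mulLeft]
  congr 3
  rw [zpow_neg, ← inv_zpow, inv_neg, inv_one]

theorem flipVar_mul {A : Type*} [CommRing A] (x y : LaurentSeries A) :
    flipVar (x * y) = flipVar x * flipVar y := by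
  ext m
  change ((((-1 : ℤˣ) ^ m : ℤˣ) : ℤ) : A) * (x * y).coeff m = _
  have hx : ∀ j < x.order, x.coeff j = 0 := fun j hj => HahnSeries.coeff_eq_zero_of_lt_order hj
  have hy : ∀ j < y.order, y.coeff j = 0 := fun j hj => HahnSeries.coeff_eq_zero_of_lt_order hj
  have hc : ∀ (z : LaurentSeries A) (j : ℤ),
    (flipVar z).coeff j = ((((-1 : ℤˣ) ^ j : ℤˣ) : ℤ) : A) * z.coeff j := fun _ _ => rfl
  obtain ⟨K, hK⟩ : ∃ K : ℕ, m - x.order - y.order < K :=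
    ⟨(m - x.order - y.order).toNat + 1, by omega⟩
  rw [laurent_coeff_mul hx hy m K hK, laurent_coeff_mul (a := x.order) (b := y.order)
    (fun j hj => by rw [hc, hx j hj, mul_zero]) (fun j hj => by rw [hc, hy j hj, mul_zero]) m K hK,
    Finset.mul_sum]
  refine Finset.sum_congr rfl fun k _ => ?_
  rw [hc, hc, show m = (x.order + k) + (m - x.order - k) by ring, zpow_add]
  push_cast
  rw [show (x.order + k) + (m - x.order - k) - x.order - k = m - x.order - k by ring]
  ring

theorem flipVar_pow {A : Type*} [CommRing A] (x : LaurentSeries A) (k : ℕ) :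
    flipVar (x ^ k) = flipVar x ^ k := by
  induction k with
  | zero =>
    rw [pow_zero, pow_zero]
    apply sc_injective
    funext j
    rw [sc_flipVar, sc_laurent, HahnSeries.coeff_one]
    split_ifs with h
    · rw [neg_eq_zero] at h; subst h; simp
    · rw [mul_zero]
  | succ k ih => rw [pow_succ, pow_succ, flipVar_mul, ih]

theorem adjoint_ofLaurent (p : ℕ) (v : LaurentSeries (TimePoly p)) :
    (ofLaurent p v).adjoint = ofLaurent p (flipVar v) := by
  ext1; funext m
  rw [PsiDO.coeff_adjoint_of_pd_eq_zero fun j => pd_zero_timePolyToFn p _, coeff_ofLaurent,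
    coeff_ofLaurent, sc_flipVar, map_mul, map_intCast, zsmul_eq_mul]

end

/-! ### The p-th root of the explicit operator and its Lax equations. -/

section

open SymbolRing

variable {p : ℕ}

theorem exists_invSeries (p n : ℕ) (w : ℂ) : ∃ q : LaurentSeries (TimePoly p),
    Le (-1) q ∧ ofLaurent p q = (n : Fn) • PsiDO.invDSub w := by
  obtain ⟨q, hq⟩ := exists_sc (R := LaurentSeries (TimePoly p))
    (fun j => if j < 0 then (n : TimePoly p) * MvPolynomial.C (w ^ (-1 - j).toNat) else 0)
    ⟨0, fun j hj => if_neg (by omega)⟩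
  refine ⟨q, fun j hj => ?_, ?_⟩
  · rw [hq]
    exact if_neg (by omega)
  · ext1; funext j
    rw [coeff_ofLaurent, hq, PsiDO.coeff_smul]
    change timePolyToFn p (if j < 0 then _ else 0) =
      (n : Fn) * if j < 0 then MvPowerSeries.C (w ^ (-1 - j).toNat) else 0
    split_ifs
    · rw [map_mul, map_natCast, timePolyToFn_C]
    · rw [map_zero, mul_zero]

/-- `V_p'(D) - x - n (D - w)⁻¹` is a multiplication by `-x` up to an operator with coefficients
independent of `x`. -/
theorem explicitLax_eq (p n : ℕ) (w : ℂ) (θ : Fin (p - 1) → TimePoly p) :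
    ∃ q : LaurentSeries (TimePoly p), Le (-1) q ∧ explicitLax p n w θ =
      ofLaurent p (ev (invVar _) (Polynomial.derivative (potential p θ)) - q) - PsiDO.mulX := by
  obtain ⟨q, hq1, hq2⟩ := exists_invSeries p n w
  refine ⟨q, hq1, ?_⟩
  rw [ofLaurent_sub, ofLaurent_ev, hq2, explicitLax, laxOp, PsiDO.mulX]
  abel

theorem le_mulX : Le 0 PsiDO.mulX := fun j hj => by
  rw [sc_psiDO, PsiDO.coeff_mulX, if_neg hj.ne']

theorem Le.adjoint {a : ℤ} {P : PsiDO} (h : Le a P) : Le a P.adjoint :=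
  PsiDO.OrdLE.adjoint (P := P) h

theorem Le.ofLaurent {a : ℤ} {v : LaurentSeries (TimePoly p)} (h : Le a v) :
    Le a (ofLaurent p v) := fun j hj => by
  rw [sc_psiDO, coeff_ofLaurent, h j hj, map_zero]

theorem Monic.ofLaurent {a : ℤ} {v : LaurentSeries (TimePoly p)} (h : Monic a v) :
    Monic a (ofLaurent p v) :=
  ⟨Le.ofLaurent h.le, by rw [sc_psiDO, coeff_ofLaurent, h.top, map_one]⟩

/-- Unlike in `hasSlope_pow_succ` only the orders are bounded and nothing need be monic: the adjoint
of an operator D + ⋯ has leading coefficient -1. -/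
theorem le_pow_sub {R B : Type*} [Ring R] [CommRing B] [SymbolRing R B] {a e : ℤ} {x y : R}
    (hx : Le a x) (hy : Le a y) (he : Le e (x - y)) (k : ℕ) :
    Le (k * a + e) (x ^ (k + 1) - y ^ (k + 1)) := by
  have hpow : ∀ k : ℕ, Le (k * a) (y ^ k) := by
    intro k
    induction k with
    | zero => simpa using (monic_one (R := R)).le
    | succ k ih =>
      rw [pow_succ]
      exact (ih.mul hy).mono (by push_cast; linarith)
  induction k with
  | zero => simpa using he
  | succ k ih =>
    have h1 : x ^ (k + 1 + 1) - y ^ (k + 1 + 1) =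
        x * (x ^ (k + 1) - y ^ (k + 1)) + (x - y) * y ^ (k + 1) := by
      rw [pow_succ' x (k + 1), pow_succ' y (k + 1)]; noncomm_ring
    rw [h1]
    exact ((hx.mul ih).mono (by push_cast; linarith)).add
      ((he.mul (hpow (k + 1))).mono (by push_cast; linarith))

/-- `L` is the `p`-th root of `V_p'(D) - x - n (D - w)⁻¹`. -/
structure IsLaxRoot (p n : ℕ) (w : ℂ) (θ : Fin (p - 1) → TimePoly p) (L : PsiDO) : Prop where
  monic : Monic 1 L
  pow_eq : L ^ p = explicitLax p n w θ

theorem pow_left_injective_psiDO (hp : p ≠ 0) {L L' : PsiDO} (h : Monic 1 L) (h' : Monic 1 L')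
    (heq : L ^ p = L' ^ p) : L = L' :=
  (hasSlope_pow (R := PsiDO) 1 hp).injOn (natCast_mul_inj_fn hp) h h' heq

theorem IsRoot.ofLaurent_pow_sub {n : ℕ} {w : ℂ} {θ : Fin (p - 1) → TimePoly p}
    {r : LaurentSeries (TimePoly p)} (hr : IsRoot p θ r) :
    Le 0 (ofLaurent p r ^ p - explicitLax p n w θ) := by
  obtain ⟨q, hq, h⟩ := explicitLax_eq p n w θ
  rw [← ofLaurent_pow, hr.pow_eq, h, ofLaurent_sub,
    show ∀ a b c : PsiDO, a - (a - b - c) = b + c from fun a b c => by abel]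
  exact (Le.ofLaurent (hq.mono (by omega))).add le_mulX

/-- The approximation starts at r(D) with r = (V_p')^{1/p}, whose p-th power V_p'(D) differs from
the target by an operator of order 0 only. -/
theorem exists_isLaxRoot (hp : 2 ≤ p) (n : ℕ) (w : ℂ) {θ : Fin (p - 1) → TimePoly p}
    {r : LaurentSeries (TimePoly p)} (hr : IsRoot p θ r) : ∃ L, IsLaxRoot p n w θ L := by
  obtain ⟨L, h1, h2⟩ := (hasSlope_pow (R := PsiDO) 1 (p := p) (by omega)).exists_eq
    (natCast_mul_inv_fn (by omega)) (Monic.ofLaurent hr.monic) (T := explicitLax p n w θ)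
    (hr.ofLaurent_pow_sub.mono (by omega))
  exact ⟨L, h1, h2⟩

section

variable {n : ℕ} {w : ℂ} {θ : Fin (p - 1) → TimePoly p} {r : LaurentSeries (TimePoly p)} {L : PsiDO}

/-- The p-th powers differ at order 0 = (p - 1) + (1 - p), and p - 1 is the shift of the p-th power
map. -/
theorem IsLaxRoot.sub_le (hp : 2 ≤ p) (hr : IsRoot p θ r) (hL : IsLaxRoot p n w θ L) :
    Le (1 - p : ℤ) (L - ofLaurent p r) := by
  rw [← neg_sub (ofLaurent p r)]
  refine Le.neg ((hasSlope_pow (R := PsiDO) 1 (p := p) (by omega)).le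
    (natCast_mul_inj_fn (by omega)) (Monic.ofLaurent hr.monic) hL.monic ?_)
  rw [hL.pow_eq]
  exact hr.ofLaurent_pow_sub.mono (by omega)

/-- The differential part of `L^i` is `Q_i(D)`. -/
theorem IsLaxRoot.coeff_pow (hp : 2 ≤ p) (hr : IsRoot p θ r) (hL : IsLaxRoot p n w θ L)
    (i : ℕ) (hi : i + 1 < p) (j : ℕ) :
    (L ^ (i + 1)).coeff j = timePolyToFn p ((flowPoly r (i + 1)).coeff j) := by
  -- The difference of the (i+1)-st powers has order at most i + (1 - p) < 0, so L and r(D) give the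
  -- same differential part.
  have h := le_pow_sub hL.monic.le (Monic.ofLaurent hr.monic).le (hL.sub_le hp hr) i j (by omega)
  rw [sc_psiDO, PsiDO.coeff_sub, sub_eq_zero, ← ofLaurent_pow, coeff_ofLaurent] at h
  rw [h, hr.coeff_flowPoly]

/-- The differential part of `(L^*)^i` is `Q_i(-D)`. -/
theorem IsLaxRoot.coeff_adjoint_pow (hp : 2 ≤ p) (hr : IsRoot p θ r) (hL : IsLaxRoot p n w θ L)
    (i : ℕ) (hi : i + 1 < p) (j : ℕ) : (L.adjoint ^ (i + 1)).coeff j =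
      (-1) ^ j * timePolyToFn p ((flowPoly r (i + 1)).coeff j) := by
  -- Adjunction preserves orders, so L^* is compared with r(-D) directly; multiplicativity of the
  -- adjoint is not needed.
  have h := le_pow_sub (R := PsiDO) (Le.adjoint hL.monic.le)
    (Le.adjoint (Monic.ofLaurent hr.monic).le) (e := 1 - p)
    (by rw [← PsiDO.adjoint_sub]; exact Le.adjoint (hL.sub_le hp hr)) i j (by omega)
  rw [sc_psiDO, PsiDO.coeff_sub, sub_eq_zero, adjoint_ofLaurent, ← ofLaurent_pow, ← flipVar_pow,
    coeff_ofLaurent, sc_flipVar, map_mul, map_intCast] at h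
  rw [h, hr.coeff_flowPoly]
  simp

theorem IsLaxRoot.plus_pow (hp : 2 ≤ p) (hr : IsRoot p θ r) (hL : IsLaxRoot p n w θ L)
    (i : ℕ) (hi : i + 1 < p) :
    (L ^ (i + 1)).plus = ofLaurent p (ev (invVar _) (flowPoly r (i + 1))) := by
  ext1; funext j
  rw [PsiDO.coeff_plus, coeff_ofLaurent, sc_ev_invVar]
  split_ifs with h
  · rw [← hL.coeff_pow hp hr i hi, Int.toNat_of_nonneg h]
  · rw [map_zero]

/-- Apart from x the operator is a series in D with coefficients free of x, so its commutator with
Q_i(D) reduces to [x, Q_i(D)] = -Q_i'(D), which is the time derivative of V_p'(D). -/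
theorem timeDeriv_explicitLax {P : TimePoly p} (hD : PotentialData p θ r P) (n : ℕ) (w : ℂ)
    (i : Fin (p - 1)) : (explicitLax p n w θ).timeDeriv (i + 1) =
      ofLaurent p (ev (invVar _) (flowPoly r (i + 1))) * explicitLax p n w θ -
        explicitLax p n w θ * ofLaurent p (ev (invVar _) (flowPoly r (i + 1))) := by
  have hrhs : ofLaurent p (ev (invVar _) (flowPoly r (i + 1))) * explicitLax p n w θ -
        explicitLax p n w θ * ofLaurent p (ev (invVar _) (flowPoly r (i + 1))) =
      PsiDO.mulX * ofLaurent p (ev (invVar _) (flowPoly r (i + 1))) -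
        ofLaurent p (ev (invVar _) (flowPoly r (i + 1))) * PsiDO.mulX := by
    obtain ⟨q, -, h⟩ := explicitLax_eq p n w θ
    rw [h, mul_sub, sub_mul, ofLaurent_comm]
    abel
  rw [hrhs]
  ext1; funext j
  rw [PsiDO.coeff_sub, PsiDO.coeff_mulX_mul, PsiDO.coeff_mul_mulX, PsiDO.coeff_timeDeriv,
    mul_comm (MvPowerSeries.X 0), sub_add_cancel_left, explicitLax, laxOp]
  simp only [PsiDO.coeff_sub, PsiDO.coeff_smul, pd_sub, PsiDO.coeff_ofPoly, coeff_ofLaurent,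
    sc_ev_invVar]
  have h1 : pd ((i : ℕ) + 1) (if 0 ≤ j then
      (Polynomial.C (MvPowerSeries.X 0 : Fn)).coeff j.toNat else 0) = 0 := by
    rw [Polynomial.coeff_C]
    split_ifs
    · exact PsiDO.pd_X_of_ne (by omega)
    · exact pd_zero _
    · exact pd_zero _
  have h2 : pd ((i : ℕ) + 1) ((n : Fn) * (PsiDO.invDSub w).coeff j) = 0 := by
    change pd _ ((n : Fn) * if j < 0 then MvPowerSeries.C (w ^ (-1 - j).toNat) else 0) = 0
    rw [← map_natCast (MvPowerSeries.C : ℂ →+* Fn)]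
    split_ifs
    · rw [← map_mul, pd_C]
    · rw [mul_zero, pd_zero]
  rw [h1, h2, sub_zero, sub_zero]
  rcases lt_trichotomy j (-1) with hj | rfl | hj
  · rw [if_neg (by omega), if_neg (by omega), pd_zero, map_zero, smul_zero, neg_zero]
  -- At order -1 the factor j + 1 kills the constant coefficient of Q_i.
  · simp [pd_zero]
  · rw [if_pos (by omega), if_pos (by omega), Polynomial.coeff_map, pd_timePolyToFn,
      hD.pderiv_potential, map_neg, Polynomial.coeff_derivative, map_mul, map_add, map_natCast,
      map_one, zsmul_eq_mul, mul_comm]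
    have h3 : (j + 1).toNat = j.toNat + 1 := by omega
    have h4 : ((j + 1 : ℤ) : Fn) = (j.toNat : Fn) + 1 := by
      rw [← Int.cast_natCast, Int.toNat_of_nonneg (by omega)]; push_cast; rfl
    rw [h3, h4]

/-- The equation is known for L^p and descends to L because ∂/∂t_i - [B, ·] is a derivation. -/
theorem IsLaxRoot.isLaxFlow (hp : 2 ≤ p) {P : TimePoly p} (hD : PotentialData p θ r P)
    (hL : IsLaxRoot p n w θ L) : IsLaxFlow {i | 1 ≤ i ∧ i < p} L where
  coeff_gt j hj := hL.monic.le j hj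
  coeff_one := hL.monic.top
  coeff_zero := by
    have h1 := hL.sub_le hp hD.isRoot 0 (by omega)
    rw [sc_psiDO, PsiDO.coeff_sub, sub_eq_zero, coeff_ofLaurent] at h1
    rw [h1]
    -- V_p' has no term of degree p - 1, so r^p - y^p has order at most p - 2 and r = y + O(y⁻¹).
    have h2 : Le (-1) (r - invVar _) := by
      refine (hasSlope_pow (R := LaurentSeries (TimePoly p)) 1 (p := p) (by omega)).le
        (natCast_mul_inj p hp) hD.isRoot.monic monic_invVar ?_
      rw [hD.isRoot.pow_eq]
      have h3 : ev (invVar _) (Polynomial.derivative (potential p θ)) - invVar (TimePoly p) ^ p =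
          ev (invVar _) (Polynomial.derivative (potential p θ) - Polynomial.X ^ p) := by
        rw [map_sub, map_pow, ev_X]
      rw [h3]
      refine le_ev monic_invVar _ _ fun k hk => ?_
      rw [Polynomial.coeff_sub, coeff_derivative_potential p hp, Polynomial.coeff_X_pow]
      split_ifs
      · exact sub_self _
      · omega
      · exact sub_self _
    have h3 := h2 0 (by omega)
    rw [map_sub, Pi.sub_apply, invVar, sc_single, if_neg (by omega), sub_zero] at h3
    rw [h3, map_zero]
  lax i hi := by
    obtain ⟨i, rfl⟩ := Nat.exists_eq_add_of_le' hi.1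
    rw [hL.plus_pow hp hD.isRoot i hi.2]
    set B := ofLaurent p (ev (invVar _) (flowPoly r (i + 1))) with hB
    have h := derivation_eq_zero_of_pow (fun X : PsiDO => X.timeDeriv (i + 1) - (B * X - X * B))
      (fun X Y => by rw [PsiDO.timeDeriv_mul]; noncomm_ring) hL.monic (p := p) (by omega)
      (natCast_mul_inj_fn (by omega)) (by
        rw [hL.pow_eq, timeDeriv_explicitLax hD n w ⟨i, by have := hi.2; omega⟩, ← hB, sub_self])
    exact sub_eq_zero.mp h

theorem restrict_laxOp {S : Set ℕ} (hS : 0 ∉ S) (Q : Fn[X]) (n : ℕ) (w : ℂ) :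
    (laxOp Q n w).restrict S = laxOp (Q.map (zeroHom S)) n w := by
  classical
  have h0 : setZero S 0 = 0 := by rw [← zeroHom_apply, map_zero]
  rw [laxOp, laxOp, PsiDO.restrict_sub, PsiDO.restrict_sub]
  congr 2
  · ext1; funext j
    rw [PsiDO.coeff_restrict, PsiDO.coeff_ofPoly, PsiDO.coeff_ofPoly, Polynomial.coeff_map,
      zeroHom_apply]
    split_ifs
    · rfl
    · exact h0
  · ext1; funext j
    have := PsiDO.coeff_mulX j
    rw [PsiDO.mulX] at this
    rw [PsiDO.coeff_restrict, this]
    split_ifs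
    · rw [setZero_X, if_neg hS]
    · exact h0
  · ext1; funext j
    rw [PsiDO.coeff_restrict, PsiDO.coeff_smul]
    change setZero _ ((n : Fn) * if j < 0 then MvPowerSeries.C (w ^ (-1 - j).toNat) else 0) =
      (n : Fn) * if j < 0 then MvPowerSeries.C (w ^ (-1 - j).toNat) else 0
    rw [← map_natCast (MvPowerSeries.C : ℂ →+* Fn)]
    split_ifs
    · rw [← map_mul, setZero_C]
    · rw [mul_zero, h0]

theorem explicitLax_restrict (hp : 2 ≤ p) {P : TimePoly p} (hD : PotentialData p θ r P) :
    (explicitLax p n w θ).restrict {i | 1 ≤ i} = laxOp (Polynomial.X ^ p) n w := by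
  rw [explicitLax, restrict_laxOp (by simp)]
  congr 1
  ext1 k
  rw [Polynomial.coeff_map, Polynomial.coeff_map, zeroHom_apply, setZero_timePolyToFn_of_one_le,
    coeff_derivative_potential p hp, Polynomial.coeff_X_pow]
  split_ifs
  · rw [map_one, map_one]
  · rw [hD.constantCoeff_theta, map_zero]
  · rw [map_zero, map_zero]

theorem explicitLax_restrict_of_le (hp : 2 ≤ p) (n : ℕ) (w : ℂ) (θ : Fin (p - 1) → TimePoly p) :
    (explicitLax p n w θ).restrict {i | p ≤ i} = explicitLax p n w θ := by
  rw [explicitLax, restrict_laxOp (by simp; omega)]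
  congr 1
  ext1 k
  rw [Polynomial.coeff_map, Polynomial.coeff_map, zeroHom_apply, setZero_timePolyToFn]

/-- `L` for the sign `ε = 1`, and `L^*` for `ε = -1`. -/
def signed (ε : ℤ) (L : PsiDO) : PsiDO := if ε = 1 then L else L.adjoint

theorem IsLaxRoot.plusApply_signed_pow (hp : 2 ≤ p) (hr : IsRoot p θ r) (hL : IsLaxRoot p n w θ L)
    {ε : ℤ} (hε : ε = 1 ∨ ε = -1) (i : ℕ) (hi : i + 1 < p) (f : Fn) :
    (signed ε L ^ (i + 1)).plusApply f = ∑ k ∈ Finset.range (i + 1 + 1),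
      (ε : Fn) ^ k * timePolyToFn p ((flowPoly r (i + 1)).coeff k) * dx k f := by
  have hc : ∀ j : ℕ, (signed ε L ^ (i + 1)).coeff j =
      (ε : Fn) ^ j * timePolyToFn p ((flowPoly r (i + 1)).coeff j) := by
    intro j
    rcases hε with rfl | rfl
    · rw [signed, if_pos rfl, hL.coeff_pow hp hr i hi, Int.cast_one, one_pow, one_mul]
    · rw [signed, if_neg (by decide), hL.coeff_adjoint_pow hp hr i hi, Int.cast_neg, Int.cast_one]
  rw [PsiDO.plusApply_eq_sum (N := i + 1)]
  · exact Finset.sum_congr rfl fun k _ => by rw [hc]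
  · intro j hj
    rw [hc, hr.coeff_flowPoly, (hr.monic.pow (i + 1)).le j (by push_cast; omega), map_zero, mul_zero]

/-- The term (D - w)⁻¹ has negative orders only and drops out, also after the adjoint, which
replaces D by -D and fixes x. -/
theorem plusApply_signed_explicitLax (hp : 2 ≤ p) (n : ℕ) (w : ℂ) (θ : Fin (p - 1) → TimePoly p)
    {ε : ℤ} (hε : ε = 1 ∨ ε = -1) (f : Fn) :
    (signed ε (explicitLax p n w θ)).plusApply f = ∑ k ∈ Finset.range (p + 1),
      (ε : Fn) ^ k * timePolyToFn p ((Polynomial.derivative (potential p θ)).coeff k) * dx k f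
        - MvPowerSeries.X 0 * f := by
  obtain ⟨q, hq, h⟩ := explicitLax_eq p n w θ
  have hc : ∀ j : ℕ, (signed ε (explicitLax p n w θ)).coeff j = (ε : Fn) ^ j *
      timePolyToFn p ((Polynomial.derivative (potential p θ)).coeff j) -
        if j = 0 then MvPowerSeries.X 0 else 0 := by
    intro j
    have hs : sc (ev (invVar _) (Polynomial.derivative (potential p θ)) - q) j =
        (Polynomial.derivative (potential p θ)).coeff j := by
      rw [map_sub, Pi.sub_apply, hq _ (by omega), sub_zero, sc_ev_invVar, if_pos (by omega),
        Int.toNat_natCast]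
    rcases hε with rfl | rfl
    · rw [signed, if_pos rfl, h, PsiDO.coeff_sub, coeff_ofLaurent, hs, PsiDO.coeff_mulX]
      simp
    · rw [signed, if_neg (by decide), h, PsiDO.adjoint_sub, PsiDO.adjoint_mulX, adjoint_ofLaurent,
        PsiDO.coeff_sub, coeff_ofLaurent, sc_flipVar, hs, PsiDO.coeff_mulX]
      simp
  rw [PsiDO.plusApply_eq_sum (N := p)]
  · simp only [hc, sub_mul, Finset.sum_sub_distrib, ite_mul, zero_mul]
    rw [Finset.sum_ite_eq', if_pos (by simp), dx_zero_apply]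
  · intro j hj
    rw [hc, coeff_derivative_potential p hp, if_neg (by omega), dif_neg (by omega), if_neg (by omega),
      map_zero, mul_zero, sub_zero]

end

end

/-! ### Formal solutions of the wave equations from functionals on polynomials. -/

section

/-! ### Formal exponentials with coefficients polynomial in `y` -/

/-- Formal functions of `x, t₁, t₂, …` with coefficients polynomial in `y`. -/
abbrev FnY : Type := MvPowerSeries ℕ ℂ[X]

/-- The partial sums of the exponential series. -/
def expSum (E : FnY) (K : ℕ) : FnY := ∑ k ∈ Finset.range K, ((k.factorial : ℂ)⁻¹) • E ^ k

/-- The exponential of a series without constant term. -/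
def formalExp (E : FnY) : FnY := fun m => MvPowerSeries.coeff m (expSum E (m.degree + 1))

theorem coeff_formalExp_def (E : FnY) (m : ℕ →₀ ℕ) :
    MvPowerSeries.coeff m (formalExp E) = MvPowerSeries.coeff m (expSum E (m.degree + 1)) := rfl

theorem coeff_smul_fnY (c : ℂ) (f : FnY) (m : ℕ →₀ ℕ) :
    MvPowerSeries.coeff m (c • f) = c • MvPowerSeries.coeff m f := rfl

/-- Without constant term, E^k contributes only to monomials of degree at least k; any longer
partial sum has the same coefficient. -/
theorem coeff_formalExp {E : FnY} (hE : MvPowerSeries.constantCoeff E = 0) {m : ℕ →₀ ℕ} {K : ℕ}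
    (hK : m.degree < K) :
    MvPowerSeries.coeff m (formalExp E) = MvPowerSeries.coeff m (expSum E K) := by
  rw [coeff_formalExp_def, expSum, expSum, map_sum, map_sum]
  refine Finset.sum_subset (Finset.range_mono hK) fun k _ hk => ?_
  rw [coeff_smul_fnY, MvPowerSeries.coeff_eq_zero_of_constantCoeff_nilpotent (m := 1) (by simpa using hE),
    smul_zero]
  rw [Finset.mem_range] at hk
  omega

theorem derivation_expSum (δ : Derivation ℂ FnY FnY) (E : FnY) (K : ℕ) :
    δ (expSum E (K + 1)) = δ E * expSum E K := by
  rw [expSum, expSum, Finset.sum_range_succ', map_add, map_sum, Finset.mul_sum]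
  have h0 : δ (((Nat.factorial 0 : ℂ)⁻¹) • E ^ 0) = 0 := by
    rw [pow_zero, Derivation.map_smul, Derivation.map_one_eq_zero, smul_zero]
  rw [h0, add_zero]
  refine Finset.sum_congr rfl fun k _ => ?_
  rw [Derivation.map_smul, Derivation.leibniz_pow, Nat.add_sub_cancel, ← Nat.cast_smul_eq_nsmul ℂ, smul_smul,
    smul_eq_mul, mul_smul_comm, mul_comm (δ E)]
  congr 1
  rw [Nat.factorial_succ]
  push_cast
  field_simp

/-- `δ e^E = δ E e^E` for derivations `δ` which lower the degree by at most one. -/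
theorem derivation_formalExp (δ : Derivation ℂ FnY FnY)
    (hδ : ∀ (m : ℕ →₀ ℕ) (f g : FnY), (∀ m' : ℕ →₀ ℕ, m'.degree ≤ m.degree + 1 →
      MvPowerSeries.coeff m' f = MvPowerSeries.coeff m' g) →
      MvPowerSeries.coeff m (δ f) = MvPowerSeries.coeff m (δ g))
    {E : FnY} (hE : MvPowerSeries.constantCoeff E = 0) : δ (formalExp E) = δ E * formalExp E := by
  classical
  ext1 m
  -- One term more than the degree requires, since the derivation may involve coefficients of degree
  -- one higher.
  rw [hδ m (formalExp E) (expSum E (m.degree + 1 + 1))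
    (fun m' hm' => coeff_formalExp hE (by omega)), derivation_expSum, MvPowerSeries.coeff_mul,
    MvPowerSeries.coeff_mul]
  refine Finset.sum_congr rfl fun q hq => ?_
  rw [Finset.HasAntidiagonal.mem_antidiagonal] at hq
  rw [coeff_formalExp hE (K := m.degree + 1)]
  rw [← hq, map_add]
  omega

/-- The partial derivatives of series with coefficients polynomial in `y`. -/
def pdY (i : ℕ) : Derivation ℂ FnY FnY := (MvPowerSeries.pderiv ℂ[X] i).restrictScalars ℂ

theorem coeff_pdY (i : ℕ) (f : FnY) (m : ℕ →₀ ℕ) : MvPowerSeries.coeff m (pdY i f) =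
    MvPowerSeries.coeff (m + Finsupp.single i 1) f * (m i + 1) := MvPowerSeries.coeff_pderiv ..

theorem pdY_formalExp (i : ℕ) {E : FnY} (hE : MvPowerSeries.constantCoeff E = 0) :
    pdY i (formalExp E) = pdY i E * formalExp E := by
  refine derivation_formalExp _ (fun m f g h => ?_) hE
  rw [coeff_pdY, coeff_pdY, h]
  rw [map_add, Finsupp.degree_single]

/-- The `y`-derivative. -/
def derivY : Derivation ℂ FnY FnY :=
  Derivation.mk'
    { toFun := fun f m => Polynomial.derivative (MvPowerSeries.coeff m f)
      map_add' := fun f g => by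
        ext1 m
        exact map_add Polynomial.derivative _ _
      map_smul' := fun c f => by
        ext1 m
        exact Polynomial.derivative_smul c _ } <| by
    classical
    intro f g
    ext1 m
    change Polynomial.derivative (MvPowerSeries.coeff m (f * g)) = _
    rw [smul_eq_mul, smul_eq_mul, mul_comm g, map_add, MvPowerSeries.coeff_mul,
      MvPowerSeries.coeff_mul, MvPowerSeries.coeff_mul, Polynomial.derivative_sum,
      ← Finset.sum_add_distrib]
    refine Finset.sum_congr rfl fun q _ => ?_
    rw [Polynomial.derivative_mul, add_comm]
    rfl

theorem coeff_derivY (f : FnY) (m : ℕ →₀ ℕ) : MvPowerSeries.coeff m (derivY f) =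
    Polynomial.derivative (MvPowerSeries.coeff m f) := rfl

theorem derivY_formalExp {E : FnY} (hE : MvPowerSeries.constantCoeff E = 0) :
    derivY (formalExp E) = derivY E * formalExp E := by
  refine derivation_formalExp _ (fun m f g h => ?_) hE
  rw [coeff_derivY, coeff_derivY, h m (by omega)]

/-! ### Linear functionals on polynomials, applied to the coefficients -/

/-- A linear functional on polynomials in `y`, applied to the coefficients of a series. -/
def liftFun (Λ : ℂ[X] →ₗ[ℂ] ℂ) : FnY →+ Fn where
  toFun f := fun m => Λ (MvPowerSeries.coeff m f)
  map_zero' := by ext m; exact map_zero Λ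
  map_add' f g := by ext m; exact map_add Λ _ _

theorem coeff_liftFun (Λ : ℂ[X] →ₗ[ℂ] ℂ) (f : FnY) (m : ℕ →₀ ℕ) :
    MvPowerSeries.coeff m (liftFun Λ f) = Λ (MvPowerSeries.coeff m f) := rfl

/-- Series with constant coefficients as series with coefficients polynomial in `y`. -/
def constY : Fn →+* FnY := MvPowerSeries.map Polynomial.C

theorem liftFun_constY_mul (Λ : ℂ[X] →ₗ[ℂ] ℂ) (g : Fn) (f : FnY) :
    liftFun Λ (constY g * f) = g * liftFun Λ f := by
  classical
  ext m
  rw [coeff_liftFun, MvPowerSeries.coeff_mul, MvPowerSeries.coeff_mul, map_sum]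
  refine Finset.sum_congr rfl fun q _ => ?_
  rw [constY, MvPowerSeries.coeff_map, ← Polynomial.smul_eq_C_mul, map_smul, smul_eq_mul,
    coeff_liftFun]

theorem pd_liftFun (Λ : ℂ[X] →ₗ[ℂ] ℂ) (i : ℕ) (f : FnY) :
    pd i (liftFun Λ f) = liftFun Λ (pdY i f) := by
  ext m
  rw [coeff_pd, coeff_liftFun, coeff_liftFun, coeff_pdY]
  have h : ((m i : ℂ[X]) + 1) = Polynomial.C ((m i : ℂ) + 1) := by simp
  rw [h, mul_comm, mul_comm _ (Polynomial.C _), ← Polynomial.smul_eq_C_mul, map_smul, smul_eq_mul]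

/-! ### The exponent -/

variable {p : ℕ}

/-- Polynomials in the times as polynomials with coefficients polynomial in `y`. -/
def timePolyY (p : ℕ) : TimePoly p →+* MvPolynomial ℕ ℂ[X] :=
  (MvPolynomial.map Polynomial.C).comp
    (MvPolynomial.rename fun i : Fin (p - 1) => (i : ℕ) + 1).toRingHom

/-- `ε (P(t) + x y - ∑ θ_i(t) y^{i+1}/(i+1))` -/
def exponent (p : ℕ) (ε : ℤ) (θ : Fin (p - 1) → TimePoly p) (P : TimePoly p) :
    MvPolynomial ℕ ℂ[X] :=
  (ε : MvPolynomial ℕ ℂ[X]) * (timePolyY p P + MvPolynomial.X 0 * MvPolynomial.C Polynomial.X -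
    ∑ i : Fin (p - 1), timePolyY p (θ i) * MvPolynomial.C
      (Polynomial.C (1 / ((i : ℂ) + 1)) * Polynomial.X ^ ((i : ℕ) + 1)))

theorem coe_timePolyY (f : TimePoly p) :
    (timePolyY p f : FnY) = constY (timePolyToFn p f) := by
  ext1 m
  rw [constY, MvPowerSeries.coeff_map, timePolyToFn_apply, MvPolynomial.coeff_coe,
    MvPolynomial.coeff_coe, timePolyY, RingHom.comp_apply, MvPolynomial.coeff_map]
  rfl

theorem constY_X (i : ℕ) : constY (MvPowerSeries.X i) = MvPowerSeries.X i := by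
  rw [constY, MvPowerSeries.map_X]

theorem coe_exponent (ε : ℤ) (θ : Fin (p - 1) → TimePoly p) (P : TimePoly p) :
    (exponent p ε θ P : FnY) = (ε : FnY) * (constY (timePolyToFn p P) +
      constY (MvPowerSeries.X 0) * MvPowerSeries.C Polynomial.X -
        ∑ i : Fin (p - 1), constY (timePolyToFn p (θ i)) * MvPowerSeries.C
          (Polynomial.C (1 / ((i : ℂ) + 1)) * Polynomial.X ^ ((i : ℕ) + 1))) := by
  change MvPolynomial.coeToMvPowerSeries.ringHom (exponent p ε θ P) = _
  rw [exponent, map_mul, map_sub, map_add, map_sum, map_mul, map_intCast]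
  simp only [map_mul _ (timePolyY p _), MvPolynomial.coeToMvPowerSeries.ringHom_apply,
    MvPolynomial.coe_C, MvPolynomial.coe_X, coe_timePolyY, constY_X]

/-- The normalizations θ_i(0) = 0 and P(0) = 0 are what makes the formal exponential meaningful. -/
theorem constantCoeff_exponent (ε : ℤ) {θ : Fin (p - 1) → TimePoly p} {P : TimePoly p}
    (hθ : ∀ i, MvPolynomial.constantCoeff (θ i) = 0) (hP : MvPolynomial.constantCoeff P = 0) :
    MvPowerSeries.constantCoeff (exponent p ε θ P : FnY) = 0 := by
  have h : ∀ f : TimePoly p, MvPowerSeries.constantCoeff (constY (timePolyToFn p f)) =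
      Polynomial.C (MvPolynomial.constantCoeff f) := by
    intro f
    have h1 := congrArg (MvPowerSeries.coeff 0) (setZero_timePolyToFn_of_one_le p f)
    classical
    rw [coeff_setZero, if_pos (by simp), MvPowerSeries.coeff_zero_C] at h1
    rw [constY, MvPowerSeries.constantCoeff_map, ← MvPowerSeries.coeff_zero_eq_constantCoeff_apply,
      h1]
  rw [coe_exponent, map_mul, map_sub, map_add, map_sum, map_mul, h, hP, constY_X,
    MvPowerSeries.constantCoeff_X]
  simp [h, hθ]

theorem pdY_constY (i : ℕ) (f : Fn) : pdY i (constY f) = constY (pd i f) := by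
  ext1 m
  rw [coeff_pdY, constY, MvPowerSeries.coeff_map, MvPowerSeries.coeff_map, coeff_pd]
  simp

theorem pdY_C (i : ℕ) (q : ℂ[X]) : pdY i (MvPowerSeries.C q) = 0 := MvPowerSeries.pderiv_C

theorem derivY_constY (f : Fn) : derivY (constY f) = 0 := by
  ext1 m
  rw [coeff_derivY, constY, MvPowerSeries.coeff_map, Polynomial.derivative_C]
  rfl

theorem derivY_C (q : ℂ[X]) :
    derivY (MvPowerSeries.C q) = MvPowerSeries.C (Polynomial.derivative q) := by
  classical
  ext1 m
  rw [coeff_derivY, MvPowerSeries.coeff_C, MvPowerSeries.coeff_C]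
  split_ifs <;> simp

theorem derivation_intCast_mul (δ : Derivation ℂ FnY FnY) (ε : ℤ) (f : FnY) :
    δ ((ε : FnY) * f) = (ε : FnY) * δ f := by
  rw [← zsmul_eq_mul, map_zsmul, zsmul_eq_mul]

theorem pdY_zero_exponent (ε : ℤ) (θ : Fin (p - 1) → TimePoly p) (P : TimePoly p) :
    pdY 0 (exponent p ε θ P : FnY) = (ε : FnY) * MvPowerSeries.C Polynomial.X := by
  rw [coe_exponent, derivation_intCast_mul, map_sub, map_add, map_sum]
  simp only [Derivation.leibniz, pdY_constY, pdY_C, pd_zero_timePolyToFn, PsiDO.pd_X_self, map_zero,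
    map_one, smul_eq_mul]
  simp

variable {θ : Fin (p - 1) → TimePoly p} {r : LaurentSeries (TimePoly p)} {P : TimePoly p}

/-- ∂P/∂t gives the constant term of Q(y), and ∂θ_k/∂t = -(k+1)·(coefficient of y^{k+1} in Q) gives
the others, the factor k + 1 cancelling the denominator in V_p. -/
theorem pdY_exponent (hp : 2 ≤ p) (hD : PotentialData p θ r P) (ε : ℤ) (i : Fin (p - 1)) :
    pdY (i + 1) (exponent p ε θ P : FnY) = (ε : FnY) * ∑ k ∈ Finset.range ((i : ℕ) + 1 + 1),
      constY (timePolyToFn p ((flowPoly r (i + 1)).coeff k)) *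
        MvPowerSeries.C (Polynomial.X ^ k) := by
  have hi := i.2
  have hθ : ∀ k : Fin (p - 1), MvPolynomial.pderiv i (θ k) =
      -((flowPoly r (i + 1)).coeff (k + 1) * ((k : ℕ) + 1)) := by
    intro k
    have := hD.pderiv_potential i k
    rwa [coeff_derivative_potential p hp, if_neg (by omega), dif_pos k.2,
      Polynomial.coeff_derivative] at this
  have hzero : ∀ k, (i : ℕ) + 1 < k → (flowPoly r (i + 1)).coeff k = 0 := by
    intro k hk
    rw [hD.isRoot.coeff_flowPoly]
    exact (hD.isRoot.monic.pow (i + 1)).le k (by push_cast; omega)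
  rw [coe_exponent, derivation_intCast_mul, map_sub, map_add, map_sum]
  simp only [Derivation.leibniz, pdY_constY, pdY_C, pd_timePolyToFn, map_zero,
    PsiDO.pd_X_of_ne (Nat.succ_ne_zero i).symm, mul_zero, smul_eq_mul, add_zero, zero_add,
    hD.pderiv_prefactor, hθ]
  refine congrArg (fun f => (ε : FnY) * f) ?_
  have hsub : ∑ k ∈ Finset.range ((i : ℕ) + 1 + 1),
      constY (timePolyToFn p ((flowPoly r (i + 1)).coeff k)) *
        MvPowerSeries.C (Polynomial.X ^ k) = ∑ k ∈ Finset.range ((p - 1) + 1),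
      constY (timePolyToFn p ((flowPoly r (i + 1)).coeff k)) *
        MvPowerSeries.C (Polynomial.X ^ k) := by
    refine Finset.sum_subset (Finset.range_mono (by omega)) fun k _ hk => ?_
    rw [Finset.mem_range] at hk
    rw [hzero k (by omega), map_zero, map_zero, zero_mul]
  have hterm : ∀ k : Fin (p - 1),
      MvPowerSeries.C (Polynomial.C (1 / ((k : ℂ) + 1)) * Polynomial.X ^ ((k : ℕ) + 1)) *
        constY (timePolyToFn p (-((flowPoly r (i + 1)).coeff (k + 1) * ((k : ℕ) + 1)))) =
      -(constY (timePolyToFn p ((flowPoly r (i + 1)).coeff (k + 1))) *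
        MvPowerSeries.C (Polynomial.X ^ ((k : ℕ) + 1))) := by
    intro k
    have h1 : MvPowerSeries.C (σ := ℕ) (Polynomial.C (1 / ((k : ℂ) + 1))) *
        constY (timePolyToFn p (((k : ℕ) : TimePoly p) + 1)) = 1 := by
      have h2 : constY (timePolyToFn p (((k : ℕ) : TimePoly p) + 1)) =
          MvPowerSeries.C (Polynomial.C ((k : ℂ) + 1)) := by simp
      rw [h2, ← map_mul, ← map_mul, one_div_mul_cancel (Nat.cast_add_one_ne_zero _), map_one,
        map_one]
    rw [map_neg, map_mul, map_neg, map_mul, map_mul constY]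
    linear_combination -(MvPowerSeries.C (Polynomial.X ^ ((k : ℕ) + 1)) *
      constY (timePolyToFn p ((flowPoly r (i + 1)).coeff (k + 1)))) * h1
  rw [hsub, Finset.sum_range_succ', Finset.sum_range, pow_zero, map_one, mul_one,
    Finset.sum_congr rfl fun k _ => hterm k, Finset.sum_neg_distrib, sub_neg_eq_add]
  exact add_comm _ _

theorem derivY_exponent (ε : ℤ) (θ : Fin (p - 1) → TimePoly p) (P : TimePoly p) :
    derivY (exponent p ε θ P : FnY) = (ε : FnY) * (constY (MvPowerSeries.X 0) -
      ∑ i : Fin (p - 1), constY (timePolyToFn p (θ i)) * MvPowerSeries.C (Polynomial.X ^ (i : ℕ))) := by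
  rw [coe_exponent, derivation_intCast_mul, map_sub, map_add, map_sum]
  simp only [Derivation.leibniz, derivY_constY, derivY_C, mul_zero, smul_eq_mul, add_zero, zero_add,
    Polynomial.derivative_X, map_one, mul_one]
  refine congrArg (fun f => (ε : FnY) * (constY (MvPowerSeries.X 0) - f))
    (Finset.sum_congr rfl fun i _ => ?_)
  rw [Polynomial.derivative_C_mul_X_pow, Nat.add_sub_cancel, Nat.cast_succ,
    one_div_mul_cancel (Nat.cast_add_one_ne_zero _), map_one, one_mul]

/-! ### The formal wave function -/

/-- The series obtained by applying a functional to the exponential. -/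
def formalWave (p : ℕ) (ε : ℤ) (θ : Fin (p - 1) → TimePoly p) (P : TimePoly p)
    (Λ : ℂ[X] →ₗ[ℂ] ℂ) : Fn := liftFun Λ (formalExp (exponent p ε θ P))

/-- The moments `∫ y^k e^E`. -/
def moment (p : ℕ) (ε : ℤ) (θ : Fin (p - 1) → TimePoly p) (P : TimePoly p)
    (Λ : ℂ[X] →ₗ[ℂ] ℂ) (k : ℕ) : Fn :=
  liftFun Λ (MvPowerSeries.C (Polynomial.X ^ k) * formalExp (exponent p ε θ P))

theorem moment_zero (ε : ℤ) (Λ : ℂ[X] →ₗ[ℂ] ℂ) : moment p ε θ P Λ 0 = formalWave p ε θ P Λ := by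
  rw [moment, formalWave, pow_zero, map_one, one_mul]

theorem liftFun_intCast_mul (Λ : ℂ[X] →ₗ[ℂ] ℂ) (ε : ℤ) (f : FnY) :
    liftFun Λ ((ε : FnY) * f) = (ε : Fn) * liftFun Λ f := by
  rw [← zsmul_eq_mul, map_zsmul, zsmul_eq_mul]

theorem pd_moment (hD : PotentialData p θ r P) (ε : ℤ) (Λ : ℂ[X] →ₗ[ℂ] ℂ) (k : ℕ) :
    pd 0 (moment p ε θ P Λ k) = (ε : Fn) * moment p ε θ P Λ (k + 1) := by
  have hE := constantCoeff_exponent ε hD.constantCoeff_theta hD.constantCoeff_prefactor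
  rw [moment, pd_liftFun, Derivation.leibniz, pdY_C, smul_zero, add_zero, pdY_formalExp 0 hE,
    pdY_zero_exponent, smul_eq_mul, moment, ← liftFun_intCast_mul, pow_succ,
    map_mul (MvPowerSeries.C (σ := ℕ) (R := ℂ[X]))]
  refine congrArg (liftFun Λ) ?_
  ring

/-- Each x-derivative brings down εy, so εD acts on the wave function as multiplication by y under
the functional. -/
theorem dx_formalWave (hD : PotentialData p θ r P) (ε : ℤ) (Λ : ℂ[X] →ₗ[ℂ] ℂ) (k : ℕ) :
    dx k (formalWave p ε θ P Λ) = (ε : Fn) ^ k * moment p ε θ P Λ k := by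
  induction k with
  | zero => rw [dx_zero_apply, pow_zero, one_mul, moment_zero]
  | succ k ih =>
    rw [dx_succ, ih, ← Int.cast_pow, ← zsmul_eq_mul, pd_zsmul, pd_moment hD, zsmul_eq_mul,
      Int.cast_pow, pow_succ]
    ring

/-- The time derivative brings down εQ_i(y), and Q_i(y) under the functional is Q_i(εD) outside it,
that is, the differential part of the i-th power of L or L^*. The functional is arbitrary. -/
theorem formalWave_isWaveFlow {n : ℕ} {w : ℂ} {L : PsiDO} (hp : 2 ≤ p) (hD : PotentialData p θ r P)
    (hL : IsLaxRoot p n w θ L) {ε : ℤ} (hε : ε = 1 ∨ ε = -1) (Λ : ℂ[X] →ₗ[ℂ] ℂ) :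
    IsWaveFlow {i | 1 ≤ i ∧ i < p} ε (signed ε L) (formalWave p ε θ P Λ) := by
  rintro i ⟨hi1, hi2⟩
  obtain ⟨i, rfl⟩ := Nat.exists_eq_add_of_le' hi1
  have hE := constantCoeff_exponent ε hD.constantCoeff_theta hD.constantCoeff_prefactor
  have hε2 : (ε : Fn) * ε = 1 := by rcases hε with rfl | rfl <;> simp
  have h := pdY_exponent hp hD ε ⟨i, by omega⟩
  simp only at h
  rw [hL.plusApply_signed_pow hp hD.isRoot hε i hi2, formalWave, pd_liftFun, pdY_formalExp _ hE, h,
    mul_assoc, liftFun_intCast_mul, zsmul_eq_mul, Finset.sum_mul, map_sum]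
  congr 1
  refine Finset.sum_congr rfl fun k _ => ?_
  rw [mul_assoc, liftFun_constY_mul, ← formalWave, dx_formalWave hD, ← moment]
  have : (ε : Fn) ^ k * ε ^ k = 1 := by rw [← mul_pow, hε2, one_pow]
  linear_combination (-(timePolyToFn p ((flowPoly r (i + 1)).coeff k)) * moment p ε θ P Λ k) * this

/-- The functional Λ' stands for Λ with the weight divided by y - w, so that its wave function is G;
the second relation is integration by parts. -/
theorem formalWave_isEigenfunction (hp : 2 ≤ p) (hD : PotentialData p θ r P) (n : ℕ) (w μ : ℂ)
    {ε : ℤ} (hε : ε = 1 ∨ ε = -1) (Λ Λ' : ℂ[X] →ₗ[ℂ] ℂ)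
    (h1 : ∀ q, Λ' ((Polynomial.X - Polynomial.C w) * q) = Λ q)
    (h2 : ∀ q, Λ (Polynomial.derivative q) =
      ε * Λ ((Polynomial.X ^ p - Polynomial.C μ) * q) - ε * n * Λ' q) :
    IsEigenfunction n w ε (signed ε (explicitLax p n w θ)) μ (formalWave p ε θ P Λ) := by
  have hE := constantCoeff_exponent ε hD.constantCoeff_theta hD.constantCoeff_prefactor
  have hε2 : (ε : Fn) * ε = 1 := by rcases hε with rfl | rfl <;> simp
  have hsmul : ∀ (c : ℂ) (f : Fn), c • f = MvPowerSeries.C c * f :=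
    fun c f => MvPowerSeries.smul_eq_C_mul f c
  refine ⟨formalWave p ε θ P Λ', ?_, ?_⟩
  · rw [← moment_zero, pd_moment hD, zsmul_eq_mul, ← mul_assoc, hε2, one_mul]
    ext m
    rw [map_sub, hsmul, MvPowerSeries.coeff_C_mul, moment, moment, formalWave, coeff_liftFun,
      coeff_liftFun, coeff_liftFun, MvPowerSeries.coeff_C_mul, MvPowerSeries.coeff_C_mul, ← h1,
      sub_mul, map_sub, ← Polynomial.smul_eq_C_mul, map_smul, smul_eq_mul, pow_zero, one_mul,
      zero_add, pow_one]
  -- The functional is applied to ∂e^E/∂y in two ways: by parts, and then by the chain rule.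
  -- Equating them gives the eigenvalue equation.
  · have h3 : liftFun Λ (derivY (formalExp (exponent p ε θ P))) = (ε : Fn) * (moment p ε θ P Λ p -
        MvPowerSeries.C μ * formalWave p ε θ P Λ) - (ε : Fn) * (n : Fn) * formalWave p ε θ P Λ' := by
      ext m
      have hcast : ∀ (a : ℤ) (f : Fn), MvPowerSeries.coeff m ((a : Fn) * f) =
          a * MvPowerSeries.coeff m f := fun a f => by
        rw [← zsmul_eq_mul, map_zsmul, zsmul_eq_mul]
      rw [coeff_liftFun, coeff_derivY, h2, map_sub, mul_assoc (ε : Fn), hcast, hcast,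
        ← Int.cast_natCast (R := Fn), hcast, map_sub, MvPowerSeries.coeff_C_mul, moment, formalWave,
        coeff_liftFun, coeff_liftFun, MvPowerSeries.coeff_C_mul, formalWave, coeff_liftFun, sub_mul,
        map_sub, ← Polynomial.smul_eq_C_mul, map_smul, smul_eq_mul, Int.cast_natCast, mul_assoc]
    have h4 : liftFun Λ (derivY (formalExp (exponent p ε θ P))) =
        (ε : Fn) * (MvPowerSeries.X 0 * formalWave p ε θ P Λ -
          ∑ i : Fin (p - 1), timePolyToFn p (θ i) * moment p ε θ P Λ i) := by
      rw [derivY_formalExp hE, derivY_exponent, mul_assoc, liftFun_intCast_mul, sub_mul, map_sub,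
        liftFun_constY_mul, Finset.sum_mul, map_sum]
      congr 2
      refine Finset.sum_congr rfl fun i _ => ?_
      rw [mul_assoc, liftFun_constY_mul, moment]
    rw [plusApply_signed_explicitLax hp n w θ hε]
    have h5 : ∑ k ∈ Finset.range (p + 1), (ε : Fn) ^ k *
        timePolyToFn p ((Polynomial.derivative (potential p θ)).coeff k) *
          dx k (formalWave p ε θ P Λ) = moment p ε θ P Λ p +
        ∑ i : Fin (p - 1), timePolyToFn p (θ i) * moment p ε θ P Λ i := by
      have h6 : ∀ k, (ε : Fn) ^ k *
          timePolyToFn p ((Polynomial.derivative (potential p θ)).coeff k) *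
          dx k (formalWave p ε θ P Λ) = timePolyToFn p
            ((Polynomial.derivative (potential p θ)).coeff k) * moment p ε θ P Λ k := by
        intro k
        have : (ε : Fn) ^ k * ε ^ k = 1 := by rw [← mul_pow, hε2, one_pow]
        rw [dx_formalWave hD]
        linear_combination (timePolyToFn p ((Polynomial.derivative (potential p θ)).coeff k) *
          moment p ε θ P Λ k) * this
      simp only [h6]
      rw [Finset.sum_range_succ, coeff_derivative_potential p hp, if_pos rfl, map_one, one_mul,
        add_comm]
      congr 1
      have hp1 : p = p - 1 + 1 := by omega
      have h7 : ∀ f : ℕ → Fn, ∑ k ∈ Finset.range p, f k = ∑ k ∈ Finset.range (p - 1 + 1), f k :=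
        fun f => by rw [← hp1]
      rw [h7, Finset.sum_range_succ, coeff_derivative_potential p hp, if_neg (by omega),
        dif_neg (by omega), map_zero, zero_mul, add_zero, Finset.sum_range]
      refine Finset.sum_congr rfl fun i _ => ?_
      have := i.2
      rw [coeff_derivative_potential p hp, if_neg (by omega), dif_pos i.2]
    rw [h5, hsmul, nsmul_eq_mul]
    have h6 := h3.symm.trans h4
    have h7 := congrArg (fun f => (ε : Fn) * f) h6
    linear_combination h7 + (-(moment p ε θ P Λ p -
        MvPowerSeries.C μ * formalWave p ε θ P Λ) + n * formalWave p ε θ P Λ' +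
        (MvPowerSeries.X 0 * formalWave p ε θ P Λ -
          ∑ i : Fin (p - 1), timePolyToFn p (θ i) * moment p ε θ P Λ i)) * hε2

end

/-! ### Absolute convergence of exponentials of polynomials. -/

section

/-! ### Absolute convergence of the exponential of a polynomial -/

/-- The monomial `v ^ m`. -/
def mon (v : ℕ → ℂ) (m : ℕ →₀ ℕ) : ℂ := m.prod fun i k => v i ^ k

theorem mon_add (v : ℕ → ℂ) (m m' : ℕ →₀ ℕ) : mon v (m + m') = mon v m * mon v m' :=
  Finsupp.prod_add_index' (fun i => pow_zero (v i)) fun i => pow_add (v i)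

/-- The sum of the absolute values of the terms of `f` at `v`. -/
def absSum (v : ℕ → ℂ) (f : MvPolynomial ℕ ℂ) : ℝ :=
  ∑ m ∈ f.support, ‖f.coeff m * mon v m‖

theorem absSum_nonneg (v : ℕ → ℂ) (f : MvPolynomial ℕ ℂ) : 0 ≤ absSum v f :=
  Finset.sum_nonneg fun _ _ => norm_nonneg _

theorem hasSum_norm_coeff (v : ℕ → ℂ) (f : MvPolynomial ℕ ℂ) :
    HasSum (fun m => ‖f.coeff m * mon v m‖) (absSum v f) :=
  hasSum_sum_of_ne_finset_zero fun m hm => by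
    rw [MvPolynomial.notMem_support_iff.mp hm, zero_mul, norm_zero]

theorem hasSum_coeff (v : ℕ → ℂ) (f : MvPolynomial ℕ ℂ) :
    HasSum (fun m => f.coeff m * mon v m) (MvPolynomial.eval v f) := by
  rw [MvPolynomial.eval_eq]
  exact hasSum_sum_of_ne_finset_zero fun m hm => by
    rw [MvPolynomial.notMem_support_iff.mp hm, zero_mul]

theorem sum_norm_coeff_le (v : ℕ → ℂ) (f : MvPolynomial ℕ ℂ) (s : Finset (ℕ →₀ ℕ)) :
    ∑ m ∈ s, ‖f.coeff m * mon v m‖ ≤ absSum v f :=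
  sum_le_hasSum s (fun _ _ => norm_nonneg _) (hasSum_norm_coeff v f)

theorem absSum_add_le (v : ℕ → ℂ) (f g : MvPolynomial ℕ ℂ) :
    absSum v (f + g) ≤ absSum v f + absSum v g := by
  refine le_trans (Finset.sum_le_sum fun m _ => ?_) (le_trans (Finset.sum_add_distrib).le
    (add_le_add (sum_norm_coeff_le v f _) (sum_norm_coeff_le v g _)))
  rw [MvPolynomial.coeff_add, add_mul]
  exact norm_add_le _ _

theorem absSum_zero (v : ℕ → ℂ) : absSum v 0 = 0 := by
  rw [absSum, MvPolynomial.support_zero, Finset.sum_empty]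

theorem absSum_sum_le {ι : Type*} (v : ℕ → ℂ) (s : Finset ι) (f : ι → MvPolynomial ℕ ℂ) :
    absSum v (∑ i ∈ s, f i) ≤ ∑ i ∈ s, absSum v (f i) :=
  Finset.le_sum_of_subadditive _ (absSum_zero v).le (absSum_add_le v) s f

theorem absSum_monomial_le (v : ℕ → ℂ) (m : ℕ →₀ ℕ) (c : ℂ) :
    absSum v (MvPolynomial.monomial m c) ≤ ‖c * mon v m‖ := by
  classical
  refine le_trans (Finset.sum_le_sum_of_subset_of_nonneg MvPolynomial.support_monomial_subset
    fun _ _ _ => norm_nonneg _) ?_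
  rw [Finset.sum_singleton, MvPolynomial.coeff_monomial, if_pos rfl]

theorem absSum_mul_le (v : ℕ → ℂ) (f g : MvPolynomial ℕ ℂ) :
    absSum v (f * g) ≤ absSum v f * absSum v g := by
  rw [MvPolynomial.mul_def, Finsupp.sum]
  refine le_trans (absSum_sum_le v _ _) ?_
  rw [absSum, Finset.sum_mul]
  refine Finset.sum_le_sum fun m _ => ?_
  rw [Finsupp.sum]
  refine le_trans (absSum_sum_le v _ _) ?_
  rw [absSum, Finset.mul_sum]
  refine Finset.sum_le_sum fun m' _ => le_trans (absSum_monomial_le v _ _) ?_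
  rw [mon_add, ← norm_mul]
  refine le_of_eq (congrArg norm ?_)
  change f.coeff m * g.coeff m' * _ = _
  ring

theorem absSum_pow_le (v : ℕ → ℂ) (f : MvPolynomial ℕ ℂ) (k : ℕ) :
    absSum v (f ^ k) ≤ absSum v f ^ k := by
  induction k with
  | zero =>
    rw [pow_zero, pow_zero, ← MvPolynomial.C_1]
    refine le_trans (absSum_monomial_le v 0 1) ?_
    simp [mon]
  | succ k ih =>
    rw [pow_succ, pow_succ]
    exact le_trans (absSum_mul_le v _ _) (mul_le_mul_of_nonneg_right ih (absSum_nonneg v f))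

/-- The coefficients of the exponential of `f`. -/
def expCoeff (f : MvPolynomial ℕ ℂ) (m : ℕ →₀ ℕ) : ℂ :=
  ∑ k ∈ Finset.range (m.degree + 1), ((k.factorial : ℂ)⁻¹) * (f ^ k).coeff m

theorem coeff_pow_eq_zero {f : MvPolynomial ℕ ℂ} (hf : MvPolynomial.constantCoeff f = 0)
    {m : ℕ →₀ ℕ} {k : ℕ} (hk : m.degree < k) : (f ^ k).coeff m = 0 := by
  rw [← MvPolynomial.coeff_coe, MvPolynomial.coe_pow]
  refine MvPowerSeries.coeff_eq_zero_of_constantCoeff_nilpotent (m := 1) ?_ (by omega)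
  rw [pow_one, ← MvPowerSeries.coeff_zero_eq_constantCoeff_apply, MvPolynomial.coeff_coe,
    ← MvPolynomial.constantCoeff_eq, hf]

/-- Submultiplicativity of `absSum` bounds the k-th row by A^k/k! with A = `absSum v f`. -/
theorem summable_exp_terms (v : ℕ → ℂ) (f : MvPolynomial ℕ ℂ) :
    Summable fun q : ℕ × (ℕ →₀ ℕ) => ((q.1.factorial : ℂ)⁻¹) * (f ^ q.1).coeff q.2 * mon v q.2 := by
  have hterm : ∀ k : ℕ, HasSum (fun m => ‖((k.factorial : ℂ)⁻¹) * (f ^ k).coeff m * mon v m‖)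
      ((k.factorial : ℝ)⁻¹ * absSum v (f ^ k)) := by
    intro k
    have := (hasSum_norm_coeff v (f ^ k)).mul_left ((k.factorial : ℝ)⁻¹)
    refine this.congr_fun fun m => ?_
    rw [mul_assoc, norm_mul, norm_inv, Complex.norm_natCast]
  refine Summable.of_norm ((summable_prod_of_nonneg fun _ => norm_nonneg _).mpr
    ⟨fun k => (hterm k).summable, ?_⟩)
  refine Summable.of_nonneg_of_le (fun k => tsum_nonneg fun _ => norm_nonneg _) (fun k => ?_)
    (Real.summable_pow_div_factorial (absSum v f))
  rw [(hterm k).tsum_eq, div_eq_inv_mul]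
  exact mul_le_mul_of_nonneg_left (absSum_pow_le v f k) (by positivity)

/-- The absolutely summable double family is summed over monomials first, giving the exponential
series, and over powers first, giving the coefficients of e^f. -/
theorem hasSum_expCoeff (v : ℕ → ℂ) {f : MvPolynomial ℕ ℂ}
    (hf : MvPolynomial.constantCoeff f = 0) :
    HasSum (fun m => expCoeff f m * mon v m) (Complex.exp (MvPolynomial.eval v f)) := by
  have hs := summable_exp_terms v f
  have h1 : HasSum (fun k : ℕ => ((k.factorial : ℂ)⁻¹) * MvPolynomial.eval v f ^ k)
      (∑' q : ℕ × (ℕ →₀ ℕ), ((q.1.factorial : ℂ)⁻¹) * (f ^ q.1).coeff q.2 * mon v q.2) := by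
    refine hs.hasSum.prod_fiberwise fun k => ?_
    simp only [mul_assoc]
    rw [← map_pow]
    exact (hasSum_coeff v (f ^ k)).mul_left _
  have h2 : HasSum (fun k : ℕ => ((k.factorial : ℂ)⁻¹) * MvPolynomial.eval v f ^ k)
      (Complex.exp (MvPolynomial.eval v f)) := by
    rw [Complex.exp_eq_exp_ℂ]
    simpa only [smul_eq_mul] using NormedSpace.exp_series_hasSum_exp' (𝕂 := ℂ)
      (MvPolynomial.eval v f)
  rw [← h1.unique h2]
  have h3 := (Equiv.prodComm (ℕ →₀ ℕ) ℕ).hasSum_iff.mpr hs.hasSum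
  refine h3.prod_fiberwise fun m => ?_
  rw [expCoeff, Finset.sum_mul]
  refine hasSum_sum_of_ne_finset_zero fun k hk => ?_
  rw [Finset.mem_range, not_lt] at hk
  change ((k.factorial : ℂ)⁻¹) * (f ^ k).coeff m * mon v m = 0
  rw [coeff_pow_eq_zero hf (by omega), mul_zero, zero_mul]

/-- A bound uniform over finite sets of monomials: it supplies the dominating function for termwise
integration. -/
theorem sum_norm_expCoeff_le (v : ℕ → ℂ) {f : MvPolynomial ℕ ℂ}
    (hf : MvPolynomial.constantCoeff f = 0) (s : Finset (ℕ →₀ ℕ)) :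
    ∑ m ∈ s, ‖expCoeff f m * mon v m‖ ≤ Real.exp (absSum v f) := by
  -- A common length of the exponential sums for all monomials in `s`, so that the two sums can be
  -- interchanged.
  set K := s.sup (fun m => m.degree) + 1
  have hK : ∀ m ∈ s, expCoeff f m * mon v m =
      ∑ k ∈ Finset.range K, ((k.factorial : ℂ)⁻¹) * ((f ^ k).coeff m * mon v m) := by
    intro m hm
    rw [expCoeff, Finset.sum_mul]
    simp only [mul_assoc]
    refine Finset.sum_subset (Finset.range_mono ?_) fun k _ hk => ?_
    · exact Nat.succ_le_succ (Finset.le_sup (f := fun m : ℕ →₀ ℕ => m.degree) hm)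
    · rw [Finset.mem_range, not_lt] at hk
      rw [coeff_pow_eq_zero hf (by omega), zero_mul, mul_zero]
  calc ∑ m ∈ s, ‖expCoeff f m * mon v m‖
      ≤ ∑ m ∈ s, ∑ k ∈ Finset.range K, ((k.factorial : ℝ)⁻¹) * ‖(f ^ k).coeff m * mon v m‖ := by
        refine Finset.sum_le_sum fun m hm => ?_
        rw [hK m hm]
        refine le_trans (norm_sum_le _ _) (le_of_eq (Finset.sum_congr rfl fun k _ => ?_))
        rw [norm_mul, norm_inv, Complex.norm_natCast]
    _ = ∑ k ∈ Finset.range K, ((k.factorial : ℝ)⁻¹) * ∑ m ∈ s, ‖(f ^ k).coeff m * mon v m‖ := by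
        rw [Finset.sum_comm]
        simp only [Finset.mul_sum]
    _ ≤ ∑ k ∈ Finset.range K, absSum v f ^ k / k.factorial := by
        refine Finset.sum_le_sum fun k _ => ?_
        rw [div_eq_inv_mul]
        exact mul_le_mul_of_nonneg_left
          ((sum_norm_coeff_le v _ s).trans (absSum_pow_le v f k)) (by positivity)
    _ ≤ Real.exp (absSum v f) := Real.sum_le_exp_of_nonneg (absSum_nonneg v f) K

/-- The value at `y` of a polynomial with coefficients polynomial in `y`. -/
def atY (E : MvPolynomial ℕ ℂ[X]) (y : ℂ) : MvPolynomial ℕ ℂ :=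
  MvPolynomial.map (Polynomial.evalRingHom y) E

theorem eval_coeff_formalExp (E : MvPolynomial ℕ ℂ[X]) (y : ℂ) (m : ℕ →₀ ℕ) :
    (MvPowerSeries.coeff m (formalExp (E : FnY))).eval y = expCoeff (atY E y) m := by
  rw [coeff_formalExp_def, expSum, map_sum, Polynomial.eval_finsetSum, expCoeff]
  refine Finset.sum_congr rfl fun k _ => ?_
  rw [coeff_smul_fnY, Polynomial.eval_smul, smul_eq_mul, ← MvPolynomial.coe_pow,
    MvPolynomial.coeff_coe, atY, ← map_pow, MvPolynomial.coeff_map]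
  rfl

theorem absSum_atY (v : ℕ → ℂ) (E : MvPolynomial ℕ ℂ[X]) (y : ℂ) :
    absSum v (atY E y) = ∑ m ∈ E.support, ‖(E.coeff m).eval y * mon v m‖ := by
  rw [absSum]
  refine Finset.sum_subset_zero_on_sdiff (MvPolynomial.support_map_subset _ _) (fun m hm => ?_)
    fun m _ => ?_
  · rw [Finset.mem_sdiff, MvPolynomial.notMem_support_iff, atY, MvPolynomial.coeff_map] at hm
    rw [← Polynomial.coe_evalRingHom, hm.2, zero_mul, norm_zero]
  · rw [atY, MvPolynomial.coeff_map, Polynomial.coe_evalRingHom]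

end

/-! ### Decay, integration by parts and termwise integration along a ray. -/

section

/-! ### Integrals along rays -/

open Filter Topology Asymptotics MeasureTheory

variable {p : ℕ}

/-- Growth of at most `e^{o(r^{p+1})}`. -/
def SubExp (p : ℕ) (f : ℝ → ℂ) : Prop :=
  ∃ h : ℝ → ℝ, h =o[atTop] (fun r : ℝ => r ^ (p + 1)) ∧ ∀ᶠ r in atTop, ‖f r‖ ≤ Real.exp (h r)

theorem SubExp.mul {f g : ℝ → ℂ} (hf : SubExp p f) (hg : SubExp p g) :
    SubExp p fun r => f r * g r := by
  obtain ⟨h, hh, hf⟩ := hf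
  obtain ⟨k, hk, hg⟩ := hg
  refine ⟨fun r => h r + k r, hh.add hk, ?_⟩
  filter_upwards [hf, hg] with r h1 h2
  rw [norm_mul, Real.exp_add]
  exact mul_le_mul h1 h2 (norm_nonneg _) (Real.exp_pos _).le

theorem const_isLittleO (c : ℝ) : (fun _ : ℝ => c) =o[atTop] fun r : ℝ => r ^ (p + 1) := by
  have h : (fun r : ℝ => r ^ 0) =o[atTop] fun r : ℝ => r ^ (p + 1) :=
    isLittleO_pow_pow_atTop_of_lt p.succ_pos
  simpa using h.const_mul_left c

theorem SubExp.of_bound {f : ℝ → ℂ} (c : ℝ) (hf : ∀ᶠ r in atTop, ‖f r‖ ≤ c) : SubExp p f :=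
  ⟨fun _ => c, const_isLittleO c, hf.mono fun _ hr =>
    hr.trans ((lt_add_one c).le.trans (Real.add_one_le_exp c))⟩

/-- From e^h + e^k ≤ 2e^{|h|+|k|} ≤ e^{1+|h|+|k|}; the constant is absorbed in o(r^{p+1}). -/
theorem SubExp.add {f g : ℝ → ℂ} (hf : SubExp p f) (hg : SubExp p g) :
    SubExp p fun r => f r + g r := by
  obtain ⟨h, hh, hf⟩ := hf
  obtain ⟨k, hk, hg⟩ := hg
  refine ⟨fun r => 1 + (‖h r‖ + ‖k r‖), (const_isLittleO 1).add (hh.norm_left.add hk.norm_left), ?_⟩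
  filter_upwards [hf, hg] with r h1 h2
  have h3 : h r ≤ ‖h r‖ + ‖k r‖ := by
    have := Real.le_norm_self (h r)
    have := norm_nonneg (k r)
    linarith
  have h4 : k r ≤ ‖h r‖ + ‖k r‖ := by
    have := Real.le_norm_self (k r)
    have := norm_nonneg (h r)
    linarith
  have h5 := Real.add_one_le_exp (1 : ℝ)
  rw [Real.exp_add]
  have h6 := mul_le_mul_of_nonneg_right h5 (Real.exp_pos (‖h r‖ + ‖k r‖)).le
  have h7 := Real.exp_le_exp.mpr h3
  have h8 := Real.exp_le_exp.mpr h4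
  have h9 := norm_add_le (f r) (g r)
  linarith

theorem SubExp.exp {f : ℝ → ℂ} (hf : f =o[atTop] fun r : ℝ => r ^ (p + 1)) :
    SubExp p fun r => Complex.exp (f r) :=
  ⟨fun r => ‖f r‖, hf.norm_left, Eventually.of_forall fun _ => Complex.norm_exp_le_exp_norm _⟩

theorem eval_ray_isLittleO (a : ℂ) {q : ℂ[X]} (hq : q.natDegree < p + 1) :
    (fun r : ℝ => q.eval (r * a)) =o[atTop] fun r : ℝ => r ^ (p + 1) := by
  have h : (fun r : ℝ => q.eval (r * a)) = fun r : ℝ =>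
      ∑ k ∈ Finset.range (q.natDegree + 1), q.coeff k * a ^ k * ((r ^ k : ℝ) : ℂ) := by
    funext r
    rw [Polynomial.eval_eq_sum_range]
    refine Finset.sum_congr rfl fun k _ => ?_
    push_cast
    ring
  rw [h]
  refine IsLittleO.fun_sum fun k hk => ?_
  refine IsLittleO.const_mul_left ?_ _
  rw [← isLittleO_norm_left]
  simp only [Complex.norm_real]
  rw [isLittleO_norm_left]
  exact isLittleO_pow_pow_atTop_of_lt (by rw [Finset.mem_range] at hk; omega)

theorem SubExp.eval (hp : 1 ≤ p) (a : ℂ) (q : ℂ[X]) : SubExp p fun r : ℝ => q.eval (r * a) := by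
  induction q using Polynomial.induction_on' with
  | add q q' hq hq' => simpa only [Polynomial.eval_add] using hq.add hq'
  | monomial k c =>
    induction k with
    | zero =>
      refine .of_bound ‖c‖ (Eventually.of_forall fun r => ?_)
      simp
    | succ k ih =>
      have h : SubExp p fun r : ℝ => (Polynomial.X : ℂ[X]).eval (r * a) := by
        refine ⟨fun r => ‖(Polynomial.X : ℂ[X]).eval (r * a)‖,
          (eval_ray_isLittleO a ?_).norm_left, Eventually.of_forall fun r => ?_⟩
        · rw [Polynomial.natDegree_X]
          omega
        · exact (lt_add_one _).le.trans (Real.add_one_le_exp _)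
      have := ih.mul h
      simpa only [← Polynomial.eval_mul, Polynomial.monomial_mul_X] using this

theorem SubExp.zpow (hp : 1 ≤ p) {a : ℂ} (ha : ‖a‖ = 1) (w : ℂ) (k : ℤ) :
    SubExp p fun r : ℝ => (r * a - w) ^ k := by
  rcases le_or_gt 0 k with hk | hk
  · obtain ⟨n, rfl⟩ := Int.eq_ofNat_of_zero_le hk
    have := SubExp.eval hp a ((Polynomial.X - Polynomial.C w) ^ n)
    simpa using this
  -- A negative power is at most 1 as soon as |ra - w| ≥ r - |w| ≥ 1.
  · refine .of_bound 1 ?_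
    filter_upwards [eventually_ge_atTop (1 + ‖w‖)] with r hr
    have hw := norm_nonneg w
    have h1 : 1 ≤ ‖r * a - w‖ := by
      have h2 := norm_sub_norm_le (r * a) w
      rw [norm_mul, ha, mul_one, Complex.norm_real, Real.norm_of_nonneg (by linarith)] at h2
      linarith
    rw [norm_zpow]
    exact zpow_le_one_of_nonpos₀ h1 hk.le

/-- If |f| ≤ e^h, then h + r = o(r^{p+1}) is eventually below r^{p+1}/(p+1), which leaves e^{-r}. -/
theorem SubExp.isBigO {f : ℝ → ℂ} (hp : 1 ≤ p) (hf : SubExp p f) :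
    (fun r : ℝ => f r * Complex.exp (-(((r ^ (p + 1) / (p + 1) : ℝ) : ℂ)))) =O[atTop]
      fun r : ℝ => Real.exp (-1 * r) := by
  obtain ⟨h, hh, hf⟩ := hf
  have h1 : (fun r : ℝ => r) =o[atTop] fun r : ℝ => r ^ (p + 1) := by
    have h2 : (fun r : ℝ => r ^ 1) =o[atTop] fun r : ℝ => r ^ (p + 1) :=
      isLittleO_pow_pow_atTop_of_lt (by omega)
    simpa using h2
  have h2 := (hh.add h1).bound (show (0 : ℝ) < 1 / (p + 1) by positivity)
  refine IsBigO.of_bound 1 ?_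
  filter_upwards [hf, h2, eventually_ge_atTop 0] with r h3 h4 h5
  rw [norm_mul, ← Complex.ofReal_neg, Complex.norm_exp_ofReal, one_mul,
    Real.norm_of_nonneg (Real.exp_pos _).le]
  rw [Real.norm_of_nonneg (pow_nonneg h5 _)] at h4
  have h6 := (Real.le_norm_self _).trans h4
  refine (mul_le_mul_of_nonneg_right h3 (Real.exp_pos _).le).trans ?_
  rw [← Real.exp_add, Real.exp_le_exp]
  have h7 : 1 / ((p : ℝ) + 1) * r ^ (p + 1) = r ^ (p + 1) / (p + 1) := by ring
  linarith

/-- `e^{-ε y^{p+1}/(p+1) + Q(y)} (y - w)^k` -/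
def kernel (p : ℕ) (ε : ℤ) (w : ℂ) (k : ℤ) (Q : ℂ[X]) (y : ℂ) : ℂ :=
  Complex.exp (-(ε : ℂ) * (1 / ((p : ℂ) + 1) * y ^ (p + 1)) + Q.eval y) * (y - w) ^ k

/-- The ray through `a` is one along which `e^{-ε y^{p+1}/(p+1)}` decays, and `(y - w)^k` is regular
on it. -/
structure IsDecayRay (p : ℕ) (ε : ℤ) (w : ℂ) (k : ℤ) (a : ℂ) : Prop where
  norm_eq : ‖a‖ = 1
  pow_eq : (ε : ℂ) * a ^ (p + 1) = 1
  regular : 0 ≤ k ∨ ∀ r : ℝ, 0 ≤ r → (r : ℂ) * a ≠ w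

variable {ε : ℤ} {w a : ℂ} {k : ℤ} {Q : ℂ[X]}

theorem IsDecayRay.kernel_eq (ha : IsDecayRay p ε w k a) (Q : ℂ[X]) (r : ℝ) :
    kernel p ε w k Q (r * a) = Complex.exp (Q.eval (r * a)) * (r * a - w) ^ k *
      Complex.exp (-(((r ^ (p + 1) / (p + 1) : ℝ) : ℂ))) := by
  have h : -(ε : ℂ) * (1 / ((p : ℂ) + 1) * (r * a) ^ (p + 1)) =
      -(((r ^ (p + 1) / (p + 1) : ℝ) : ℂ)) := by
    push_cast
    rw [mul_pow]
    linear_combination (-(r : ℂ) ^ (p + 1) / (p + 1)) * ha.pow_eq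
  rw [kernel, h, Complex.exp_add]
  ring

theorem IsDecayRay.continuousOn_kernel (ha : IsDecayRay p ε w k a) (Q : ℂ[X]) :
    ContinuousOn (fun r : ℝ => kernel p ε w k Q (r * a)) (Set.Ici 0) := by
  have h : ContinuousOn (fun r : ℝ => ((r : ℂ) * a - w) ^ k) (Set.Ici 0) := by
    have h1 : ContinuousOn (fun r : ℝ => (r : ℂ) * a - w) (Set.Ici 0) := by fun_prop
    refine h1.zpow₀ k fun r hr => ?_
    rcases ha.regular with h2 | h2
    · exact Or.inr h2
    · exact Or.inl (sub_ne_zero.mpr (h2 r hr))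
  have h2 : Continuous fun y : ℂ =>
      Complex.exp (-(ε : ℂ) * (1 / ((p : ℂ) + 1) * y ^ (p + 1)) + Q.eval y) := by fun_prop
  have h3 : Continuous fun r : ℝ => (r : ℂ) * a := by fun_prop
  exact (h2.comp h3).continuousOn.mul h

theorem IsDecayRay.isBigO_kernel (hp : 1 ≤ p) (ha : IsDecayRay p ε w k a)
    (hQ : Q.natDegree < p + 1) {f : ℝ → ℂ} (hf : SubExp p f) :
    (fun r : ℝ => f r * kernel p ε w k Q (r * a)) =O[atTop] fun r : ℝ => Real.exp (-1 * r) := by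
  refine ((hf.mul ((SubExp.exp (eval_ray_isLittleO a hQ)).mul
    (SubExp.zpow hp ha.norm_eq w k))).isBigO hp).congr_left fun r => ?_
  rw [ha.kernel_eq]
  ring

theorem IsDecayRay.integrableOn (hp : 1 ≤ p) (ha : IsDecayRay p ε w k a)
    (hQ : Q.natDegree < p + 1) {f : ℝ → ℂ} (hf : SubExp p f) (hc : ContinuousOn f (Set.Ici 0)) :
    IntegrableOn (fun r : ℝ => f r * kernel p ε w k Q (r * a)) (Set.Ioi 0) :=
  integrableOn_Ici_iff_integrableOn_Ioi (by finiteness) |>.mp <|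
    ((hc.mul (ha.continuousOn_kernel Q)).locallyIntegrableOn
      measurableSet_Ici).integrableOn_of_isBigO_atTop (ha.isBigO_kernel hp hQ hf)
      ⟨Set.Ioi 1, Ioi_mem_atTop 1, exp_neg_integrableOn_Ioi 1 one_pos⟩

theorem IsDecayRay.integrableOn_eval (hp : 1 ≤ p) (ha : IsDecayRay p ε w k a)
    (hQ : Q.natDegree < p + 1) (q : ℂ[X]) :
    IntegrableOn (fun r : ℝ => q.eval (r * a) * kernel p ε w k Q (r * a) * a) (Set.Ioi 0) :=
  (ha.integrableOn hp hQ (SubExp.eval hp a q) (by fun_prop)).mul_const a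

theorem IsDecayRay.tendsto (hp : 1 ≤ p) (ha : IsDecayRay p ε w k a)
    (hQ : Q.natDegree < p + 1) (q : ℂ[X]) :
    Tendsto (fun r : ℝ => q.eval (r * a) * kernel p ε w k Q (r * a)) atTop (𝓝 0) := by
  refine (ha.isBigO_kernel hp hQ (SubExp.eval hp a q)).trans_tendsto ?_
  simp only [neg_one_mul]
  exact Real.tendsto_exp_neg_atTop_nhds_zero

theorem hasDerivAt_kernel {y : ℂ} (hy : y - w ≠ 0 ∨ 0 ≤ k) (q : ℂ[X]) :
    HasDerivAt (fun y => q.eval y * kernel p ε w k Q y)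
      ((Polynomial.derivative q + (-(Polynomial.C (ε : ℂ)) * Polynomial.X ^ p +
        Polynomial.derivative Q) * q).eval y * kernel p ε w k Q y +
        k * (q.eval y * kernel p ε w (k - 1) Q y)) y := by
  have h1 := (hasDerivAt_zpow k (y - w) hy).comp y ((hasDerivAt_id y).sub_const w)
  have h2 : HasDerivAt (fun y : ℂ => -(ε : ℂ) * (1 / ((p : ℂ) + 1) * y ^ (p + 1)) + Q.eval y)
      (-(ε : ℂ) * (1 / ((p : ℂ) + 1) * (((p + 1 : ℕ) : ℂ) * y ^ p)) +
        (Polynomial.derivative Q).eval y) y :=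
    (((hasDerivAt_pow (p + 1) y).const_mul _).const_mul _).add (Q.hasDerivAt y)
  have h3 := (q.hasDerivAt y).mul (h2.cexp.mul h1)
  refine h3.congr_deriv ?_
  have h4 : 1 / ((p : ℂ) + 1) * (((p + 1 : ℕ) : ℂ) * y ^ p) = y ^ p := by
    push_cast
    rw [← mul_assoc, one_div_mul_cancel (Nat.cast_add_one_ne_zero p), one_mul]
  rw [h4]
  simp only [kernel, Polynomial.eval_add, Polynomial.eval_mul, Polynomial.eval_neg,
    Polynomial.eval_C, Polynomial.eval_pow, Polynomial.eval_X, Function.comp_apply, Pi.mul_apply, id]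
  ring

/-- A nonzero k ≥ 0 stays nonnegative when lowered; otherwise w is off the ray and the exponent does
not matter. For k = 0 a pole could appear on the ray. -/
theorem IsDecayRay.pred (ha : IsDecayRay p ε w k a) (hk : k ≠ 0) : IsDecayRay p ε w (k - 1) a :=
  ⟨ha.norm_eq, ha.pow_eq, ha.regular.imp_left fun h => by omega⟩

/-- Integration by parts along a ray. -/
theorem IsDecayRay.rayIntegral_deriv (hp : 1 ≤ p) (ha : IsDecayRay p ε w k a)
    (hQ : Q.natDegree < p + 1) (q : ℂ[X]) :
    rayIntegral a (fun y => (Polynomial.derivative q + (-(Polynomial.C (ε : ℂ)) * Polynomial.X ^ p +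
        Polynomial.derivative Q) * q).eval y * kernel p ε w k Q y +
        k * (q.eval y * kernel p ε w (k - 1) Q y)) = -(q.eval 0 * kernel p ε w k Q 0) := by
  have h := integral_Ioi_of_hasDerivAt_of_tendsto (a := 0) (m := 0)
    (f := fun r : ℝ => q.eval (r * a) * kernel p ε w k Q (r * a))
    (f' := fun r : ℝ => ((Polynomial.derivative q + (-(Polynomial.C (ε : ℂ)) * Polynomial.X ^ p +
        Polynomial.derivative Q) * q).eval (r * a) * kernel p ε w k Q (r * a) +
        k * (q.eval (r * a) * kernel p ε w (k - 1) Q (r * a))) * a) ?_ ?_ ?_ (ha.tendsto hp hQ q)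
  · rw [rayIntegral, h]
    simp
  · have h1 : ContinuousOn (fun r : ℝ => q.eval ((r : ℂ) * a)) (Set.Ici 0) := by fun_prop
    exact (h1.mul (ha.continuousOn_kernel Q)) 0 Set.self_mem_Ici
  · intro r hr
    have hy : (r : ℂ) * a - w ≠ 0 ∨ 0 ≤ k := by
      rcases ha.regular with h2 | h2
      · exact Or.inr h2
      · exact Or.inl (sub_ne_zero.mpr (h2 r (le_of_lt hr)))
    have h1 := (hasDerivAt_kernel (p := p) (ε := ε) (Q := Q) hy q).comp (r : ℂ)
      ((hasDerivAt_id (r : ℂ)).mul_const a)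
    have h2 := h1.comp_ofReal
    rw [one_mul] at h2
    exact h2
  · simp only [add_mul _ _ a]
    refine Integrable.add (ha.integrableOn_eval hp hQ _) ?_
    -- For k = 0 the factor (y - w)⁻¹ need not be integrable, but its coefficient k vanishes.
    by_cases hk : k = 0
    · subst hk
      simp
    · have := ((ha.pred hk).integrableOn_eval hp hQ q).const_mul (k : ℂ)
      simpa only [mul_assoc] using this

/-- All coefficients of E have degree at most p in y, so the dominating exponent stays below the
decay of order r^{p+1}. -/
theorem absSum_ray_isLittleO (v : ℕ → ℂ) (a : ℂ) {E : MvPolynomial ℕ ℂ[X]}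
    (hE : ∀ m, (E.coeff m).natDegree < p + 1) :
    (fun r : ℝ => ((absSum v (atY E (r * a)) : ℝ) : ℂ)) =o[atTop] fun r : ℝ => r ^ (p + 1) := by
  rw [← isLittleO_norm_left]
  simp only [Complex.norm_real, absSum_atY, norm_mul]
  rw [isLittleO_norm_left]
  refine IsLittleO.fun_sum fun m _ => ?_
  have := ((eval_ray_isLittleO (p := p) a (hE m)).norm_left).const_mul_left ‖mon v m‖
  simpa only [mul_comm] using this

/-- Termwise integration of the exponential series along a ray. -/
theorem IsDecayRay.hasSum_rayIntegral (hp : 1 ≤ p) (ha : IsDecayRay p ε w k a)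
    (hQ : Q.natDegree < p + 1) (v : ℕ → ℂ) {E : MvPolynomial ℕ ℂ[X]}
    (hE : ∀ m, (E.coeff m).natDegree < p + 1) (hE0 : MvPolynomial.constantCoeff E = 0) :
    HasSum (fun m => rayIntegral a (fun y => (MvPowerSeries.coeff m (formalExp (E : FnY))).eval y *
        kernel p ε w k Q y) * mon v m)
      (rayIntegral a fun y => Complex.exp (MvPolynomial.eval v (atY E y)) *
        kernel p ε w k Q y) := by
  have hE1 : ∀ y, MvPolynomial.constantCoeff (atY E y) = 0 := by
    intro y
    rw [atY, MvPolynomial.constantCoeff_map, hE0, map_zero]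
  set F : (ℕ →₀ ℕ) → ℝ → ℂ := fun m r => (MvPowerSeries.coeff m (formalExp (E : FnY))).eval (r * a) *
        kernel p ε w k Q (r * a) * a * mon v m with hF
  have hFint : ∀ m, Integrable (F m) (volume.restrict (Set.Ioi 0)) := fun m =>
    (ha.integrableOn_eval hp hQ _).mul_const _
  have hFeq : ∀ m r, F m r = expCoeff (atY E (r * a)) m * mon v m *
      (kernel p ε w k Q (r * a) * a) := by
    intro m r
    rw [hF]
    simp only [eval_coeff_formalExp]
    ring
  have hcont : Continuous fun r : ℝ => Complex.exp ((absSum v (atY E (r * a)) : ℝ) : ℂ) := by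
    simp only [absSum_atY]
    fun_prop
  -- The dominating function: e to the sum of absolute values of the terms of E, times the kernel.
  have hbound : Integrable (fun r : ℝ => Complex.exp ((absSum v (atY E (r * a)) : ℝ) : ℂ) *
      kernel p ε w k Q (r * a) * a) (volume.restrict (Set.Ioi 0)) :=
    (ha.integrableOn hp hQ (SubExp.exp (absSum_ray_isLittleO v a hE)) hcont.continuousOn).mul_const a
  have hsum : Summable fun m => ∫ r in Set.Ioi (0 : ℝ), ‖F m r‖ := by
    refine summable_of_sum_le (c := ∫ r in Set.Ioi (0 : ℝ),
      ‖Complex.exp ((absSum v (atY E (r * a)) : ℝ) : ℂ) * kernel p ε w k Q (r * a) * a‖)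
      (fun m => integral_nonneg fun r => norm_nonneg _) fun s => ?_
    rw [← integral_finsetSum _ fun m _ => (hFint m).norm]
    refine integral_mono (integrable_finsetSum _ fun m _ => (hFint m).norm) hbound.norm fun r => ?_
    simp only [hFeq, norm_mul _ (kernel p ε w k Q _ * a)]
    rw [← Finset.sum_mul, mul_assoc, norm_mul _ (kernel p ε w k Q _ * a), Complex.norm_exp_ofReal]
    exact mul_le_mul_of_nonneg_right (sum_norm_expCoeff_le v (hE1 _) s) (norm_nonneg _)
  have h := hasSum_integral_of_summable_integral_norm hFint hsum
  have h1 : ∀ r : ℝ, ∑' m, F m r = Complex.exp (MvPolynomial.eval v (atY E (r * a))) *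
      kernel p ε w k Q (r * a) * a := by
    intro r
    simp only [hFeq]
    rw [tsum_mul_right, (hasSum_expCoeff v (hE1 _)).tsum_eq, mul_assoc]
  simp only [h1, integral_mul_const] at h
  simpa only [rayIntegral, integral_mul_const, hF] using h

end

/-! ### Contour integrals and the convergence of the wave functions. -/

section

/-! ### Contour integrals -/

open MeasureTheory

variable {p : ℕ} {Γ : Finset ℕ} {ε : ℤ} {w : ℂ} {k : ℤ} {Q : ℂ[X]}

theorem omega_pow_succ (p : ℕ) : omega p ^ (p + 1) = -1 := by
  rw [omega, ← Complex.exp_nat_mul, Nat.cast_succ,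
    mul_div_cancel₀ _ (Nat.cast_add_one_ne_zero p), Complex.exp_pi_mul_I]

theorem norm_omega (p : ℕ) : ‖omega p‖ = 1 := by
  have h : ‖omega p‖ ^ (p + 1) = 1 := by rw [← norm_pow, omega_pow_succ, norm_neg, norm_one]
  exact (pow_eq_one_iff_of_nonneg (norm_nonneg _) p.succ_ne_zero).mp h

/-- All rays of `Γ` are rays of decay, on which `(y - w)^k` is regular. -/
def IsDecayContour (p : ℕ) (ε : ℤ) (w : ℂ) (k : ℤ) (Γ : Finset ℕ) : Prop :=
  ∀ l ∈ Γ, IsDecayRay p ε w k (omega p ^ l) ∧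
    IsDecayRay p ε w k ((starRingEnd ℂ) (omega p ^ l))

/-- As ω^{p+1} = -1, the leading exponential decays along ω^ℓ and its conjugate for even ℓ when ε =
1, and for odd ℓ when ε = -1. -/
theorem isDecayContour (hε : ∀ l ∈ Γ, ε * (-1) ^ l = 1) (hk : 0 ≤ k ∨ w ∉ contourSet p Γ) :
    IsDecayContour p ε w k Γ := by
  intro l hl
  have h1 : ‖omega p ^ l‖ = 1 := by rw [norm_pow, norm_omega, one_pow]
  have h2 : (omega p ^ l) ^ (p + 1) = (-1) ^ l := by
    rw [← pow_mul, mul_comm, pow_mul, omega_pow_succ]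
  have h3 : (ε : ℂ) * (-1) ^ l = 1 := by exact_mod_cast congrArg (Int.cast (R := ℂ)) (hε l hl)
  refine ⟨⟨h1, by rw [h2, h3], hk.imp_right fun h r hr he => ?_⟩,
    ⟨by rw [RCLike.norm_conj, h1], ?_, hk.imp_right fun h r hr he => ?_⟩⟩
  · exact h ⟨l, hl, r, hr, Or.inl he.symm⟩
  · rw [← map_pow, h2, map_pow, map_neg, map_one, h3]
  · exact h ⟨l, hl, r, hr, Or.inr he.symm⟩

theorem IsDecayContour.pred (h : IsDecayContour p ε w k Γ) (hk : k ≠ 0) :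
    IsDecayContour p ε w (k - 1) Γ :=
  fun l hl => ⟨(h l hl).1.pred hk, (h l hl).2.pred hk⟩

theorem IsDecayContour.integrable (hp : 1 ≤ p) (h : IsDecayContour p ε w k Γ)
    (hQ : Q.natDegree < p + 1) (q : ℂ[X]) :
    ContourIntegrable p Γ fun y => q.eval y * kernel p ε w k Q y := by
  rintro l hl a (rfl | rfl)
  · exact (h l hl).1.integrableOn_eval hp hQ q
  · exact (h l hl).2.integrableOn_eval hp hQ q

theorem contourIntegral_add {f g : ℂ → ℂ} (hf : ContourIntegrable p Γ f)
    (hg : ContourIntegrable p Γ g) : contourIntegral p Γ (fun y => f y + g y) =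
      contourIntegral p Γ f + contourIntegral p Γ g := by
  have h : ∀ l ∈ Γ, ∀ a ∈ ({omega p ^ l, (starRingEnd ℂ) (omega p ^ l)} : Set ℂ),
      rayIntegral a (fun y => f y + g y) = rayIntegral a f + rayIntegral a g := by
    intro l hl a ha
    simp only [rayIntegral, add_mul]
    exact integral_add (hf l hl a ha) (hg l hl a ha)
  rw [contourIntegral, contourIntegral, contourIntegral, ← Finset.sum_add_distrib]
  refine Finset.sum_congr rfl fun l hl => ?_
  rw [h l hl _ (Or.inl rfl), h l hl _ (Or.inr rfl)]
  ring

theorem contourIntegral_const_mul (c : ℂ) (f : ℂ → ℂ) :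
    contourIntegral p Γ (fun y => c * f y) = c * contourIntegral p Γ f := by
  have h : ∀ a, rayIntegral a (fun y => c * f y) = c * rayIntegral a f := by
    intro a
    simp only [rayIntegral, mul_assoc]
    exact integral_const_mul _ _
  simp only [contourIntegral, h, ← mul_sub, Finset.mul_sum]

/-- The functional `q ↦ c ∫_Γ q(y) e^{-ε y^{p+1}/(p+1) + Q(y)} (y - w)^k dy`. -/
def contourFunctional (hp : 1 ≤ p) (h : IsDecayContour p ε w k Γ) (hQ : Q.natDegree < p + 1)
    (c : ℂ) : ℂ[X] →ₗ[ℂ] ℂ where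
  toFun q := c * contourIntegral p Γ fun y => q.eval y * kernel p ε w k Q y
  map_add' q q' := by
    simp only [Polynomial.eval_add, add_mul]
    rw [contourIntegral_add (h.integrable hp hQ q) (h.integrable hp hQ q'), mul_add]
  map_smul' b q := by
    simp only [Polynomial.eval_smul, smul_eq_mul, mul_assoc, contourIntegral_const_mul,
      RingHom.id_apply]
    ring

theorem contourFunctional_apply (hp : 1 ≤ p) (h : IsDecayContour p ε w k Γ)
    (hQ : Q.natDegree < p + 1) (c : ℂ) (q : ℂ[X]) : contourFunctional hp h hQ c q =
      c * contourIntegral p Γ fun y => q.eval y * kernel p ε w k Q y := rfl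

/-- Integration by parts: the boundary terms of the two rays of each contour cancel. -/
theorem IsDecayContour.contourIntegral_deriv (hp : 1 ≤ p) (h : IsDecayContour p ε w k Γ)
    (hQ : Q.natDegree < p + 1) (q : ℂ[X]) :
    contourIntegral p Γ (fun y => (Polynomial.derivative q +
      (-(Polynomial.C (ε : ℂ)) * Polynomial.X ^ p +
        Polynomial.derivative Q) * q).eval y * kernel p ε w k Q y +
        k * (q.eval y * kernel p ε w (k - 1) Q y)) = 0 := by
  rw [contourIntegral]
  refine Finset.sum_eq_zero fun l hl => ?_
  rw [(h l hl).1.rayIntegral_deriv hp hQ, (h l hl).2.rayIntegral_deriv hp hQ, sub_self]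

theorem kernel_mul_sub (hk : k ≠ 0) (y : ℂ) :
    (y - w) * kernel p ε w (k - 1) Q y = kernel p ε w k Q y := by
  rw [kernel, kernel, mul_left_comm]
  congr 1
  by_cases hy : y - w = 0
  -- At y = w both sides vanish, also for negative k, by the convention for inverses of zero.
  · rw [hy, zero_mul, zero_zpow k hk]
  · rw [zpow_sub_one₀ hy, mul_left_comm, mul_inv_cancel₀ hy, mul_one]

/-- The functional obtained from `contourFunctional` by lowering the exponent `k` by one satisfies
the relations which express multiplication by `y - w` and integration by parts. -/
theorem exists_lowered_functional (hp : 1 ≤ p) (h : IsDecayContour p ε w k Γ)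
    (hQ : Q.natDegree < p + 1) (c : ℂ) : ∃ Λ' : ℂ[X] →ₗ[ℂ] ℂ,
      (∀ q, Λ' ((Polynomial.X - Polynomial.C w) * q) = contourFunctional hp h hQ c q) ∧
      ∀ q, contourFunctional hp h hQ c (Polynomial.derivative q) = contourFunctional hp h hQ c
        ((Polynomial.C (ε : ℂ) * Polynomial.X ^ p - Polynomial.derivative Q) * q) - k * Λ' q := by
  have hsplit : ∀ q, contourFunctional hp h hQ c (Polynomial.derivative q) -
      contourFunctional hp h hQ c ((Polynomial.C (ε : ℂ) * Polynomial.X ^ p -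
        Polynomial.derivative Q) * q) = contourFunctional hp h hQ c (Polynomial.derivative q +
          (-(Polynomial.C (ε : ℂ)) * Polynomial.X ^ p + Polynomial.derivative Q) * q) := by
    intro q
    rw [← map_sub]
    congr 1
    ring
  by_cases hk : k = 0
  -- For k = 0 the weight cannot be divided by y - w if w lies on the contour. An algebraic left
  -- inverse of multiplication by y - w on polynomials serves instead, as Λ' enters the second
  -- relation with coefficient zero.
  · obtain ⟨g, hg⟩ := (LinearMap.mulLeft ℂ
      (Polynomial.X - Polynomial.C w)).exists_leftInverse_of_injective
      (LinearMap.ker_eq_bot.mpr (mul_right_injective₀ (Polynomial.X_sub_C_ne_zero w)))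
    refine ⟨(contourFunctional hp h hQ c).comp g, fun q => ?_, fun q => ?_⟩
    · exact congrArg (contourFunctional hp h hQ c) (LinearMap.congr_fun hg q)
    · have h1 := h.contourIntegral_deriv hp hQ q
      have h2 := hsplit q
      rw [contourFunctional_apply hp h hQ c (_ + _)] at h2
      subst hk
      simp only [Int.cast_zero, zero_mul, add_zero] at h1
      rw [Int.cast_zero, zero_mul, sub_zero]
      rw [h1, mul_zero] at h2
      exact sub_eq_zero.mp h2
  · refine ⟨contourFunctional hp (h.pred hk) hQ c, fun q => ?_, fun q => ?_⟩
    · rw [contourFunctional_apply, contourFunctional_apply]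
      congr 2
      funext y
      rw [Polynomial.eval_mul, Polynomial.eval_sub, Polynomial.eval_X, Polynomial.eval_C,
        ← kernel_mul_sub hk]
      ring
    · have h1 := h.contourIntegral_deriv hp hQ q
      rw [contourIntegral_add (h.integrable hp hQ _), contourIntegral_const_mul] at h1
      · have h2 := hsplit q
        rw [contourFunctional_apply hp h hQ c (_ + _)] at h2
        rw [contourFunctional_apply hp (h.pred hk)]
        linear_combination h2 + c * h1
      · intro l hl a ha
        have := ((h.pred hk).integrable hp hQ q l hl a ha).const_mul (k : ℂ)
        simp only [mul_assoc] at this ⊢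
        exact this

/-- Termwise integration of the exponential series along a contour. -/
theorem IsDecayContour.hasSum (hp : 1 ≤ p) (h : IsDecayContour p ε w k Γ)
    (hQ : Q.natDegree < p + 1) (v : ℕ → ℂ) {E : MvPolynomial ℕ ℂ[X]}
    (hE : ∀ m, (E.coeff m).natDegree < p + 1) (hE0 : MvPolynomial.constantCoeff E = 0) :
    HasSum (fun m => contourIntegral p Γ
        (fun y => (MvPowerSeries.coeff m (formalExp (E : FnY))).eval y * kernel p ε w k Q y) *
          mon v m)
      (contourIntegral p Γ fun y => Complex.exp (MvPolynomial.eval v (atY E y)) *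
        kernel p ε w k Q y) := by
  simp only [contourIntegral, Finset.sum_mul, sub_mul]
  exact hasSum_sum fun l hl => ((h l hl).1.hasSum_rayIntegral hp hQ v hE hE0).sub
    ((h l hl).2.hasSum_rayIntegral hp hQ v hE hE0)

/-! ### The integrand of the wave functions -/

/-- `V_p(y) - y^{p+1}/(p+1)` at numerical times. -/
def lowerPart (p : ℕ) (θ : Fin (p - 1) → TimePoly p) (t : Fin (p - 1) → ℂ) : ℂ[X] :=
  ∑ i : Fin (p - 1), Polynomial.C (1 / ((i : ℂ) + 1) * MvPolynomial.eval t (θ i)) *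
    Polynomial.X ^ ((i : ℕ) + 1)

theorem potentialAt_eq (θ : Fin (p - 1) → TimePoly p) (t : Fin (p - 1) → ℂ) :
    potentialAt p θ t = Polynomial.C (1 / ((p : ℂ) + 1)) * Polynomial.X ^ (p + 1) +
      lowerPart p θ t := by
  simp [potentialAt, potential, lowerPart, Polynomial.map_sum]

/-- The exponent of the integrand without the leading term of the potential. -/
def lowerExponent (p : ℕ) (ε : ℤ) (θ : Fin (p - 1) → TimePoly p) (t : Fin (p - 1) → ℂ)
    (x z : ℂ) : ℂ[X] :=
  Polynomial.C ((ε : ℂ) * (x + z ^ p)) * Polynomial.X - Polynomial.C (ε : ℂ) * lowerPart p θ t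

theorem natDegree_lowerExponent (hp : 1 ≤ p) (ε : ℤ) (θ : Fin (p - 1) → TimePoly p)
    (t : Fin (p - 1) → ℂ) (x z : ℂ) : (lowerExponent p ε θ t x z).natDegree < p + 1 := by
  refine Nat.lt_succ_of_le ((Polynomial.natDegree_sub_le_of_le (m := p) (n := p) ?_ ?_).trans
    (max_self p).le)
  · exact (Polynomial.natDegree_C_mul_le _ _).trans (Polynomial.natDegree_X_le.trans hp)
  · refine (Polynomial.natDegree_C_mul_le _ _).trans
      (Polynomial.natDegree_sum_le_of_forall_le _ _ fun i _ => ?_)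
    have := i.2
    exact (Polynomial.natDegree_C_mul_X_pow_le _ _).trans (by omega)

theorem integrand_eq_kernel (n : ℕ) (θ : Fin (p - 1) → TimePoly p) (t : Fin (p - 1) → ℂ)
    (x z y : ℂ) : integrand p n w ε (potentialAt p θ t) x z y =
      kernel p ε w (ε * n) (lowerExponent p ε θ t x z) y := by
  rw [integrand, kernel, potentialAt_eq, lowerExponent]
  congr 2
  simp only [Polynomial.eval_add, Polynomial.eval_sub, Polynomial.eval_mul, Polynomial.eval_C,
    Polynomial.eval_pow, Polynomial.eval_X]
  ring

theorem IsDecayContour.integrable_integrand {n : ℕ} (hp : 1 ≤ p)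
    (h : IsDecayContour p ε w (ε * n) Γ) (θ : Fin (p - 1) → TimePoly p) (t : Fin (p - 1) → ℂ)
    (x z : ℂ) : ContourIntegrable p Γ (integrand p n w ε (potentialAt p θ t) x z) := by
  have := h.integrable hp (natDegree_lowerExponent hp ε θ t x z) 1
  simp only [Polynomial.eval_one, one_mul, ← integrand_eq_kernel] at this
  exact this

theorem natDegree_coeff_exponent (hp : 1 ≤ p) (ε : ℤ) (θ : Fin (p - 1) → TimePoly p)
    (P : TimePoly p) (m : ℕ →₀ ℕ) : ((exponent p ε θ P).coeff m).natDegree < p + 1 := by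
  have h : ∀ f : TimePoly p, (timePolyY p f).coeff m = Polynomial.C
      ((MvPolynomial.rename (fun i : Fin (p - 1) => (i : ℕ) + 1) f).coeff m) := fun f =>
    MvPolynomial.coeff_map ..
  have h1 : ((MvPolynomial.X 0 : MvPolynomial ℕ ℂ[X]).coeff m).natDegree = 0 := by
    classical
    rw [MvPolynomial.coeff_X]
    split_ifs <;> simp
  rw [exponent, ← map_intCast (MvPolynomial.C (σ := ℕ) (R := ℂ[X])), MvPolynomial.coeff_C_mul, MvPolynomial.coeff_sub,
    MvPolynomial.coeff_add, mul_comm (MvPolynomial.X 0), MvPolynomial.coeff_C_mul,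
    MvPolynomial.coeff_sum, h,
    ← map_intCast (Polynomial.C (R := ℂ))]
  refine Nat.lt_succ_of_le ((Polynomial.natDegree_C_mul_le _ _).trans
    ((Polynomial.natDegree_sub_le_of_le (m := p) (n := p) ?_ ?_).trans (max_self p).le))
  · refine (Polynomial.natDegree_add_le_of_le (m := p) (n := p) ?_ ?_).trans (max_self p).le
    · rw [Polynomial.natDegree_C]
      omega
    · refine Polynomial.natDegree_mul_le.trans ?_
      rw [h1, Polynomial.natDegree_X]
      omega
  · refine Polynomial.natDegree_sum_le_of_forall_le _ _ fun i _ => ?_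
    rw [mul_comm, MvPolynomial.coeff_C_mul, h, mul_comm]
    have := i.2
    exact (Polynomial.natDegree_C_mul_le _ _).trans
      ((Polynomial.natDegree_C_mul_X_pow_le _ _).trans (by omega))

theorem eval_atY_timePolyY (f : TimePoly p) (x : ℂ) (t : Fin (p - 1) → ℂ) (y : ℂ) :
    MvPolynomial.eval (point p x t) (atY (timePolyY p f) y) = MvPolynomial.eval t f := by
  have h : ((MvPolynomial.eval (point p x t)).comp
      ((MvPolynomial.map (Polynomial.evalRingHom y)).comp (timePolyY p))) =
      MvPolynomial.eval t := by
    refine MvPolynomial.ringHom_ext (fun c => ?_) fun i => ?_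
    · simp [timePolyY]
    · have := i.2
      simp [timePolyY, point]
  exact congrArg (fun φ : TimePoly p →+* ℂ => φ f) h

theorem eval_atY_exponent (ε : ℤ) (θ : Fin (p - 1) → TimePoly p) (P : TimePoly p)
    (x : ℂ) (t : Fin (p - 1) → ℂ) (y : ℂ) :
    MvPolynomial.eval (point p x t) (atY (exponent p ε θ P) y) =
      (ε : ℂ) * MvPolynomial.eval t P + (ε : ℂ) * x * y - (ε : ℂ) * (lowerPart p θ t).eval y := by
  have h := fun f : TimePoly p => eval_atY_timePolyY f x t y
  have h0 : point p x t 0 = x := if_pos rfl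
  simp only [atY] at h ⊢
  simp only [exponent, map_mul, map_sub, map_add, map_sum, map_intCast, h, MvPolynomial.map_X,
    MvPolynomial.map_C, MvPolynomial.eval_X, MvPolynomial.eval_C, h0, lowerPart,
    Polynomial.eval_finsetSum, Polynomial.coe_evalRingHom, Polynomial.eval_X, Polynomial.eval_C,
    Polynomial.eval_mul, Polynomial.eval_pow]
  rw [mul_sub, mul_add, mul_assoc]
  refine congrArg (fun s => _ - (ε : ℂ) * s) (Finset.sum_congr rfl fun i _ => ?_)
  ring

/-- The integrand splits into the part expanded in x and the times, and the fixed weight containing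
y^{p+1}, z and w that is kept inside the functional. -/
theorem exp_mul_kernel (ε : ℤ) (θ : Fin (p - 1) → TimePoly p) (P : TimePoly p)
    (x : ℂ) (t : Fin (p - 1) → ℂ) (z y : ℂ) :
    Complex.exp (MvPolynomial.eval (point p x t) (atY (exponent p ε θ P) y)) *
      kernel p ε w k (Polynomial.C ((ε : ℂ) * z ^ p) * Polynomial.X) y =
    Complex.exp ((ε : ℂ) * MvPolynomial.eval t P) *
      kernel p ε w k (lowerExponent p ε θ t x z) y := by
  rw [kernel, kernel, ← mul_assoc (Complex.exp _), ← mul_assoc (Complex.exp _), ← Complex.exp_add,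
    ← Complex.exp_add, eval_atY_exponent, lowerExponent]
  congr 2
  simp only [Polynomial.eval_sub, Polynomial.eval_mul, Polynomial.eval_C, Polynomial.eval_X]
  ring

/-- The factor in front of the integral in the wave functions. -/
def waveConst (p n : ℕ) (ε : ℤ) (z : ℂ) : ℂ :=
  ((ε : ℂ) * p / (2 * Real.pi)) ^ (1 / 2 : ℂ) * z ^ (((p : ℂ) - 1) / 2 - (ε : ℂ) * n) *
    Complex.exp (-(ε : ℂ) * (p / ((p : ℂ) + 1)) * z ^ (p + 1))

theorem natDegree_C_mul_X_lt (hp : 1 ≤ p) (c : ℂ) :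
    (Polynomial.C c * Polynomial.X : ℂ[X]).natDegree < p + 1 :=
  Nat.lt_succ_of_le ((Polynomial.natDegree_C_mul_le _ _).trans (Polynomial.natDegree_X_le.trans hp))

/-- The functional whose formal wave function is the wave function. -/
def waveFunctional {n : ℕ} (hp : 1 ≤ p) (h : IsDecayContour p ε w (ε * n) Γ) (z : ℂ) :
    ℂ[X] →ₗ[ℂ] ℂ :=
  contourFunctional hp h (natDegree_C_mul_X_lt hp ((ε : ℂ) * z ^ p)) (waveConst p n ε z)

variable {θ : Fin (p - 1) → TimePoly p} {r : LaurentSeries (TimePoly p)} {P : TimePoly p}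

/-- The coefficients of the formal wave function are the contour integrals of the coefficients of
e^E, so its value is obtained by termwise integration. -/
theorem hasValue_formalWave {n : ℕ} (hp : 1 ≤ p) (hD : PotentialData p θ r P)
    (h : IsDecayContour p ε w (ε * n) Γ) (z x : ℂ) (t : Fin (p - 1) → ℂ) :
    HasValue (formalWave p ε θ P (waveFunctional hp h z)) (point p x t)
      (explicitWave p n w Γ ε θ P x t z) := by
  have hE0 : MvPolynomial.constantCoeff (exponent p ε θ P) = 0 := by
    have := constantCoeff_exponent ε hD.constantCoeff_theta hD.constantCoeff_prefactor
    rwa [← MvPowerSeries.coeff_zero_eq_constantCoeff_apply, MvPolynomial.coeff_coe,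
      ← MvPolynomial.constantCoeff_eq] at this
  have h1 := (h.hasSum hp (natDegree_C_mul_X_lt hp ((ε : ℂ) * z ^ p)) (point p x t)
    (natDegree_coeff_exponent hp ε θ P) hE0).mul_left (waveConst p n ε z)
  simp only [exp_mul_kernel, ← integrand_eq_kernel, contourIntegral_const_mul, ← mul_assoc] at h1
  have h2 : explicitWave p n w Γ ε θ P x t z = waveConst p n ε z *
      Complex.exp ((ε : ℂ) * MvPolynomial.eval t P) *
        contourIntegral p Γ (integrand p n w ε (potentialAt p θ t) x z) := by
    rw [explicitWave, airyWave, waveConst]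
    ring
  rw [HasValue, h2]
  exact h1

theorem explicitWave_zero (n : ℕ) (hD : PotentialData p θ r P) (x z : ℂ) :
    explicitWave p n w Γ ε θ P x 0 z = initialWave p n w Γ ε x z := by
  have h : lowerPart p θ 0 = 0 := by
    refine Finset.sum_eq_zero fun i _ => ?_
    rw [MvPolynomial.eval_zero, hD.constantCoeff_theta]
    simp
  rw [explicitWave, potentialAt_eq, h, add_zero, initialWave,
    MvPolynomial.eval_zero, hD.constantCoeff_prefactor, mul_zero,
    Complex.exp_zero, one_mul]

theorem isEigenfunction_formalWave {n : ℕ} (hp : 2 ≤ p) (hD : PotentialData p θ r P)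
    (hε : ε = 1 ∨ ε = -1) (h : IsDecayContour p ε w (ε * n) Γ) (z : ℂ) :
    IsEigenfunction n w ε (signed ε (explicitLax p n w θ)) (z ^ p)
      (formalWave p ε θ P (waveFunctional (by omega) h z)) := by
  obtain ⟨Λ', h1, h2⟩ := exists_lowered_functional (show 1 ≤ p by omega) h
    (natDegree_C_mul_X_lt (by omega) ((ε : ℂ) * z ^ p)) (waveConst p n ε z)
  refine formalWave_isEigenfunction hp hD n w (z ^ p) hε _ Λ' h1 fun q => ?_
  refine (h2 q).trans ?_
  have h3 : (Polynomial.C (ε : ℂ) * Polynomial.X ^ p - Polynomial.derivative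
      (Polynomial.C ((ε : ℂ) * z ^ p) * Polynomial.X)) * q =
      (ε : ℂ) • ((Polynomial.X ^ p - Polynomial.C (z ^ p)) * q) := by
    rw [Polynomial.derivative_C_mul, Polynomial.derivative_X, mul_one, Polynomial.smul_eq_C_mul,
      ← mul_assoc, mul_sub, ← map_mul]
  rw [h3, map_smul, smul_eq_mul, waveFunctional]
  push_cast
  rfl

end

/-! ### Uniqueness of the flows, and assembly of the result. -/

section

/-! ### The filtration by the degree in the times -/

/-- The total degree of a monomial in the times `t₁, t₂, …`. -/
def timeDegree (m : ℕ →₀ ℕ) : ℕ := (m.erase 0).degree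

theorem timeDegree_add (m m' : ℕ →₀ ℕ) : timeDegree (m + m') = timeDegree m + timeDegree m' := by
  rw [timeDegree, Finsupp.erase_add, map_add]
  rfl

theorem timeDegree_single (i : ℕ) :
    timeDegree (Finsupp.single i 1) = if i = 0 then 0 else 1 := by
  rw [timeDegree]
  split_ifs with h
  · rw [h, Finsupp.erase_single, map_zero]
  · rw [Finsupp.erase_single_ne (Ne.symm h), Finsupp.degree_single]

/-- The series of order at least `d` in the times. -/
def VanishTo (d : ℕ) (f : Fn) : Prop :=
  ∀ m, timeDegree m < d → MvPowerSeries.coeff m f = 0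

theorem VanishTo.zero (d : ℕ) : VanishTo d 0 := fun m _ => map_zero (MvPowerSeries.coeff m)

theorem VanishTo.add {d : ℕ} {f g : Fn} (hf : VanishTo d f) (hg : VanishTo d g) :
    VanishTo d (f + g) := fun m hm => by rw [map_add, hf m hm, hg m hm, add_zero]

theorem VanishTo.sub {d : ℕ} {f g : Fn} (hf : VanishTo d f) (hg : VanishTo d g) :
    VanishTo d (f - g) := fun m hm => by rw [map_sub, hf m hm, hg m hm, sub_zero]

theorem VanishTo.zsmul {d : ℕ} {f : Fn} (hf : VanishTo d f) (a : ℤ) : VanishTo d (a • f) :=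
  fun m hm => by rw [map_zsmul, hf m hm, smul_zero]

theorem VanishTo.mul_left {d : ℕ} {f : Fn} (hf : VanishTo d f) (g : Fn) : VanishTo d (g * f) := by
  classical
  intro m hm
  rw [MvPowerSeries.coeff_mul]
  refine Finset.sum_eq_zero fun q hq => ?_
  rw [Finset.HasAntidiagonal.mem_antidiagonal] at hq
  rw [hf q.2, mul_zero]
  rw [← hq, timeDegree_add] at hm
  omega

theorem VanishTo.pd_zero {d : ℕ} {f : Fn} (hf : VanishTo d f) : VanishTo d (pd 0 f) := by
  intro m hm
  rw [coeff_pd, hf, zero_mul]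
  rwa [timeDegree_add, timeDegree_single, if_pos rfl, add_zero]

theorem VanishTo.iterate_pd {d : ℕ} {f : Fn} (hf : VanishTo d f) (k : ℕ) :
    VanishTo d ((pd 0)^[k] f) := by
  induction k generalizing f with
  | zero => exact hf
  | succ k ih =>
    rw [Function.iterate_succ_apply]
    exact ih hf.pd_zero

theorem eq_zero_of_forall_vanishTo {f : Fn} (hf : ∀ d, VanishTo d f) : f = 0 := by
  ext m
  exact hf (timeDegree m + 1) m (Nat.lt_succ_self _)

/-- A function of `x, t₁, …, t_{p-1}` which vanishes at `t = 0` vanishes to one order more than its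
time derivatives. -/
theorem VanishTo.succ {p d : ℕ} {f : Fn} (h1 : setZero {i | p ≤ i} f = f)
    (h2 : setZero {i | 1 ≤ i} f = 0) (h3 : ∀ i, 1 ≤ i → i < p → VanishTo d (pd i f)) :
    VanishTo (d + 1) f := by
  classical
  intro m hm
  by_cases ha : ∀ i ∈ {i | 1 ≤ i}, m i = 0
  · have := congrArg (MvPowerSeries.coeff m) h2
    rwa [coeff_setZero, if_pos ha] at this
  · push Not at ha
    obtain ⟨i, hi, hmi⟩ := ha
    rw [Set.mem_ofPred_eq] at hi
    rcases lt_or_ge i p with hip | hip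
    · have hm' : m = m - Finsupp.single i 1 + Finsupp.single i 1 := by
        rw [tsub_add_cancel_of_le]
        rw [Finsupp.single_le_iff]
        omega
      have := h3 i hi hip (m - Finsupp.single i 1) (by
        rw [hm', timeDegree_add, timeDegree_single, if_neg (by omega)] at hm
        omega)
      rw [coeff_pd, ← hm'] at this
      -- A monomial containing t_i is recovered from the t_i-derivative, whose coefficient carries a
      -- nonzero integer factor.
      exact (mul_eq_zero.mp this).resolve_right (Nat.cast_add_one_ne_zero _)
    · rw [← h1, coeff_setZero, if_neg]
      intro h
      exact hmi (h i hip)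

theorem setZero_sub (S : Set ℕ) (f g : Fn) : setZero S (f - g) = setZero S f - setZero S g := by
  rw [← zeroHom_apply, map_sub, zeroHom_apply, zeroHom_apply]

theorem setZero_setZero {S T : Set ℕ} (h : S ⊆ T) (f : Fn) :
    setZero T (setZero S f) = setZero T f := by
  classical
  ext m
  rw [coeff_setZero, coeff_setZero, coeff_setZero]
  split_ifs with h1 h2
  · rfl
  · exact absurd (fun i hi => h1 i (h hi)) h2
  · rfl

/-! ### Uniqueness for the Lax equations -/

/-- Operators with coefficients of order at least `d` in the times. -/
def OpVanishTo (d : ℕ) (P : PsiDO) : Prop := ∀ j, VanishTo d (P.coeff j)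

theorem OpVanishTo.sub {d : ℕ} {P Q : PsiDO} (hP : OpVanishTo d P) (hQ : OpVanishTo d Q) :
    OpVanishTo d (P - Q) := fun j => by
  rw [PsiDO.coeff_sub]
  exact (hP j).sub (hQ j)

theorem OpVanishTo.add {d : ℕ} {P Q : PsiDO} (hP : OpVanishTo d P) (hQ : OpVanishTo d Q) :
    OpVanishTo d (P + Q) := fun j => by
  rw [PsiDO.coeff_add]
  exact (hP j).add (hQ j)

theorem OpVanishTo.mul_left {d : ℕ} {Q : PsiDO} (hQ : OpVanishTo d Q) (P : PsiDO) :
    OpVanishTo d (P * Q) := fun j => by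
  rw [PsiDO.coeff_mul_def]
  exact finsum_induction _ (VanishTo.zero d) (fun _ _ => VanishTo.add) fun q =>
    (((hQ _).iterate_pd q.2).mul_left _).zsmul _

theorem OpVanishTo.mul_right {d : ℕ} {P : PsiDO} (hP : OpVanishTo d P) (Q : PsiDO) :
    OpVanishTo d (P * Q) := fun j => by
  rw [PsiDO.coeff_mul_def]
  refine finsum_induction _ (VanishTo.zero d) (fun _ _ => VanishTo.add) fun q => ?_
  rw [mul_comm]
  exact ((hP _).mul_left _).zsmul _

theorem OpVanishTo.pow_sub_pow {d : ℕ} {L M : PsiDO} (h : OpVanishTo d (L - M)) (i : ℕ) :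
    OpVanishTo d (L ^ i - M ^ i) := by
  induction i with
  | zero =>
    rw [pow_zero, pow_zero, sub_self]
    exact fun _ => VanishTo.zero d
  | succ i ih =>
    have he : L ^ (i + 1) - M ^ (i + 1) = L * (L ^ i - M ^ i) + (L - M) * M ^ i := by
      rw [pow_succ', pow_succ']
      noncomm_ring
    rw [he]
    exact (ih.mul_left L).add (h.mul_right _)

theorem PsiDO.plus_sub (P Q : PsiDO) : P.plus - Q.plus = (P - Q).plus := by
  ext1; funext j
  rw [PsiDO.coeff_sub, PsiDO.coeff_plus, PsiDO.coeff_plus, PsiDO.coeff_plus, PsiDO.coeff_sub]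
  split_ifs
  · rfl
  · exact sub_zero 0

theorem OpVanishTo.plus {d : ℕ} {P : PsiDO} (hP : OpVanishTo d P) : OpVanishTo d P.plus :=
  fun j => by
    rw [PsiDO.coeff_plus]
    split_ifs
    · exact hP j
    · exact VanishTo.zero d

/-- Operators in `x, t₁, …, t_{p-1}` which agree at `t = 0` and satisfy the first `p - 1` Lax
equations are equal. -/
theorem lax_unique {p : ℕ} {L M : PsiDO} (hL : L.restrict {i | p ≤ i} = L)
    (hM : M.restrict {i | p ≤ i} = M) (h0 : L.restrict {i | 1 ≤ i} = M.restrict {i | 1 ≤ i})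
    (hL' : ∀ i, 1 ≤ i → i < p → L.timeDeriv i = (L ^ i).plus * L - L * (L ^ i).plus)
    (hM' : ∀ i, 1 ≤ i → i < p → M.timeDeriv i = (M ^ i).plus * M - M * (M ^ i).plus) : L = M := by
  have h : ∀ d, OpVanishTo d (L - M) := by
    intro d
    induction d with
    | zero => exact fun j m hm => absurd hm (Nat.not_lt_zero _)
    | succ d ih =>
      intro j
      rw [PsiDO.coeff_sub]
      refine VanishTo.succ (p := p) ?_ ?_ fun i h1 h2 => ?_
      · rw [setZero_sub, ← PsiDO.coeff_restrict, ← PsiDO.coeff_restrict, hL, hM]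
      · rw [setZero_sub, ← PsiDO.coeff_restrict, ← PsiDO.coeff_restrict, h0, sub_self]
      · have hd := (ih.pow_sub_pow i).plus
        rw [← PsiDO.plus_sub] at hd
        -- Each term contains L - M or the difference of the differential parts of L^i and M^i, all
        -- of order d in the times; so L - M has order d + 1.
        have he : L.timeDeriv i - M.timeDeriv i = ((L ^ i).plus - (M ^ i).plus) * L +
            (M ^ i).plus * (L - M) - ((L - M) * (L ^ i).plus +
              M * ((L ^ i).plus - (M ^ i).plus)) := by
          rw [hL' i h1 h2, hM' i h1 h2]
          noncomm_ring
        have hv := ((hd.mul_right L).add (ih.mul_left (M ^ i).plus)).sub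
          ((ih.mul_right (L ^ i).plus).add (hd.mul_left M))
        rw [← he] at hv
        have := hv j
        rwa [PsiDO.coeff_sub, PsiDO.coeff_timeDeriv, PsiDO.coeff_timeDeriv, ← pd_sub] at this
  refine sub_eq_zero.mp ?_
  ext1; funext j
  exact eq_zero_of_forall_vanishTo fun d => h d j

theorem PsiDO.restrict_restrict {S T : Set ℕ} (h : S ⊆ T) (P : PsiDO) :
    (P.restrict S).restrict T = P.restrict T := by
  ext1; funext j
  rw [PsiDO.coeff_restrict, PsiDO.coeff_restrict, PsiDO.coeff_restrict, setZero_setZero h]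

theorem monic_restrict {L : PsiDO} (hL : SymbolRing.Monic 1 L) (S : Set ℕ) :
    SymbolRing.Monic 1 (L.restrict S) := by
  refine ⟨fun j hj => ?_, ?_⟩
  · have := hL.le j hj
    rw [sc_psiDO] at this ⊢
    rw [PsiDO.coeff_restrict, this, ← zeroHom_apply, map_zero]
  · have := hL.top
    rw [sc_psiDO] at this ⊢
    rw [PsiDO.coeff_restrict, this, ← zeroHom_apply, map_one]

theorem IsLaxFlow.monic {T : Set ℕ} {L : PsiDO} (hL : IsLaxFlow T L) : SymbolRing.Monic 1 L :=
  ⟨fun j hj => (sc_psiDO L j).trans (hL.coeff_gt j hj), (sc_psiDO L 1).trans hL.coeff_one⟩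

variable {p n : ℕ} {w : ℂ} {θ : Fin (p - 1) → TimePoly p} {r : LaurentSeries (TimePoly p)}
  {P : TimePoly p}

/-- M^p does not involve t_{≥p}, and monic p-th roots are unique, so neither does M. -/
theorem IsLaxRoot.restrict_eq {M : PsiDO} (hp : 2 ≤ p) (hM : IsLaxRoot p n w θ M) :
    M.restrict {i | p ≤ i} = M := by
  refine pow_left_injective_psiDO (p := p) (by omega) (monic_restrict hM.monic _) hM.monic ?_
  rw [← PsiDO.restrict_pow (by simp; omega), hM.pow_eq, explicitLax_restrict_of_le hp]

/-- A solution of the Lax equations with the given initial value is the explicit one. -/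
theorem IsLaxRoot.eq_restrict {L M : PsiDO} (hp : 2 ≤ p) (hD : PotentialData p θ r P)
    (hM : IsLaxRoot p n w θ M) {T : Set ℕ} (hT : ∀ i, 1 ≤ i → i < p → i ∈ T)
    (hL : IsLaxFlow T L)
    (h0 : (L ^ p).restrict {i | 1 ≤ i} = laxOp (Polynomial.X ^ p) n w) :
    L.restrict {i | p ≤ i} = M := by
  have hS : (0 : ℕ) ∉ {i | p ≤ i} := by simp; omega
  refine lax_unique (p := p) (PsiDO.restrict_restrict subset_rfl L) (hM.restrict_eq hp) ?_
    (fun i h1 h2 => ?_) fun i h1 h2 => (hM.isLaxFlow hp hD).lax i ⟨h1, h2⟩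
  · have hsub : {i | p ≤ i} ⊆ {i | 1 ≤ i} := fun i hi =>
      le_trans (show 1 ≤ p by omega) hi
    rw [PsiDO.restrict_restrict hsub]
    -- The initial value is prescribed for L^p; uniqueness of monic roots transfers it to L.
    refine pow_left_injective_psiDO (p := p) (by omega) (monic_restrict hL.monic _)
      (monic_restrict hM.monic _) ?_
    rw [← PsiDO.restrict_pow (by simp), ← PsiDO.restrict_pow (by simp), h0, hM.pow_eq,
      explicitLax_restrict hp hD]
  · have hi : i ∉ {i | p ≤ i} := by simp; omega
    rw [← PsiDO.restrict_timeDeriv hi, hL.lax i (hT i h1 h2), PsiDO.restrict_sub,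
      PsiDO.restrict_mul hS, PsiDO.restrict_mul hS, PsiDO.restrict_plus, PsiDO.restrict_pow hS]

/-! ### Uniqueness for the wave functions -/

theorem PsiDO.exists_plusApply_eq_sum (Q : PsiDO) : ∃ N : ℕ, ∀ f : Fn,
    Q.plusApply f = ∑ j ∈ Finset.range (N + 1), Q.coeff j * dx j f := by
  obtain ⟨N, hN⟩ := Q.bdd
  exact ⟨N.toNat, PsiDO.plusApply_eq_sum fun j hj => hN j (by omega)⟩

theorem PsiDO.plusApply_sub (Q : PsiDO) (f g : Fn) :
    Q.plusApply (f - g) = Q.plusApply f - Q.plusApply g := by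
  obtain ⟨N, hN⟩ := Q.exists_plusApply_eq_sum
  rw [hN, hN, hN, ← Finset.sum_sub_distrib]
  refine Finset.sum_congr rfl fun j _ => ?_
  rw [map_sub, mul_sub]

theorem VanishTo.plusApply {d : ℕ} {f : Fn} (hf : VanishTo d f) (Q : PsiDO) :
    VanishTo d (Q.plusApply f) :=
  finsum_induction _ (VanishTo.zero d) (fun _ _ => VanishTo.add) fun j =>
    (hf.iterate_pd j).mul_left _

/-- A function of `x, t₁, …, t_{p-1}` which vanishes at `t = 0` and satisfies linear evolution
equations is zero. -/
theorem wave_unique {f : Fn} (h1 : setZero {i | p ≤ i} f = f)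
    (h2 : setZero {i | 1 ≤ i} f = 0) (ε : ℤ) (A : ℕ → PsiDO)
    (h3 : ∀ i, 1 ≤ i → i < p → pd i f = ε • (A i).plusApply f) : f = 0 := by
  refine eq_zero_of_forall_vanishTo fun d => ?_
  induction d with
  | zero => exact fun m hm => absurd hm (Nat.not_lt_zero _)
  | succ d ih =>
    refine VanishTo.succ h1 h2 fun i hi hip => ?_
    rw [h3 i hi hip]
    exact (ih.plusApply _).zsmul ε

/-- Uniqueness of the power series expansion of the zero function. -/
theorem eq_zero_of_hasSum_zero {a : ℕ → ℂ} (h : ∀ x : ℂ, HasSum (fun k => a k * x ^ k) 0) (k : ℕ) :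
    a k = 0 := by
  have h1 : HasFPowerSeriesAt (0 : ℂ → ℂ) (FormalMultilinearSeries.ofScalars ℂ a) 0 := by
    rw [hasFPowerSeriesAt_iff]
    refine Filter.Eventually.of_forall fun x => ?_
    simp only [FormalMultilinearSeries.coeff_ofScalars, smul_eq_mul, Pi.zero_apply]
    simpa only [mul_comm] using h x
  have h2 := h1.eq_zero
  rw [← FormalMultilinearSeries.coeff_ofScalars (𝕜 := ℂ) (p := a) (n := k), h2]
  rfl

theorem mon_point_eq_zero {x : ℂ} {t : Fin (p - 1) → ℂ} {m : ℕ →₀ ℕ} {i : ℕ}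
    (hi : point p x t i = 0) (hm : m i ≠ 0) : mon (point p x t) m = 0 :=
  Finset.prod_eq_zero (Finsupp.mem_support_iff.mpr hm) (by
    simp only [hi, zero_pow hm])

theorem HasValue.sub {f g : Fn} {v : ℕ → ℂ} {a b : ℂ} (hf : HasValue f v a) (hg : HasValue g v b) :
    HasValue (f - g) v (a - b) := by
  have := HasSum.sub hf hg
  rw [HasValue]
  simpa only [map_sub, sub_mul] using this

/-- At t = 0 only the pure powers of x contribute, leaving a power series in x whose sum vanishes
everywhere. -/
theorem setZero_eq_zero_of_hasValue {f : Fn} (h : ∀ x, HasValue f (point p x 0) 0) :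
    setZero {i | 1 ≤ i} f = 0 := by
  classical
  have hinj : Function.Injective fun k : ℕ => Finsupp.single 0 k := Finsupp.single_injective 0
  have hpt : ∀ (x : ℂ) (i : ℕ), 1 ≤ i → point p x 0 i = 0 := by
    intro x i hi
    rw [point, if_neg (by omega)]
    split_ifs <;> rfl
  have hsum : ∀ x : ℂ, HasSum (fun k => MvPowerSeries.coeff (Finsupp.single 0 k) f * x ^ k) 0 := by
    intro x
    have h1 := h x
    rw [HasValue, ← hinj.hasSum_iff] at h1
    · refine h1.congr_fun fun k => ?_
      have h2 : point p x 0 0 = x := if_pos rfl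
      simp [Finsupp.prod_single_index, h2]
    · intro m hm
      have hex : ∃ i, 1 ≤ i ∧ m i ≠ 0 := by
        by_contra hne
        push Not at hne
        refine hm ⟨m 0, ?_⟩
        ext i
        rcases Nat.eq_zero_or_pos i with rfl | hi
        · simp
        · rw [hne i hi]
          simp [Nat.pos_iff_ne_zero.mp hi]
      obtain ⟨i, hi, hmi⟩ := hex
      exact mul_eq_zero_of_right _ (mon_point_eq_zero (hpt x i hi) hmi)
  ext m
  rw [coeff_setZero]
  split_ifs with hm
  · have : m = Finsupp.single 0 (m 0) := by
      ext i
      rcases Nat.eq_zero_or_pos i with rfl | hi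
      · simp
      · rw [hm i hi]
        simp [Nat.pos_iff_ne_zero.mp hi]
    rw [this, eq_zero_of_hasSum_zero hsum, map_zero]
  · rw [map_zero]

/-- At a point with t_{≥p} = 0 the monomials containing such a time contribute nothing, so the value
sees only the restricted series. -/
theorem hasValue_congr (hp : 1 ≤ p) {f g : Fn} (h : setZero {i | p ≤ i} f = setZero {i | p ≤ i} g) {x : ℂ}
    {t : Fin (p - 1) → ℂ} {c : ℂ} (hf : HasValue f (point p x t) c) :
    HasValue g (point p x t) c := by
  classical
  refine HasSum.congr_fun hf fun m => ?_
  by_cases hm : ∀ i ∈ {i | p ≤ i}, m i = 0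
  · have := congrArg (MvPowerSeries.coeff m) h
    rw [coeff_setZero, coeff_setZero, if_pos hm, if_pos hm] at this
    rw [this]
  · push Not at hm
    obtain ⟨i, hi, hmi⟩ := hm
    rw [Set.mem_ofPred_eq] at hi
    have h0 : mon (point p x t) m = 0 := by
      refine mon_point_eq_zero (i := i) ?_ hmi
      rw [point]
      split_ifs with h1 h2
      · subst h1
        omega
      · omega
      · rfl
    exact (mul_eq_zero_of_right _ h0).trans (mul_eq_zero_of_right _ h0).symm

theorem restrict_signed {S : Set ℕ} (hS : 0 ∉ S) (ε : ℤ) (L : PsiDO) :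
    (signed ε L).restrict S = signed ε (L.restrict S) := by
  rw [signed, signed]
  split_ifs
  · rfl
  · exact PsiDO.restrict_adjoint hS L

theorem IsWaveFlow.setZero {ε : ℤ} {M Ψ} {T : Set ℕ} (hT : ∀ i, 1 ≤ i → i < p → i ∈ T)
    (h : IsWaveFlow T ε M Ψ) (i : ℕ) (h1 : 1 ≤ i) (h2 : i < p) :
    pd i (setZero {i | p ≤ i} Ψ) = ε • (M.restrict {i | p ≤ i} ^ i).plusApply
      (setZero {i | p ≤ i} Ψ) := by
  have hS : (0 : ℕ) ∉ {i | p ≤ i} := by simp; omega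
  have hi : i ∉ {i | p ≤ i} := by simp; omega
  rw [pd_setZero hi, h i (hT i h1 h2), ← zeroHom_apply, map_zsmul, zeroHom_apply,
    PsiDO.setZero_plusApply hS, PsiDO.restrict_pow hS]

theorem signed_one (L : PsiDO) : signed 1 L = L := if_pos rfl

theorem signed_neg_one (L : PsiDO) : signed (-1) L = L.adjoint := if_neg (by decide)

/-- Two solutions of the wave equations with the same values at `t = 0` have the same values. -/
theorem wave_hasValue_unique {ε : ℤ} {M M' Ψ Φ} {T T' : Set ℕ}
    (hT : ∀ i, 1 ≤ i → i < p → i ∈ T) (hT' : ∀ i, 1 ≤ i → i < p → i ∈ T')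
    (hM : M.restrict {i | p ≤ i} = M'.restrict {i | p ≤ i})
    (hΨ : IsWaveFlow T ε M Ψ) (hΦ : IsWaveFlow T' ε M' Φ) {c : ℂ → ℂ} (hp : 1 ≤ p)
    (h1 : ∀ x, HasValue Ψ (point p x 0) (c x)) (h2 : ∀ x, HasValue Φ (point p x 0) (c x))
    {x : ℂ} {t : Fin (p - 1) → ℂ} {b : ℂ} (hb : HasValue Φ (point p x t) b) :
    HasValue Ψ (point p x t) b := by
  refine hasValue_congr hp (sub_eq_zero.mp ?_) hb
  -- The difference of the restricted solutions satisfies the same linear equations and vanishes at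
  -- t = 0.
  refine wave_unique (p := p) ?_ ?_ ε (fun i => M.restrict {i | p ≤ i} ^ i) fun i h3 h4 => ?_
  · rw [setZero_sub, setZero_setZero subset_rfl, setZero_setZero subset_rfl]
  · have hsub : {i | p ≤ i} ⊆ {i | 1 ≤ i} := fun i hi => le_trans hp hi
    rw [setZero_sub, setZero_setZero hsub, setZero_setZero hsub, ← setZero_sub]
    refine setZero_eq_zero_of_hasValue (p := p) fun x => ?_
    simpa only [sub_self] using (h2 x).sub (h1 x)
  · rw [pd_sub, hΨ.setZero hT i h3 h4, hΦ.setZero hT' i h3 h4, PsiDO.plusApply_sub, smul_sub, hM]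

/-- The explicit wave functions solve the evolution equations and the eigenvalue equation. -/
theorem exists_wave {L : PsiDO} {ε : ℤ} {Γ : Finset ℕ} (hp : 2 ≤ p) (hD : PotentialData p θ r P)
    (hL : IsLaxRoot p n w θ L) (hε : ε = 1 ∨ ε = -1) (h : IsDecayContour p ε w (ε * n) Γ) (z : ℂ) :
    ∃ Ψ : Fn, IsWaveFlow {i | 1 ≤ i ∧ i < p} ε (signed ε L) Ψ ∧
      IsEigenfunction n w ε (signed ε (L ^ p)) (z ^ p) Ψ ∧
      (∀ x, HasValue Ψ (point p x 0) (initialWave p n w Γ ε x z)) ∧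
      ∀ x t, HasValue Ψ (point p x t) (explicitWave p n w Γ ε θ P x t z) := by
  have hv := hasValue_formalWave (show 1 ≤ p by omega) hD h z
  refine ⟨_, formalWave_isWaveFlow hp hD hL hε _, ?_, fun x => ?_, hv⟩
  · rw [hL.pow_eq]
    exact isEigenfunction_formalWave hp hD hε h z
  · rw [← explicitWave_zero n hD]
    exact hv x 0

/-- Wave functions which flow off the initial data are the explicit ones. -/
theorem IsWaveFlow.hasValue {L M : PsiDO} {ε : ℤ} {Γ : Finset ℕ} {T : Set ℕ} {z : ℂ} {Ψ : Fn}
    (hp : 2 ≤ p) (hD : PotentialData p θ r P) (hM : IsLaxRoot p n w θ M)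
    (hε : ε = 1 ∨ ε = -1) (h : IsDecayContour p ε w (ε * n) Γ)
    (hT : ∀ i, 1 ≤ i → i < p → i ∈ T) (hL : L.restrict {i | p ≤ i} = M)
    (hΨ : IsWaveFlow T ε (signed ε L) Ψ)
    (h0 : ∀ x, HasValue Ψ (point p x 0) (initialWave p n w Γ ε x z)) (x : ℂ)
    (t : Fin (p - 1) → ℂ) : HasValue Ψ (point p x t) (explicitWave p n w Γ ε θ P x t z) := by
  obtain ⟨Φ, h1, -, h2, h3⟩ := exists_wave hp hD hM hε h z
  have hS : (0 : ℕ) ∉ {i | p ≤ i} := by simp; omega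
  refine wave_hasValue_unique hT (T' := {i | 1 ≤ i ∧ i < p}) (fun i h1 h2 => ⟨h1, h2⟩) ?_ hΨ h1 (by omega) h0 h2 (h3 x t)
  rw [restrict_signed hS, restrict_signed hS, hL, hM.restrict_eq hp]

end

end KPAiry

end

open KPAiry in
theorem proposition3p6 (p n : ℕ) (hp : 2 ≤ p) (w : ℝ) (Γp Γm : Finset ℕ)
    (hΓp : ∀ l ∈ Γp, ∃ j ≤ (p + 1) / 2, l = 2 * j)
    (hΓm : ∀ l ∈ Γm, ∃ j ≤ p / 2, l = 2 * j + 1) :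
    ∃ (θ : Fin (p - 1) → TimePoly p) (P : TimePoly p),
      (∀ θ', IsTimeParam p θ' ↔ θ' = θ) ∧ (∀ P', IsPrefactor p θ P' ↔ P' = P) ∧
      -- the integrals converge absolutely
      (∀ x t z, ContourIntegrable p Γp (integrand p n w 1 (potentialAt p θ t) x z)) ∧
      ((n = 0 ∨ (w : ℂ) ∉ contourSet p Γm) →
        ∀ x t z, ContourIntegrable p Γm (integrand p n w (-1) (potentialAt p θ t) x z)) ∧
      -- every solution flowing off the initial data has the stated form at `t_{≥ p} = 0`
      (∀ T : Set ℕ, (∀ i, 1 ≤ i → i < p → i ∈ T) → ∀ L : PsiDO, IsLaxFlow T L →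
        (L ^ p).restrict {i | 1 ≤ i} = laxOp (Polynomial.X ^ p) n w →
          (L ^ p).restrict {i | p ≤ i} = explicitLax p n w θ ∧
          (∀ z : ℂ, z ≠ 0 → ∀ Ψ : Fn, IsWaveFlow T 1 L Ψ →
            (∀ x, HasValue Ψ (point p x 0) (initialWave p n w Γp 1 x z)) →
            ∀ x t, HasValue Ψ (point p x t) (explicitWave p n w Γp 1 θ P x t z)) ∧
          ((n = 0 ∨ (w : ℂ) ∉ contourSet p Γm) →
            ∀ z : ℂ, z ≠ 0 → ∀ Ψ : Fn, IsWaveFlow T (-1) L.adjoint Ψ →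
            (∀ x, HasValue Ψ (point p x 0) (initialWave p n w Γm (-1) x z)) →
            ∀ x t, HasValue Ψ (point p x t) (explicitWave p n w Γm (-1) θ P x t z))) ∧
      -- and these expressions do flow along `t_1, …, t_{p-1}`
      (∃ L : PsiDO, IsLaxFlow {i | 1 ≤ i ∧ i < p} L ∧ L ^ p = explicitLax p n w θ ∧
        (L ^ p).restrict {i | 1 ≤ i} = laxOp (Polynomial.X ^ p) n w ∧
        (∀ z : ℂ, z ≠ 0 → ∃ Ψ : Fn, IsWaveFlow {i | 1 ≤ i ∧ i < p} 1 L Ψ ∧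
          IsEigenfunction n w 1 (L ^ p) (z ^ p) Ψ ∧
          (∀ x, HasValue Ψ (point p x 0) (initialWave p n w Γp 1 x z)) ∧
          ∀ x t, HasValue Ψ (point p x t) (explicitWave p n w Γp 1 θ P x t z)) ∧
        ((n = 0 ∨ (w : ℂ) ∉ contourSet p Γm) →
          ∀ z : ℂ, z ≠ 0 → ∃ Ψ : Fn, IsWaveFlow {i | 1 ≤ i ∧ i < p} (-1) L.adjoint Ψ ∧
          IsEigenfunction n w (-1) (L ^ p).adjoint (z ^ p) Ψ ∧
          (∀ x, HasValue Ψ (point p x 0) (initialWave p n w Γm (-1) x z)) ∧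
          ∀ x t, HasValue Ψ (point p x t) (explicitWave p n w Γm (-1) θ P x t z))) := by
  obtain ⟨θ, r, P, hD, hθ, hP⟩ := exists_potentialData hp
  obtain ⟨M, hM⟩ := exists_isLaxRoot hp n w hD.isRoot
  have hp1 : 1 ≤ p := by omega
  have hplus : IsDecayContour p 1 w (1 * n) Γp := by
    refine isDecayContour (fun l hl => ?_) (Or.inl (by positivity))
    obtain ⟨j, -, rfl⟩ := hΓp l hl
    simp
  have hminus : n = 0 ∨ (w : ℂ) ∉ contourSet p Γm → IsDecayContour p (-1) w (-1 * n) Γm := by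
    intro h
    -- For n = 0 the exponent -n is not negative, and no condition on w is needed.
    refine isDecayContour (fun l hl => ?_) (h.imp_left fun h => by simp [h])
    obtain ⟨j, -, rfl⟩ := hΓm l hl
    simp [pow_succ]
  refine ⟨θ, P, hθ, hP, fun x t z => hplus.integrable_integrand hp1 θ t x z,
    fun h x t z => (hminus h).integrable_integrand hp1 θ t x z, ?_, M, hM.isLaxFlow hp hD, hM.pow_eq,
    by rw [hM.pow_eq, explicitLax_restrict hp hD], fun z _ => ?_, fun h z _ => ?_⟩
  · intro T hT L hL h0
    have hLM := hM.eq_restrict hp hD hT hL h0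
    refine ⟨?_, fun z _ Ψ hΨ hv => ?_, fun h z _ Ψ hΨ hv => ?_⟩
    · rw [PsiDO.restrict_pow (by simp; omega), hLM, hM.pow_eq]
    · rw [← signed_one L] at hΨ
      exact hΨ.hasValue hp hD hM (Or.inl rfl) hplus hT hLM hv
    · rw [← signed_neg_one L] at hΨ
      exact hΨ.hasValue hp hD hM (Or.inr rfl) (hminus h) hT hLM hv
  · have := exists_wave hp hD hM (Or.inl rfl) hplus z
    rwa [signed_one, signed_one] at this
  · have := exists_wave hp hD hM (Or.inr rfl) (hminus h) z
    rwa [signed_neg_one, signed_neg_one] at this
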